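/- **Conventions.** A *directed graph* $E$ is a graph in the sense of Serre: a set $E^0$ of vertices, a set $E^1$ of edges, origin and terminus maps $o,t:E^1\to E^0$, and a fixed-point-free involution $e\mapsto\bar e$ of $E^1$ (reversal) with $o(\bar e)=t(e)$, together with a set $E^1_+\subseteq E^1$ of *directed* edges containing exactly one of $e,\bar e$ for every $e$. Put $\Delta_{1,E}(v)=\{e\in E^1_+ : o(e)=v\}$, and let $\Sigma(E)$ be the set of vertices $v$ for which $\Delta_{1,E}(v)$ is finite and nonempty. $V_E(v)$ is the set of termini of finite directed paths (of length $\ge 0$) from $v$; for finite $F\subseteq\Delta_{1,E}(v)$, $V_E(v;F)$ is the set of termini of those that do not begin with an edge of $F$. An *inclusion* $E_1\subseteq E_2$ is a pair of injective maps on vertices and edges which intertwine $o$, $t$ and reversal and take directed edges to directed edges; we write $E_1$ for its image. $G(E)$ is the groupoid of finite reduced paths in $E$ (directed and reversed edges allowed, including the paths of length zero), under concatenation followed by cancellation, with range $o$ and source $t$. $\widetilde E$ is the directed graph (a disjoint union of directed trees) whose vertices are these paths and whose (directed) edges are the pairs $(p,q)$ with $o(p)=o(q)$ and $p^{-1}q$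 a (directed) edge of $E$. $\mathcal A(\widetilde E)$ is the Boolean ring of finite disjoint unions of sets $V_{\widetilde E}(p;F)$, with $p$ a vertex of $\widetilde E$ and $F\subseteq\Delta_{1,\widetilde E}(p)$ finite. For $S\subseteq\Sigma(E)$ let $\widetilde S=t^{-1}(S)\subseteq\widetilde E^0$, and let $\partial(\widetilde E,\widetilde S)$ be the Stone space of ultrafilters of $\mathcal A(\widetilde E)$ with the fixed ultrafilters of the points of $\widetilde S$ removed; equivalently, the spectrum of $A(\widetilde E)/C_0(\widetilde S)$, where $A(\widetilde E)\subseteq\ell^\infty(\widetilde E^0)$ is the closed span of the characteristic functions of the sets in $\mathcal A(\widetilde E)$. $G(E)$ acts on $\partial(\widetilde E,\widetilde S)$ by left translation. $X(E,S)\subseteq\partial(\widetilde E,\widetilde S)$ is the set of points represented by finite or infinite directed paths of $E$ (i.e. directed paths of $\widetilde E$ starting at a path of length zero). $TG(E,S)$ is the restriction to $X(E,S)$ of the transformation groupoid of this action (with $G(E)$ discrete), and $\mathcal{TO}(E,S)=C^*(TG(E,S))$ is the completion of the convolution $*$-algebra $C_c(TG(E,S))$ in the supremum of the seminorms given by all of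 its $*$-representations on Hilbert spaces. For $u\in E^0$ and $e\in E^1_+$ let $P_u\in\mathcal{TO}(E,S)$ be the characteristic function of the set of units at the points of $X(E,S)$ represented by directed paths starting at $u$, and let $S_e$ be the characteristic function of the set of $(e,x)\in TG(E,S)$ with $x$ represented by a directed path starting at $t(e)$. **Theorem 2.34.** Let $E_1\subseteq E_2$ be an inclusion of directed graphs, let $S_2\subseteq\Sigma(E_2)$, and put $$S_1=\{v\in E_1^0\cap S_2 \;:\; \Delta_{1,E_2}(v)\subseteq (E_1)^1_+\}\subseteq\Sigma(E_1).\tag{$*$}$$ Then there is an injective $*$-homomorphism $\mathcal{TO}(E_1,S_1)\to\mathcal{TO}(E_2,S_2)$. These can be chosen, for all such data simultaneously, so that $P_u\mapsto P_u$ for $u\in E_1^0$ and $S_e\mapsto S_e$ for $e\in (E_1)^1_+$, so that the identity inclusion of $E$ (for which $S_1=S_2$) gives the identity map, and so that they are compatible with composition: if $E_1\subseteq E_2\subseteq E_3$, $S_3\subseteq\Sigma(E_3)$, $S_2$ is obtained from $S_3$ by $(*)$ and $S_1$ from $S_2$ by $(*)$ (so that $S_1$ is also the set obtained by $(*)$ from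 $S_3$ and the inclusion $E_1\subseteq E_3$), then the map $\mathcal{TO}(E_1,S_1)\to\mathcal{TO}(E_3,S_3)$ is the composition of $\mathcal{TO}(E_1,S_1)\to\mathcal{TO}(E_2,S_2)$ and $\mathcal{TO}(E_2,S_2)\to\mathcal{TO}(E_3,S_3)$. Thus $(E,S)\mapsto\mathcal{TO}(E,S)$ is a functor to C*-algebras with injective $*$-homomorphisms, defined on the category of pairs $(E,S)$ with $S\subseteq\Sigma(E)$, whose morphisms $(E_1,S_1)\to(E_2,S_2)$ are the inclusions $E_1\subseteq E_2$ for which $S_1$ is the set induced by $S_2$ through $(*)$. -/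

import Mathlib

open Set Topology
open scoped CompactlySupported ENNReal

universe u

/-- A directed graph: a graph in the sense of Serre (every edge `e` has a reversal `rev e ≠ e`),
with a set `pos` of (directed) edges containing exactly one edge of each pair `{e, rev e}`. -/
structure DirectedGraph where
  /-- vertices -/
  V : Type u
  /-- edges, in both orientations -/
  Edge : Type u
  /-- origin -/
  o : Edge → V
  /-- terminus -/
  t : Edge → V
  /-- reversal -/
  rev : Edge → Edge
  rev_rev : ∀ e, rev (rev e) = e
  rev_ne : ∀ e, rev e ≠ e
  o_rev : ∀ e, o (rev e) = t e
  /-- directed edges -/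
  pos : Set Edge
  rev_mem_pos_iff : ∀ e, rev e ∈ pos ↔ e ∉ pos

namespace DirectedGraph

section Tree

variable (T : DirectedGraph.{u})

/-- There is a directed edge from `v` to `w`. -/
def Step (v w : T.V) : Prop := ∃ e ∈ T.pos, T.o e = v ∧ T.t e = w

/-- `V(v)`: the vertices at the end of a finite directed path (possibly of length zero) starting
at `v`. -/
def reach (v : T.V) : Set T.V := {w | Relation.ReflTransGen T.Step v w}

/-- `Δ₁(v)`: the directed edges with origin `v`. -/
def out (v : T.V) : Set T.Edge := {e | e ∈ T.pos ∧ T.o e = v}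

/-- `Σ(T)`: the vertices with finite nonzero exit valence. -/
def regular : Set T.V := {v | (T.out v).Nonempty ∧ (T.out v).Finite}

/-- `V(v;F)`: the vertices at the end of a finite directed path starting at `v` and not beginning
with an edge of `F`. -/
def reachOff (v : T.V) (F : Set T.Edge) : Set T.V := {v} ∪ ⋃ e ∈ T.out v \ F, T.reach (T.t e)

/-- The collection `ℰ(T)`: the empty set and the sets `V(v;F)`, `F ⊆ Δ₁(v)` finite. -/
def basicSets : Set (Set T.V) :=
  {B | B = ∅ ∨ ∃ (v : T.V) (F : Set T.Edge), F ⊆ T.out v ∧ F.Finite ∧ B = T.reachOff v F}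

/-- The collection `𝒜(T)` of finite disjoint unions of sets from `ℰ(T)`. For a directed tree, or a
disjoint union of directed trees, it is a Boolean ring of sets. -/
def boolRing : Set (Set T.V) :=
  {B | ∃ I : Finset (Set T.V), (I : Set (Set T.V)) ⊆ T.basicSets ∧
    (I : Set (Set T.V)).PairwiseDisjoint id ∧ B = ⋃₀ (I : Set (Set T.V))}

/-- Proper filters in the Boolean ring `𝒜(T)`. -/
structure IsFilter (U : Set (Set T.V)) : Prop where
  subset : U ⊆ T.boolRing
  nonempty : U.Nonempty
  empty_notMem : ∅ ∉ U
  inter_mem : ∀ B ∈ U, ∀ C ∈ U, B ∩ C ∈ U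
  mem_of_superset : ∀ B ∈ U, ∀ C ∈ T.boolRing, B ⊆ C → C ∈ U

/-- The Stone space of `𝒜(T)`: its points are the ultrafilters (maximal proper filters) of `𝒜(T)`.
It is the spectrum of the commutative C*-algebra `A(T) ⊆ ℓ^∞(T⁰)` spanned by the characteristic
functions of the sets in `𝒜(T)`. -/
@[ext]
structure Spectrum : Type u where
  /-- the sets belonging to the ultrafilter -/
  sets : Set (Set T.V)
  maximal : Maximal T.IsFilter sets

/-- `[B]`: the ultrafilters containing `B`. -/
def cyl (B : Set T.V) : Set T.Spectrum := {x | B ∈ x.1}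

/-- The Stone topology: the sets `[B]`, `B ∈ 𝒜(T)`, form a subbase (in fact a base). -/
instance : TopologicalSpace T.Spectrum :=
  TopologicalSpace.generateFrom {O | ∃ B ∈ T.boolRing, O = T.cyl B}

/-- The fixed ultrafilter of a vertex. -/
def fixedFilter (v : T.V) : Set (Set T.V) := {B | B ∈ T.boolRing ∧ v ∈ B}

/-- The ultrafilter of an infinite directed path with vertices `p 0, p 1, …`. -/
def endFilter (p : ℕ → T.V) : Set (Set T.V) := {B | B ∈ T.boolRing ∧ ∃ j, T.reach (p j) ⊆ B}

/-- `∂(T,S)` for `S ⊆ Σ(T)`: the complement, in the spectrum of `A(T)`, of the set `S` of vertices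
(viewed as fixed ultrafilters). It is the spectrum of `A(T,S) = A(T)/C₀(S)`. -/
def boundary (S : Set T.V) : Set T.Spectrum := {x | ∀ v ∈ S, x.1 ≠ T.fixedFilter v}

/-- The combinatorial properties of a disjoint union of directed trees that make `𝒜(T)` a ring. -/
structure Branching : Prop where
  notMem_reach : ∀ e ∈ T.pos, T.o e ∉ T.reach (T.t e)
  disjoint : ∀ e ∈ T.pos, ∀ f ∈ T.pos, T.o e = T.o f → e ≠ f →
    Disjoint (T.reach (T.t e)) (T.reach (T.t f))
  meet : ∀ u v, Disjoint (T.reach u) (T.reach v) ∨ ∃ m, T.reach u ∩ T.reach v = T.reach m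

variable {T}

theorem self_mem_reach (v : T.V) : v ∈ T.reach v := Relation.ReflTransGen.refl

theorem reach_subset {v w : T.V} (h : w ∈ T.reach v) : T.reach w ⊆ T.reach v :=
  fun _ hx => Relation.ReflTransGen.trans h hx

theorem reach_edge_subset {v : T.V} {e : T.Edge} (h : e ∈ T.out v) :
    T.reach (T.t e) ⊆ T.reach v :=
  reach_subset (Relation.ReflTransGen.single ⟨e, h.1, h.2, rfl⟩)

theorem mem_reach_cases {v w : T.V} (h : w ∈ T.reach v) :
    w = v ∨ ∃ e ∈ T.out v, w ∈ T.reach (T.t e) := by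
  rcases Relation.ReflTransGen.cases_head h with h | ⟨c, ⟨e, he, ho, ht⟩, hc⟩
  · exact Or.inl h.symm
  · exact Or.inr ⟨e, ⟨he, ho⟩, by rw [ht]; exact hc⟩

theorem reachOff_subset_reach (v : T.V) (F : Set T.Edge) : T.reachOff v F ⊆ T.reach v := by
  rintro w (h | h)
  · rw [mem_singleton_iff.1 h]; exact self_mem_reach v
  · simp only [mem_iUnion] at h
    obtain ⟨e, he, h⟩ := h
    exact reach_edge_subset he.1 h

theorem reachOff_empty (v : T.V) : T.reachOff v ∅ = T.reach v := by
  refine (reachOff_subset_reach v ∅).antisymm fun w h => ?_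
  rcases mem_reach_cases h with h | ⟨e, he, h⟩
  · exact Or.inl h
  · exact Or.inr (by simp only [mem_iUnion]; exact ⟨e, ⟨he, notMem_empty e⟩, h⟩)

theorem basic_mem_ring {B : Set T.V} (h : B ∈ T.basicSets) : B ∈ T.boolRing :=
  ⟨{B}, by simpa using h, by simp, by simp⟩

theorem reachOff_mem_basic {v : T.V} {F : Set T.Edge} (h : F ⊆ T.out v) (hF : F.Finite) :
    T.reachOff v F ∈ T.basicSets := Or.inr ⟨v, F, h, hF, rfl⟩

theorem reach_mem_basic (v : T.V) : T.reach v ∈ T.basicSets := by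
  rw [← reachOff_empty]; exact reachOff_mem_basic (empty_subset _) finite_empty

theorem empty_mem_ring : (∅ : Set T.V) ∈ T.boolRing := basic_mem_ring (Or.inl rfl)

theorem reach_mem_ring (v : T.V) : T.reach v ∈ T.boolRing := basic_mem_ring (reach_mem_basic v)

theorem disjUnion_mem_ring {B C : Set T.V} (hB : B ∈ T.boolRing) (hC : C ∈ T.boolRing)
    (h : Disjoint B C) : B ∪ C ∈ T.boolRing := by
  classical
  obtain ⟨I, hI, dI, rfl⟩ := hB
  obtain ⟨J, hJ, dJ, rfl⟩ := hC
  refine ⟨I ∪ J, by rw [Finset.coe_union]; exact union_subset hI hJ, ?_, ?_⟩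
  · rw [Finset.coe_union]
    refine pairwiseDisjoint_union.2 ⟨dI, dJ, fun i hi j hj _ => ?_⟩
    exact h.mono (subset_sUnion_of_mem hi) (subset_sUnion_of_mem hj)
  · rw [Finset.coe_union, sUnion_union]

theorem biUnion_mem_ring {ι : Type*} {F : Set ι} (hF : F.Finite) (B : ι → Set T.V)
    (hB : ∀ e ∈ F, B e ∈ T.boolRing) (hd : F.PairwiseDisjoint B) :
    (⋃ e ∈ F, B e) ∈ T.boolRing := by
  induction F, hF using Set.Finite.induction_on with
  | empty => simpa using empty_mem_ring
  | @insert a s ha hs ih =>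
    rw [biUnion_insert]
    refine disjUnion_mem_ring (hB a (mem_insert _ _))
      (ih (fun e he => hB e (mem_insert_of_mem _ he)) (hd.subset (subset_insert _ _))) ?_
    simp only [disjoint_iUnion_right]
    intro i hi
    exact hd (mem_insert _ _) (mem_insert_of_mem _ hi) (fun h => ha (h ▸ hi))

namespace Branching

theorem reachOff_eq (hT : T.Branching) {v : T.V} {F : Set T.Edge} (hF : F ⊆ T.out v) :
    T.reachOff v F = T.reach v \ ⋃ e ∈ F, T.reach (T.t e) := by
  ext w
  constructor
  · intro h
    refine ⟨reachOff_subset_reach v F h, ?_⟩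
    simp only [mem_iUnion, not_exists]
    intro f hf hw
    rcases h with h | h
    · rw [mem_singleton_iff.1 h] at hw
      have := hT.notMem_reach f (hF hf).1
      rw [(hF hf).2] at this
      exact this hw
    · simp only [mem_iUnion] at h
      obtain ⟨e, he, h⟩ := h
      refine Set.disjoint_left.1 (hT.disjoint e he.1.1 f (hF hf).1 ?_ ?_) h hw
      · rw [he.1.2, (hF hf).2]
      · rintro rfl; exact he.2 hf
  · rintro ⟨h, hn⟩
    rcases mem_reach_cases h with h | ⟨e, he, h⟩
    · exact Or.inl h
    · refine Or.inr ?_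
      simp only [mem_iUnion] at hn ⊢
      exact ⟨e, ⟨he, fun hf => hn ⟨e, hf, h⟩⟩, h⟩

/-- A vertex of `V(u)` is `u`, or lies behind an edge, so that `V(w)` avoids or is contained in
`V(u;F)`. -/
theorem cases_reachOff (hT : T.Branching) {u w : T.V} {F : Set T.Edge} (hF : F ⊆ T.out u)
    (hw : w ∈ T.reach u) (hne : w ≠ u) :
    ∃ e ∈ T.out u, w ∈ T.reach (T.t e) ∧
      ((e ∈ F ∧ Disjoint (T.reachOff u F) (T.reach (T.t e))) ∨
        (e ∉ F ∧ T.reach (T.t e) ⊆ T.reachOff u F)) := by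
  rcases mem_reach_cases hw with h | ⟨e, he, h⟩
  · exact absurd h hne
  · refine ⟨e, he, h, ?_⟩
    by_cases hf : e ∈ F
    · refine Or.inl ⟨hf, ?_⟩
      rw [hT.reachOff_eq hF]
      refine Set.disjoint_left.2 fun x hx hx' => hx.2 ?_
      simp only [mem_iUnion]
      exact ⟨e, hf, hx'⟩
    · refine Or.inr ⟨hf, fun x hx => Or.inr ?_⟩
      simp only [mem_iUnion]
      exact ⟨e, ⟨he, hf⟩, hx⟩

theorem inter_mem_basic (hT : T.Branching) {B C : Set T.V} (hB : B ∈ T.basicSets)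
    (hC : C ∈ T.basicSets) : B ∩ C ∈ T.basicSets := by
  rcases hB with rfl | ⟨u, F, hF, fF, rfl⟩
  · exact Or.inl (empty_inter _)
  rcases hC with rfl | ⟨v, G, hG, fG, rfl⟩
  · exact Or.inl (inter_empty _)
  have hBu := reachOff_subset_reach u F
  have hCv := reachOff_subset_reach v G
  by_cases huv : u = v
  · subst huv
    refine Or.inr ⟨u, F ∪ G, union_subset hF hG, fF.union fG, ?_⟩
    rw [hT.reachOff_eq hF, hT.reachOff_eq hG, hT.reachOff_eq (union_subset hF hG),
      biUnion_union]
    ext x; simp only [mem_inter_iff, mem_sdiff, mem_union]; tauto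
  rcases hT.meet u v with hd | ⟨m, hm⟩
  · exact Or.inl (disjoint_iff_inter_eq_empty.1 (hd.mono hBu hCv))
  have hmm : m ∈ T.reach u ∩ T.reach v := hm ▸ self_mem_reach m
  have key : ∀ (w : T.V) (H : Set T.Edge), H ⊆ T.out w → m ∈ T.reach w → m ≠ w →
      Disjoint (T.reachOff w H) (T.reach m) ∨ T.reach m ⊆ T.reachOff w H := by
    intro w H hH h1 h2
    obtain ⟨e, _, h3, h4⟩ := hT.cases_reachOff hH h1 h2
    rcases h4 with h4 | h4
    · exact Or.inl (h4.2.mono_right (reach_subset h3))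
    · exact Or.inr ((reach_subset h3).trans h4.2)
  have hsub : T.reachOff u F ∩ T.reachOff v G ⊆ T.reach m := by
    rw [← hm]; exact inter_subset_inter hBu hCv
  by_cases h1 : m = u
  · subst h1
    rcases key v G hG hmm.2 huv with h | h
    · exact Or.inl (disjoint_iff_inter_eq_empty.1 (h.symm.mono_left hBu))
    · rw [inter_eq_left.2 (hBu.trans h)]; exact reachOff_mem_basic hF fF
  by_cases h2 : m = v
  · subst h2
    rcases key u F hF hmm.1 h1 with h | h
    · exact Or.inl (disjoint_iff_inter_eq_empty.1 (h.mono_right hCv))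
    · rw [inter_eq_right.2 (hCv.trans h)]; exact reachOff_mem_basic hG fG
  rcases key u F hF hmm.1 h1 with h | h
  · refine Or.inl (eq_empty_of_forall_notMem fun x hx => ?_)
    exact Set.disjoint_left.1 h hx.1 (hsub hx)
  rcases key v G hG hmm.2 h2 with h' | h'
  · refine Or.inl (eq_empty_of_forall_notMem fun x hx => ?_)
    exact Set.disjoint_left.1 h' hx.2 (hsub hx)
  rw [hsub.antisymm (subset_inter h h')]
  exact reach_mem_basic m

theorem disjoint_insert_reach (hT : T.Branching) {u : T.V} {e : T.Edge} {F : Set T.Edge}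
    (he : e ∈ T.out u) (hF : F ⊆ T.out u) :
    Disjoint (T.reachOff u (insert e F)) (T.reach (T.t e)) := by
  rw [hT.reachOff_eq (insert_subset he hF), biUnion_insert]
  exact Set.disjoint_left.2 fun x hx hx' => hx.2 (Or.inl hx')

theorem reachOff_diff_aux (hT : T.Branching) {u w : T.V} {e : T.Edge} {F : Set T.Edge}
    (he : e ∈ T.out u) (hF : F ⊆ T.out u) (fF : F.Finite) (heF : e ∉ F)
    (hw : w ∈ T.reach (T.t e)) (h : T.reach (T.t e) \ T.reach w ∈ T.boolRing) :
    T.reachOff u F \ T.reach w ∈ T.boolRing := by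
  have hins : insert e F ⊆ T.out u := insert_subset he hF
  have hd := hT.disjoint_insert_reach he hF
  have : T.reachOff u F \ T.reach w =
      T.reachOff u (insert e F) ∪ (T.reach (T.t e) \ T.reach w) := by
    have h1 : T.reachOff u F = T.reachOff u (insert e F) ∪ T.reach (T.t e) := by
      ext x
      constructor
      · rintro (hx | hx)
        · exact Or.inl (Or.inl hx)
        · simp only [mem_iUnion] at hx
          obtain ⟨f, hf, hx⟩ := hx
          by_cases hfe : f = e
          · subst hfe; exact Or.inr hx
          · refine Or.inl (Or.inr ?_)
            simp only [mem_iUnion]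
            exact ⟨f, ⟨hf.1, by simp [hfe, hf.2]⟩, hx⟩
      · rintro ((hx | hx) | hx)
        · exact Or.inl hx
        · simp only [mem_iUnion] at hx
          obtain ⟨f, hf, hx⟩ := hx
          refine Or.inr ?_
          simp only [mem_iUnion]
          exact ⟨f, ⟨hf.1, fun h => hf.2 (mem_insert_of_mem _ h)⟩, hx⟩
        · refine Or.inr ?_
          simp only [mem_iUnion]
          exact ⟨e, ⟨he, heF⟩, hx⟩
    rw [h1, union_sdiff_distrib, (hd.mono_right (reach_subset hw)).sdiff_eq_left]
  rw [this]
  exact disjUnion_mem_ring (basic_mem_ring (reachOff_mem_basic hins (fF.insert e))) h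
    (hd.mono_right sdiff_subset)

theorem reach_diff_reach (hT : T.Branching) {u w : T.V} (h : w ∈ T.reach u) :
    T.reach u \ T.reach w ∈ T.boolRing := by
  induction h using Relation.ReflTransGen.head_induction_on with
  | refl => rw [sdiff_self]; exact empty_mem_ring
  | @head a c hac hcw ih =>
    obtain ⟨e, he, ho, rfl⟩ := hac
    rw [← reachOff_empty a]
    exact hT.reachOff_diff_aux ⟨he, ho⟩ (empty_subset _) finite_empty (notMem_empty e) hcw ih

theorem reachOff_diff_reach (hT : T.Branching) {u : T.V} {F : Set T.Edge} (hF : F ⊆ T.out u)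
    (fF : F.Finite) (w : T.V) : T.reachOff u F \ T.reach w ∈ T.boolRing := by
  have hBu := reachOff_subset_reach u F
  have main : ∀ m ∈ T.reach u, T.reachOff u F \ T.reach m ∈ T.boolRing := by
    intro m hm
    by_cases hmu : m = u
    · subst hmu; rw [sdiff_eq_bot_iff.2 hBu]; exact empty_mem_ring
    · obtain ⟨e, he, h1, h2⟩ := hT.cases_reachOff hF hm hmu
      rcases h2 with h2 | h2
      · rw [(h2.2.mono_right (reach_subset h1)).sdiff_eq_left]
        exact basic_mem_ring (reachOff_mem_basic hF fF)
      · exact hT.reachOff_diff_aux he hF fF h2.1 h1 (hT.reach_diff_reach h1)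
  rcases hT.meet u w with hd | ⟨m, hm⟩
  · rw [(hd.mono_left hBu).sdiff_eq_left]
    exact basic_mem_ring (reachOff_mem_basic hF fF)
  · have : T.reachOff u F \ T.reach w = T.reachOff u F \ T.reach m := by
      rw [← hm]; ext x
      have := @hBu x
      simp only [mem_sdiff, mem_inter_iff]; tauto
    rw [this]
    exact main m (hm ▸ self_mem_reach m : m ∈ T.reach u ∩ T.reach w).1

theorem diff_mem_ring_of_basic (hT : T.Branching) {B C : Set T.V} (hB : B ∈ T.basicSets)
    (hC : C ∈ T.basicSets) : B \ C ∈ T.boolRing := by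
  have hB' := hB
  rcases hB with rfl | ⟨u, F, hF, fF, rfl⟩
  · rw [empty_sdiff]; exact empty_mem_ring
  rcases hC with rfl | ⟨v, G, hG, fG, rfl⟩
  · rw [sdiff_empty]; exact basic_mem_ring hB'
  have : T.reachOff u F \ T.reachOff v G = (T.reachOff u F \ T.reach v) ∪
      ⋃ e ∈ G, (T.reachOff u F ∩ T.reach (T.t e)) := by
    rw [hT.reachOff_eq hG, ← inter_iUnion₂]
    have h2 : (⋃ e ∈ G, T.reach (T.t e)) ⊆ T.reach v :=
      iUnion₂_subset fun e he => reach_edge_subset (hG he)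
    ext x
    have := @h2 x
    simp only [mem_sdiff, mem_inter_iff, mem_union]; tauto
  rw [this]
  refine disjUnion_mem_ring (hT.reachOff_diff_reach hF fF v) (biUnion_mem_ring fG _ ?_ ?_) ?_
  · exact fun e _ => basic_mem_ring (hT.inter_mem_basic hB' (reach_mem_basic _))
  · intro e he f hf hne
    exact (hT.disjoint e (hG he).1 f (hG hf).1 (by rw [(hG he).2, (hG hf).2]) hne).mono
      inter_subset_right inter_subset_right
  · simp only [disjoint_iUnion_right]
    intro e he
    exact Set.disjoint_left.2 fun x hx hx' => hx.2 (reach_edge_subset (hG he) hx'.2)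

theorem isSetSemiring (hT : T.Branching) : MeasureTheory.IsSetSemiring T.basicSets where
  empty_mem := Or.inl rfl
  inter_mem := fun _ hB _ hC => hT.inter_mem_basic hB hC
  sdiff_eq_sUnion' := fun _ hB _ hC => hT.diff_mem_ring_of_basic hB hC

/-- `𝒜(T)` is a ring of sets. -/
theorem isSetRing (hT : T.Branching) : MeasureTheory.IsSetRing T.boolRing := by
  have : T.boolRing = supClosure T.basicSets := by
    ext B
    rw [hT.isSetSemiring.mem_supClosure_iff]
    constructor
    · rintro ⟨I, hI, hd, rfl⟩
      have h := hT.isSetSemiring.isSetRing_supClosure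
      rw [← hT.isSetSemiring.mem_supClosure_iff, sUnion_eq_biUnion]
      exact h.biUnion_mem I (fun B hB => subset_supClosure (hI hB))
    · rintro ⟨P, hP⟩
      refine ⟨P.parts, hP, P.supIndep.pairwiseDisjoint, ?_⟩
      exact P.sup_parts.symm.trans (Finset.sup_id_set_eq_sUnion _)
  rw [this]; exact hT.isSetSemiring.isSetRing_supClosure


/-- For a filter in the ring `𝒜(T)`, maximality is the usual dichotomy. -/
theorem maximal_iff (hT : T.Branching) {U : Set (Set T.V)} (hU : T.IsFilter U) :
    Maximal T.IsFilter U ↔ ∀ B ∈ T.boolRing, ∀ C ∈ U, C ∩ B ∈ U ∨ C \ B ∈ U := by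
  have hR := hT.isSetRing
  constructor
  · intro h B hB C hC
    by_contra! hn
    have hW : T.IsFilter {D | D ∈ T.boolRing ∧ ∃ A ∈ U, A \ B ⊆ D} := by
      refine ⟨fun D hD => hD.1, ⟨C, hU.subset hC, C, hC, sdiff_subset⟩, ?_, ?_, ?_⟩
      · rintro ⟨_, A, hA, hAB⟩
        have hAB' : A ⊆ B := sdiff_eq_empty.1 (subset_empty_iff.1 hAB)
        exact hn.1 (hU.mem_of_superset _ (hU.inter_mem _ hA _ hC) _
          (hR.inter_mem (hU.subset hC) hB) fun x hx => ⟨hx.2, hAB' hx.1⟩)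
      · rintro D ⟨hD, A, hA, h1⟩ D' ⟨hD', A', hA', h2⟩
        exact ⟨hR.inter_mem hD hD', A ∩ A', hU.inter_mem _ hA _ hA',
          fun x hx => ⟨h1 ⟨hx.1.1, hx.2⟩, h2 ⟨hx.1.2, hx.2⟩⟩⟩
      · rintro D ⟨hD, A, hA, h1⟩ D' hD' hDD'
        exact ⟨hD', A, hA, h1.trans hDD'⟩
    have hle := h.2 hW fun D hD => ⟨hU.subset hD, D, hD, sdiff_subset⟩
    exact hn.2 (hle ⟨hR.sdiff_mem (hU.subset hC) hB, C, hC, Subset.rfl⟩)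
  · refine fun h => ⟨hU, fun W hW hle B hB => ?_⟩
    obtain ⟨C, hC⟩ := hU.nonempty
    rcases h B (hW.subset hB) C hC with h | h
    · exact hU.mem_of_superset _ h _ (hW.subset hB) inter_subset_right
    · refine absurd ?_ hW.empty_notMem
      have := hW.inter_mem _ (hle h) _ hB
      rwa [show C \ B ∩ B = ∅ from sdiff_inter_self] at this

end Branching

namespace Spectrum

variable (x : T.Spectrum)

theorem isFilter : T.IsFilter x.1 := x.maximal.1

theorem mem_or (hT : T.Branching) {B C : Set T.V} (hB : B ∈ T.boolRing) (hC : C ∈ x.1) :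
    C ∩ B ∈ x.1 ∨ C \ B ∈ x.1 := (hT.maximal_iff x.isFilter).1 x.maximal B hB C hC

theorem not_disjoint {B C : Set T.V} (hB : B ∈ x.1) (hC : C ∈ x.1) : ¬ Disjoint B C := by
  intro h
  have := x.isFilter.inter_mem _ hB _ hC
  rw [disjoint_iff_inter_eq_empty.1 h] at this
  exact x.isFilter.empty_notMem this

theorem exists_mem_of_sUnion (hT : T.Branching) (I : Finset (Set T.V))
    (hI : ∀ B ∈ I, B ∈ T.boolRing) (h : ⋃₀ (I : Set (Set T.V)) ∈ x.1) : ∃ B ∈ I, B ∈ x.1 := by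
  classical
  induction I using Finset.induction with
  | empty => simp only [Finset.coe_empty, sUnion_empty] at h; exact absurd h x.isFilter.empty_notMem
  | insert B I _ ih =>
    rw [Finset.coe_insert, sUnion_insert] at h
    have hB := hI B (Finset.mem_insert_self _ _)
    rcases x.mem_or hT hB h with h' | h'
    · exact ⟨B, Finset.mem_insert_self _ _, x.isFilter.mem_of_superset _ h' _ hB inter_subset_right⟩
    · have hU : ⋃₀ (I : Set (Set T.V)) ∈ T.boolRing := by
        rw [sUnion_eq_biUnion]
        exact hT.isSetRing.biUnion_mem I fun D hD => hI D (Finset.mem_insert_of_mem hD)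
      obtain ⟨D, hD, hDx⟩ := ih (fun B hB => hI B (Finset.mem_insert_of_mem hB))
        (x.isFilter.mem_of_superset _ h' _ hU fun y hy => hy.1.resolve_left hy.2)
      exact ⟨D, Finset.mem_insert_of_mem hD, hDx⟩

theorem exists_basic (hT : T.Branching) {B : Set T.V} (hB : B ∈ x.1) :
    ∃ (v : T.V) (F : Set T.Edge), F ⊆ T.out v ∧ F.Finite ∧ T.reachOff v F ∈ x.1 ∧
      T.reachOff v F ⊆ B := by
  obtain ⟨I, hI, _, rfl⟩ := x.isFilter.subset hB
  obtain ⟨D, hD, hDx⟩ := x.exists_mem_of_sUnion hT I (fun D hD => basic_mem_ring (hI hD)) hB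
  rcases hI hD with rfl | ⟨v, F, hF, fF, rfl⟩
  · exact absurd hDx x.isFilter.empty_notMem
  · exact ⟨v, F, hF, fF, hDx, subset_sUnion_of_mem hD⟩

theorem exists_reach (hT : T.Branching) : ∃ v, T.reach v ∈ x.1 := by
  obtain ⟨B, hB⟩ := x.isFilter.nonempty
  obtain ⟨v, F, _, _, h, _⟩ := x.exists_basic hT hB
  exact ⟨v, x.isFilter.mem_of_superset _ h _ (reach_mem_ring v) (reachOff_subset_reach v F)⟩

theorem isOpen_cyl {B : Set T.V} (hB : B ∈ T.boolRing) : IsOpen (T.cyl B) :=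
  TopologicalSpace.isOpen_generateFrom_of_mem ⟨B, hB, rfl⟩

theorem isClosed_cyl (hT : T.Branching) {B : Set T.V} (hB : B ∈ T.boolRing) :
    IsClosed (T.cyl B) := by
  rw [← isOpen_compl_iff, isOpen_iff_forall_mem_open]
  intro x hx
  obtain ⟨C, hC⟩ := x.isFilter.nonempty
  have hCB := hT.isSetRing.sdiff_mem (x.isFilter.subset hC) hB
  refine ⟨T.cyl (C \ B), fun y hy hyB => ?_, isOpen_cyl hCB, ?_⟩
  · exact y.not_disjoint hy hyB disjoint_sdiff_left
  · rcases x.mem_or hT hB hC with h | h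
    · exact absurd (x.isFilter.mem_of_superset _ h _ hB inter_subset_right) hx
    · exact h

theorem isClopen_cyl (hT : T.Branching) {B : Set T.V} (hB : B ∈ T.boolRing) :
    IsClopen (T.cyl B) := ⟨isClosed_cyl hT hB, isOpen_cyl hB⟩

theorem t2Space (hT : T.Branching) : T2Space T.Spectrum := by
  refine ⟨fun x y hxy => ?_⟩
  have : ∃ B ∈ x.1, B ∉ y.1 := by
    by_contra! h
    exact hxy (Spectrum.ext (x.2.eq_of_subset y.isFilter h))
  obtain ⟨B, hB, hBy⟩ := this
  have h := isClopen_cyl hT (x.isFilter.subset hB)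
  exact ⟨T.cyl B, (T.cyl B)ᶜ, h.isOpen, h.compl.isOpen, hB, hBy, disjoint_compl_right⟩

/-- The sets `[B]` are compact (and empty if `B` is not in `𝒜(T)`). -/
theorem isCompact_cyl (hT : T.Branching) (B : Set T.V) :
    IsCompact (T.cyl B) := by
  let j : T.Spectrum → (Set T.V → Bool) := fun x C => by classical exact decide (C ∈ x.1)
  have hj : ∀ x C, j x C = true ↔ C ∈ x.1 := fun x C => by simp [j]
  have hind : IsInducing j := by
    refine ⟨le_antisymm ?_ ?_⟩
    · rw [← continuous_iff_le_induced, continuous_pi_iff]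
      intro C
      rw [continuous_bool_rng true]
      have : (fun x => j x C) ⁻¹' {true} = T.cyl C := by ext x; exact hj x C
      rw [this]
      by_cases hC : C ∈ T.boolRing
      · exact isClopen_cyl hT hC
      · have : T.cyl C = ∅ := eq_empty_of_forall_notMem fun x hx => hC (x.isFilter.subset hx)
        rw [this]; exact isClopen_empty
    · refine le_generateFrom ?_
      rintro O ⟨C, _, rfl⟩
      refine ⟨{z | z C = true}, ?_, ?_⟩
      · exact (isOpen_discrete ({true} : Set Bool)).preimage
          (show Continuous (fun z : Set T.V → Bool => z C) from continuous_apply C)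
      · ext x; exact hj x C
  rw [hind.isCompact_iff]
  refine IsClosed.isCompact ?_
  have hcl : ∀ (C : Set T.V) (b : Bool), IsClosed {z : Set T.V → Bool | z C = b} := fun C b =>
    (isClosed_discrete ({b} : Set Bool)).preimage
      (show Continuous (fun z : Set T.V → Bool => z C) from continuous_apply C)
  have himg : j '' T.cyl B = {z | z B = true} ∩ {z | z ∅ = false} ∩
      (⋂ C ∈ T.boolRingᶜ, {z | z C = false}) ∩
      (⋂ C, ⋂ D, ({z | z C = false} ∪ {z | z D = false} ∪ {z | z (C ∩ D) = true})) ∩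
      (⋂ C, ⋂ D, ⋂ (_ : D ∈ T.boolRing), ⋂ (_ : C ⊆ D), ({z | z C = false} ∪ {z | z D = true})) ∩
      (⋂ D ∈ T.boolRing, ⋂ C, ({z | z C = false} ∪ {z | z (C ∩ D) = true} ∪
        {z | z (C \ D) = true})) := by
    ext z
    simp only [mem_inter_iff, mem_iInter, mem_union, mem_ofPred_eq, mem_compl_iff]
    constructor
    · rintro ⟨x, hx, rfl⟩
      have hf := x.isFilter
      simp only [← Bool.not_eq_true, hj]
      refine ⟨⟨⟨⟨⟨hx, hf.empty_notMem⟩, fun C hC h => hC (hf.subset h)⟩, fun C D => ?_⟩,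
        fun C D hD hCD => ?_⟩, fun D hD C => ?_⟩
      · have := hf.inter_mem C; tauto
      · have := hf.mem_of_superset C; tauto
      · have := fun h => x.mem_or hT hD (C := C) h; tauto
    · rintro ⟨⟨⟨⟨⟨h1, h2⟩, h3⟩, h4⟩, h5⟩, h6⟩
      simp only [← Bool.not_eq_true] at h2 h3 h4 h5 h6
      have hf : T.IsFilter {C | z C = true} := by
        refine ⟨fun C hC => ?_, ⟨B, h1⟩, h2, fun C hC D hD => ?_, fun C hC D hD hCD => ?_⟩
        · by_contra h; exact h3 C h hC
        · rcases h4 C D with (h | h) | h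
          · exact absurd hC h
          · exact absurd hD h
          · exact h
        · exact (h5 C D hD hCD).resolve_left (fun h => h hC)
      refine ⟨⟨{C | z C = true}, (hT.maximal_iff hf).2 fun D hD C hC => ?_⟩, h1, ?_⟩
      · rcases h6 D hD C with (h | h) | h
        · exact absurd hC h
        · exact Or.inl h
        · exact Or.inr h
      · ext C; exact Bool.eq_iff_iff.2 (hj _ C)
  rw [himg]
  refine ((((((hcl _ _).inter (hcl _ _)).inter ?_).inter ?_).inter ?_).inter ?_)
  · exact isClosed_biInter fun C _ => hcl _ _
  · exact isClosed_iInter fun C => isClosed_iInter fun D =>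
      ((hcl _ _).union (hcl _ _)).union (hcl _ _)
  · exact isClosed_iInter fun C => isClosed_iInter fun D => isClosed_iInter fun _ =>
      isClosed_iInter fun _ => (hcl _ _).union (hcl _ _)
  · exact isClosed_biInter fun C _ => isClosed_iInter fun D =>
      ((hcl _ _).union (hcl _ _)).union (hcl _ _)

end Spectrum

end Tree

section Paths

variable (E : DirectedGraph.{u})

/-- The edges in the list follow one another, the first one starting at `v`. -/
def IsWalk : E.V → List E.Edge → Prop
  | _, [] => True
  | v, e :: l => E.o e = v ∧ IsWalk (E.t e) l

/-- The last vertex of a walk starting at `v`. -/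
def endpoint : E.V → List E.Edge → E.V
  | v, [] => v
  | _, e :: l => endpoint (E.t e) l

/-- No edge is immediately followed by its reversal. -/
def NoBacktrack (l : List E.Edge) : Prop := l.IsChain fun e f => f ≠ E.rev e

/-- `E*`: the finite (undirected, reduced) paths in `E`, including those of length zero. -/
@[ext]
structure Path where
  /-- the origin of the path -/
  o : E.V
  /-- the edges of the path -/
  edges : List E.Edge
  isWalk : E.IsWalk o edges
  noBacktrack : E.NoBacktrack edges

variable {E}

open Classical in
/-- Put an edge in front of a reduced path, cancelling a pair `e (rev e)` if one appears. -/
noncomputable def consRed (e : E.Edge) : List E.Edge → List E.Edge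
  | [] => [e]
  | f :: l => if f = E.rev e then l else e :: f :: l

theorem t_rev (e : E.Edge) : E.t (E.rev e) = E.o e := by rw [← E.o_rev, E.rev_rev]

theorem isWalk_consRed {e : E.Edge} {l : List E.Edge} (h : E.IsWalk (E.t e) l) :
    E.IsWalk (E.o e) (consRed e l) := by
  cases l with
  | nil => exact ⟨rfl, trivial⟩
  | cons f l =>
    simp only [consRed]
    split_ifs with hf
    · have := h.2
      rwa [hf, E.t_rev] at this
    · exact ⟨rfl, h⟩

theorem endpoint_consRed (e : E.Edge) (l : List E.Edge) :
    E.endpoint (E.o e) (consRed e l) = E.endpoint (E.t e) l := by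
  cases l with
  | nil => rfl
  | cons f l =>
    simp only [consRed]
    split_ifs with hf
    · simp only [endpoint]; rw [hf, E.t_rev]
    · rfl

theorem noBacktrack_consRed {e : E.Edge} {l : List E.Edge} (h : E.NoBacktrack l) :
    E.NoBacktrack (consRed e l) := by
  cases l with
  | nil => exact List.isChain_singleton _
  | cons f l =>
    simp only [consRed]
    split_ifs with hf
    · exact h.tail
    · exact List.isChain_cons_cons.2 ⟨hf, h⟩

theorem isWalk_foldr {l m : List E.Edge} {v : E.V} (hl : E.IsWalk v l)
    (hm : E.IsWalk (E.endpoint v l) m) : E.IsWalk v (l.foldr consRed m) := by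
  induction l generalizing v with
  | nil => exact hm
  | cons e l ih => obtain ⟨rfl, hl⟩ := hl; exact isWalk_consRed (ih hl hm)

theorem endpoint_foldr {l : List E.Edge} (m : List E.Edge) {v : E.V} (hl : E.IsWalk v l) :
    E.endpoint v (l.foldr consRed m) = E.endpoint (E.endpoint v l) m := by
  induction l generalizing v with
  | nil => rfl
  | cons e l ih =>
    obtain ⟨rfl, hl⟩ := hl
    exact (endpoint_consRed e _).trans (ih hl)

theorem noBacktrack_foldr (l : List E.Edge) {m : List E.Edge} (hm : E.NoBacktrack m) :
    E.NoBacktrack (l.foldr consRed m) := by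
  induction l with
  | nil => exact hm
  | cons e l ih => exact noBacktrack_consRed ih

theorem consRed_rev_consRed (e : E.Edge) {l : List E.Edge} (h : E.NoBacktrack l) :
    consRed (E.rev e) (consRed e l) = l := by
  cases l with
  | nil => simp [consRed, E.rev_rev]
  | cons f l =>
    by_cases hf : f = E.rev e
    · have h1 : consRed e (f :: l) = l := by simp [consRed, hf]
      rw [h1]
      cases l with
      | nil => simp [consRed, hf]
      | cons g l =>
        have : g ≠ E.rev f := (List.isChain_cons_cons.1 h).1
        rw [hf] at this
        simp [consRed, this, hf]
    · simp [consRed, hf, E.rev_rev]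

theorem foldr_consRed (e : E.Edge) (q : List E.Edge) {r : List E.Edge} (hr : E.NoBacktrack r) :
    (consRed e q).foldr consRed r = consRed e (q.foldr consRed r) := by
  cases q with
  | nil => rfl
  | cons f l =>
    by_cases hf : f = E.rev e
    · have h1 : consRed e (f :: l) = l := by simp [consRed, hf]
      have h2 := consRed_rev_consRed (E.rev e) (noBacktrack_foldr l hr)
      rw [E.rev_rev] at h2
      rw [h1, List.foldr_cons, hf, h2]
    · have h1 : consRed e (f :: l) = e :: f :: l := by simp [consRed, hf]
      rw [h1]; rfl

theorem foldr_assoc (p q : List E.Edge) {r : List E.Edge} (hr : E.NoBacktrack r) :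
    (p.foldr consRed q).foldr consRed r = p.foldr consRed (q.foldr consRed r) := by
  induction p with
  | nil => rfl
  | cons e p ih => rw [List.foldr_cons, foldr_consRed e _ hr, ih]; rfl

theorem foldr_eq_append {p q : List E.Edge} (h : E.NoBacktrack (p ++ q)) :
    p.foldr consRed q = p ++ q := by
  induction p with
  | nil => rfl
  | cons e p ih =>
    rw [List.foldr_cons, ih (List.IsChain.tail h)]
    cases hpq : p ++ q with
    | nil => simp [consRed, hpq]
    | cons f l =>
      rw [List.cons_append, hpq] at h
      have : f ≠ E.rev e := (List.isChain_cons_cons.1 h).1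
      simp [consRed, this, hpq]

theorem foldr_reverse (p : List E.Edge) {q : List E.Edge} (hq : E.NoBacktrack q) :
    (p.map E.rev).reverse.foldr consRed (p.foldr consRed q) = q := by
  induction p with
  | nil => rfl
  | cons e p ih =>
    simp only [List.map_cons, List.reverse_cons, List.foldr_append, List.foldr_cons,
      List.foldr_nil]
    rw [consRed_rev_consRed e (noBacktrack_foldr p hq), ih]

theorem isWalk_append {v : E.V} {l m : List E.Edge} :
    E.IsWalk v (l ++ m) ↔ E.IsWalk v l ∧ E.IsWalk (E.endpoint v l) m := by
  induction l generalizing v with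
  | nil => simp [IsWalk, endpoint]
  | cons e l ih => simp [IsWalk, endpoint, ih, and_assoc]

theorem endpoint_append (v : E.V) (l m : List E.Edge) :
    E.endpoint v (l ++ m) = E.endpoint (E.endpoint v l) m := by
  induction l generalizing v with
  | nil => rfl
  | cons e l ih => exact ih _

theorem isWalk_reverse {v : E.V} {l : List E.Edge} (h : E.IsWalk v l) :
    E.IsWalk (E.endpoint v l) (l.map E.rev).reverse ∧
      E.endpoint (E.endpoint v l) (l.map E.rev).reverse = v := by
  induction l generalizing v with
  | nil => exact ⟨trivial, rfl⟩
  | cons e l ih =>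
    obtain ⟨rfl, h⟩ := h
    obtain ⟨h1, h2⟩ := ih h
    simp only [List.map_cons, List.reverse_cons, endpoint]
    rw [isWalk_append, endpoint_append, h2]
    exact ⟨⟨h1, E.o_rev e, trivial⟩, E.t_rev e⟩

theorem noBacktrack_reverse {l : List E.Edge} (h : E.NoBacktrack l) :
    E.NoBacktrack (l.map E.rev).reverse := by
  unfold NoBacktrack at *
  rw [List.isChain_reverse, List.isChain_map]
  refine h.imp fun e f hef => ?_
  intro h
  exact hef (by rw [h, E.rev_rev])

namespace Path

/-- The terminus of a path. -/
def t (p : E.Path) : E.V := E.endpoint p.o p.edges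

/-- The path of length zero at `v`. -/
def nil (v : E.V) : E.Path := ⟨v, [], trivial, List.isChain_nil⟩

/-- The path of length one given by an edge. -/
def single (e : E.Edge) : E.Path := ⟨E.o e, [e], ⟨rfl, trivial⟩, List.isChain_singleton _⟩

/-- A path is directed if all its edges are. -/
def IsDirected (p : E.Path) : Prop := ∀ e ∈ p.edges, e ∈ E.pos

open Classical in
/-- The product in the groupoid `G(E)` of reduced paths, defined when `p` ends where `q` starts
(otherwise `p.mul q` has the junk value `p`): concatenation, followed by removal of the pairs
`e (rev e)`. In this groupoid the range of `p` is `p.o` and its source is `p.t`. -/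
noncomputable def mul (p q : E.Path) : E.Path :=
  if h : p.t = q.o then
    ⟨p.o, p.edges.foldr consRed q.edges, isWalk_foldr p.isWalk (by rw [← t, h]; exact q.isWalk),
      noBacktrack_foldr _ q.noBacktrack⟩
  else p

/-- The inverse in the groupoid `G(E)`: the reversed path. -/
def inv (p : E.Path) : E.Path :=
  ⟨p.t, (p.edges.map E.rev).reverse, (isWalk_reverse p.isWalk).1, noBacktrack_reverse p.noBacktrack⟩

theorem mul_edges {p q : E.Path} (h : p.t = q.o) :
    (p.mul q).edges = p.edges.foldr consRed q.edges := by rw [mul, dif_pos h]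

theorem mul_o (p q : E.Path) : (p.mul q).o = p.o := by rw [mul]; split_ifs <;> rfl

theorem mul_t {p q : E.Path} (h : p.t = q.o) : (p.mul q).t = q.t := by
  rw [mul, dif_pos h, t, endpoint_foldr _ p.isWalk, ← t, h]; rfl

theorem inv_o (p : E.Path) : p.inv.o = p.t := rfl

theorem inv_t (p : E.Path) : p.inv.t = p.o := (isWalk_reverse p.isWalk).2

theorem mul_assoc {p q r : E.Path} (h1 : p.t = q.o) (h2 : q.t = r.o) :
    (p.mul q).mul r = p.mul (q.mul r) := by
  ext1
  · rw [mul_o, mul_o, mul_o]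
  · rw [mul_edges (by rw [mul_t h1, h2]), mul_edges h1, mul_edges (by rw [mul_o, h1]),
      mul_edges h2, foldr_assoc _ _ r.noBacktrack]

theorem nil_mul (p : E.Path) : (nil p.o).mul p = p := by
  ext1
  · rw [mul_o]; rfl
  · rw [mul_edges rfl]; rfl

theorem mul_nil (p : E.Path) : p.mul (nil p.t) = p := by
  ext1
  · rw [mul_o]
  · rw [mul_edges rfl]
    have : E.NoBacktrack (p.edges ++ []) := by rw [List.append_nil]; exact p.noBacktrack
    rw [show (nil p.t).edges = [] from rfl, foldr_eq_append this, List.append_nil]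

theorem inv_mul_cancel_left {p q : E.Path} (h : p.t = q.o) : p.inv.mul (p.mul q) = q := by
  ext1
  · rw [mul_o, inv_o, h]
  · rw [mul_edges (by rw [mul_o, inv_t]), mul_edges h]
    exact foldr_reverse _ q.noBacktrack

theorem inv_inv (p : E.Path) : p.inv.inv = p := by
  ext1
  · exact p.inv_t
  · simp only [inv, List.map_reverse, List.map_map, List.reverse_reverse]
    have : E.rev ∘ E.rev = id := funext E.rev_rev
    rw [this, List.map_id]

theorem mul_inv_cancel_left {p q : E.Path} (h : p.o = q.o) : p.mul (p.inv.mul q) = q := by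
  have := inv_mul_cancel_left (p := p.inv) (q := q) (by rw [inv_t, h])
  rwa [inv_inv] at this

theorem inv_mul (p : E.Path) : p.inv.mul p = nil p.t := by
  have := inv_mul_cancel_left (p := p) (q := nil p.t) rfl
  rwa [mul_nil] at this

theorem mul_inv (p : E.Path) : p.mul p.inv = nil p.o := by
  have := inv_mul p.inv
  rwa [inv_inv, inv_t] at this

theorem mul_left_cancel {p a b : E.Path} (ha : p.t = a.o) (hb : p.t = b.o)
    (h : p.mul a = p.mul b) : a = b := by
  rw [← inv_mul_cancel_left ha, h, inv_mul_cancel_left hb]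

theorem mul_inv_cancel_right {p q : E.Path} (h : p.t = q.o) : (p.mul q).mul q.inv = p := by
  rw [mul_assoc h (inv_o q).symm, mul_inv, ← h, mul_nil]

theorem eq_single {p : E.Path} {e : E.Edge} (h : p.edges = [e]) : p = single e := by
  ext1
  · have := p.isWalk
    rw [h] at this
    exact this.1.symm
  · exact h

theorem single_mul_rev (e : E.Edge) : (single e).mul (single (E.rev e)) = nil (E.o e) := by
  have : single (E.rev e) = (single e).inv := by
    ext1
    · exact E.o_rev e
    · rfl
  rw [this, mul_inv]; rfl

theorem noBacktrack_of_pos {l : List E.Edge} (h : ∀ e ∈ l, e ∈ E.pos) : E.NoBacktrack l := by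
  induction l with
  | nil => exact List.isChain_nil
  | cons e l ih =>
    refine List.isChain_cons.2 ⟨fun f hf => ?_, ih fun f hf => h f (List.mem_cons_of_mem _ hf)⟩
    rintro rfl
    refine (E.rev_mem_pos_iff e).1 (h _ (List.mem_cons_of_mem _ (List.mem_of_mem_head? hf))) ?_
    exact h e List.mem_cons_self

theorem IsDirected.mul_edges {p q : E.Path} (hp : p.IsDirected) (hq : q.IsDirected)
    (h : p.t = q.o) : (p.mul q).edges = p.edges ++ q.edges := by
  rw [Path.mul_edges h, foldr_eq_append]
  refine noBacktrack_of_pos fun e he => ?_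
  rcases List.mem_append.1 he with he | he
  · exact hp e he
  · exact hq e he

theorem IsDirected.mul {p q : E.Path} (hp : p.IsDirected) (hq : q.IsDirected)
    (h : p.t = q.o) : (p.mul q).IsDirected := by
  intro e he
  rw [hp.mul_edges hq h] at he
  rcases List.mem_append.1 he with he | he
  · exact hp e he
  · exact hq e he

theorem isDirected_nil (v : E.V) : (nil v).IsDirected := fun _ h => absurd h List.not_mem_nil

theorem isDirected_single {e : E.Edge} (h : e ∈ E.pos) : (single e).IsDirected := by
  intro f hf
  rw [List.mem_singleton.1 hf]; exact h

end Path

theorem Path.eq_mul_single {p q : E.Path} {e : E.Edge} (h : p.o = q.o)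
    (he : (p.inv.mul q).edges = [e]) : p.t = E.o e ∧ q = p.mul (Path.single e) := by
  have h1 := Path.eq_single he
  refine ⟨?_, ?_⟩
  · have := congrArg Path.o h1
    rwa [Path.mul_o, Path.inv_o] at this
  · rw [← h1, Path.mul_inv_cancel_left h]

theorem Path.inv_mul_mul_single {p : E.Path} {e : E.Edge} (h : p.t = E.o e) :
    (p.inv.mul (p.mul (Path.single e))).edges = [e] := by
  rw [Path.inv_mul_cancel_left (q := Path.single e) h]; rfl

theorem Path.inv_mul_symm {p q : E.Path} {e : E.Edge} (h : p.o = q.o)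
    (he : (p.inv.mul q).edges = [e]) : (q.inv.mul p).edges = [E.rev e] := by
  obtain ⟨h1, rfl⟩ := Path.eq_mul_single h he
  have h2 : (Path.single e).t = (Path.single (E.rev e)).o := (E.o_rev e).symm
  have h3 : (p.mul (Path.single e)).mul (Path.single (E.rev e)) = p := by
    rw [Path.mul_assoc h1 h2, Path.single_mul_rev, ← h1, Path.mul_nil]
  have h4 : (p.mul (Path.single e)).t = E.o (E.rev e) := by rw [Path.mul_t h1]; exact h2
  have := Path.inv_mul_mul_single h4
  rwa [h3] at this

variable (E)

/-- The universal cover `Ẽ`, a disjoint union of directed trees: its vertices are the finite paths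
of `E`, and its (directed) edges are the pairs `(p,q)` with `p⁻¹q` a (directed) edge of `E`. -/
noncomputable abbrev cover : DirectedGraph.{u} where
  V := E.Path
  Edge := {x : E.Path × E.Path // x.1.o = x.2.o ∧ ∃ e, (x.1.inv.mul x.2).edges = [e]}
  o x := x.1.1
  t x := x.1.2
  rev x := ⟨(x.1.2, x.1.1), x.2.1.symm, x.2.2.elim fun e he => ⟨E.rev e, Path.inv_mul_symm x.2.1 he⟩⟩
  rev_rev _ := rfl
  rev_ne x := by
    obtain ⟨⟨p, q⟩, h, e, he⟩ := x
    intro h'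
    have h2 : q = p := congrArg (fun x => x.1.1) h'
    simp only [h2, Path.inv_mul] at he
    exact List.cons_ne_nil _ _ he.symm
  o_rev _ := rfl
  pos := {x | ∃ e ∈ E.pos, (x.1.1.inv.mul x.1.2).edges = [e]}
  rev_mem_pos_iff x := by
    obtain ⟨⟨p, q⟩, h, e, he⟩ := x
    have h1 := Path.inv_mul_symm h he
    constructor
    · rintro ⟨f, hf, hf'⟩ ⟨g, hg, hg'⟩
      simp only at h1 he hf' hg'
      rw [h1] at hf'
      rw [he] at hg'
      obtain rfl : E.rev e = f := by simpa using hf'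
      obtain rfl : e = g := by simpa using hg'
      exact (E.rev_mem_pos_iff e).1 hf hg
    · intro hn
      exact ⟨E.rev e, (E.rev_mem_pos_iff e).2 fun hp => hn ⟨e, hp, he⟩, h1⟩

variable {E}

theorem cover_step_iff {p q : E.Path} : E.cover.Step p q ↔
    ∃ e ∈ E.pos, p.t = E.o e ∧ q = p.mul (Path.single e) := by
  constructor
  · rintro ⟨⟨⟨p', q'⟩, h, _⟩, ⟨e, he, he'⟩, h1, h2⟩
    change p' = p at h1
    change q' = q at h2
    subst h1 h2
    exact ⟨e, he, Path.eq_mul_single h he'⟩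
  · rintro ⟨e, he, h, rfl⟩
    have := Path.inv_mul_mul_single h
    exact ⟨⟨(p, _), (Path.mul_o _ _).symm, e, this⟩, ⟨e, he, this⟩, rfl, rfl⟩

/-- `V(p)` in the universal cover: the products of `p` with directed paths. -/
theorem mem_cover_reach_iff {p q : E.Path} : q ∈ E.cover.reach p ↔
    ∃ d : E.Path, d.IsDirected ∧ p.t = d.o ∧ q = p.mul d := by
  constructor
  · intro h
    induction h with
    | refl => exact ⟨Path.nil p.t, Path.isDirected_nil _, rfl, (Path.mul_nil p).symm⟩
    | tail _ hs ih =>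
      obtain ⟨d, hd, h, rfl⟩ := ih
      obtain ⟨e, he, h', rfl⟩ := cover_step_iff.1 hs
      rw [Path.mul_t h] at h'
      exact ⟨d.mul (Path.single e), hd.mul (Path.isDirected_single he) h', by rw [Path.mul_o, h],
        Path.mul_assoc h h'⟩
  · rintro ⟨⟨v, l, hl, hl'⟩, hd, h, rfl⟩
    induction l generalizing p v with
    | nil =>
      have : (⟨v, [], hl, hl'⟩ : E.Path) = Path.nil p.t := by ext1 <;> [exact h.symm; rfl]
      rw [this, Path.mul_nil]; exact self_mem_reach (T := E.cover) p
    | cons e l ih =>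
      obtain ⟨rfl, hl⟩ := hl
      have he : e ∈ E.pos := hd e List.mem_cons_self
      have hstep : E.cover.Step p (p.mul (Path.single e)) := cover_step_iff.2 ⟨e, he, h, rfl⟩
      have htl : (⟨E.t e, l, hl, hl'.tail⟩ : E.Path).IsDirected :=
        fun f hf => hd f (List.mem_cons_of_mem _ hf)
      have h2 : (p.mul (Path.single e)).t = E.t e := Path.mul_t h
      refine Relation.ReflTransGen.head hstep ?_
      have h3 := ih (p := p.mul (Path.single e)) (E.t e) hl hl'.tail htl h2
      have h4 : (Path.single e).mul ⟨E.t e, l, hl, hl'.tail⟩ =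
          (⟨E.o e, e :: l, ⟨rfl, hl⟩, hl'⟩ : E.Path) := by
        ext1
        · exact Path.mul_o _ _
        · rw [(Path.isDirected_single he).mul_edges htl rfl]; rfl
      rw [Path.mul_assoc (q := Path.single e) h rfl, h4] at h3
      exact h3

/-- Cancellation in a product of a directed path with the reversal of another one. -/
theorem exists_common_suffix (a b : List E.Edge) (ha : ∀ e ∈ a, e ∈ E.pos)
    (hb : ∀ e ∈ b, e ∈ E.pos) : ∃ a' b' c, a = a' ++ c ∧ b = b' ++ c ∧
      E.NoBacktrack (a' ++ (b'.map E.rev).reverse) := by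
  induction a using List.reverseRecOn generalizing b with
  | nil =>
    exact ⟨[], b, [], rfl, by simp, noBacktrack_reverse (Path.noBacktrack_of_pos hb)⟩
  | append_singleton a e ih =>
    rcases List.eq_nil_or_concat b with rfl | ⟨b, f, rfl⟩
    · exact ⟨a ++ [e], [], [], by simp, rfl, by simpa using Path.noBacktrack_of_pos ha⟩
    · rw [List.concat_eq_append] at hb ⊢
      by_cases hef : e = f
      · subst hef
        obtain ⟨a', b', c, rfl, rfl, h⟩ := ih b (fun x hx => ha x (by simp [hx]))
          (fun x hx => hb x (by simp [hx]))
        exact ⟨a', b', c ++ [e], by simp, by simp, h⟩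
      · refine ⟨a ++ [e], b ++ [f], [], by simp, by simp, ?_⟩
        refine List.isChain_append.2 ⟨Path.noBacktrack_of_pos ha,
          noBacktrack_reverse (Path.noBacktrack_of_pos hb), ?_⟩
        intro x hx y hy
        simp only [List.getLast?_append, List.getLast?_singleton, Option.some_or,
          Option.mem_def, Option.some.injEq] at hx
        simp only [List.map_append, List.map_cons, List.map_nil, List.reverse_append,
          List.reverse_cons, List.reverse_nil, List.nil_append, List.cons_append,
          List.head?_cons, Option.mem_def, Option.some.injEq] at hy
        subst hx hy
        intro h
        have := congrArg E.rev h
        rw [E.rev_rev, E.rev_rev] at this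
        exact hef this.symm

theorem cover_meet {u v r : E.Path} (hu : r ∈ E.cover.reach u) (hv : r ∈ E.cover.reach v) :
    ∃ a : E.Path, a.IsDirected ∧ u.t = a.o ∧ u.mul a ∈ E.cover.reach v ∧
      r ∈ E.cover.reach (u.mul a) ∧
      ∃ l : List E.Edge, (∀ e ∈ l, e ∉ E.pos) ∧ (u.inv.mul v).edges = a.edges ++ l := by
  obtain ⟨x, hx, hxo, rfl⟩ := mem_cover_reach_iff.1 hu
  obtain ⟨y, hy, hyo, hxy⟩ := mem_cover_reach_iff.1 hv
  obtain ⟨a', b', c, ha, hb, hred⟩ := exists_common_suffix x.edges y.edges hx hy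
  have hxt : (u.mul x).t = x.t := Path.mul_t hxo
  have hyt : (u.mul x).t = y.t := by rw [hxy, Path.mul_t hyo]
  have split : ∀ (z : E.Path) (d c : List E.Edge), z.IsDirected → z.edges = d ++ c →
      ∃ p q : E.Path, p.IsDirected ∧ q.IsDirected ∧ p.o = z.o ∧ p.t = q.o ∧ p.edges = d ∧
        q.edges = c ∧ z = p.mul q := by
    intro z d c hz hdc
    have hw := z.isWalk
    rw [hdc, isWalk_append] at hw
    have h1 : ∀ e ∈ d, e ∈ E.pos := fun e he => hz e (by rw [hdc]; simp [he])
    have h2 : ∀ e ∈ c, e ∈ E.pos := fun e he => hz e (by rw [hdc]; simp [he])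
    refine ⟨⟨z.o, d, hw.1, Path.noBacktrack_of_pos h1⟩,
      ⟨_, c, hw.2, Path.noBacktrack_of_pos h2⟩, h1, h2, rfl, rfl, rfl, rfl, ?_⟩
    ext1
    · rw [Path.mul_o]
    · rw [Path.IsDirected.mul_edges (p := ⟨z.o, d, _, _⟩) (q := ⟨_, c, _, _⟩) h1 h2 rfl]; exact hdc
  obtain ⟨a, c₁, da, dc₁, ao, ac, rfl, hc₁, rfl⟩ := split x a' c hx ha
  obtain ⟨b, c₂, db, dc₂, bo, bc, rfl, hc₂, rfl⟩ := split y b' c hy hb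
  rw [← ao] at hxo
  rw [← bo] at hyo
  have hc : c₁ = c₂ := by
    rw [← Path.inv_inv c₁, ← Path.inv_inv c₂]
    congr 1
    ext1
    · rw [Path.inv_o, Path.inv_o, ← Path.mul_t ac, ← hxt, hyt, Path.mul_t bc]
    · simp only [Path.inv, hc₁, hc₂]
  subst hc
  have hua : (u.mul a).t = c₁.o := by rw [Path.mul_t hxo, ac]
  have hvb : (v.mul b).t = c₁.o := by rw [Path.mul_t hyo, bc]
  have huv : u.mul a = v.mul b := by
    rw [← Path.mul_inv_cancel_right hua, Path.mul_assoc hxo ac, hxy, ← Path.mul_assoc hyo bc,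
      Path.mul_inv_cancel_right hvb]
  have hab : a.t = b.inv.o := by rw [Path.inv_o, ← Path.mul_t hxo, huv, Path.mul_t hyo]
  have hv' : v = u.mul (a.mul b.inv) := by
    rw [← Path.mul_assoc hxo hab, huv, Path.mul_inv_cancel_right hyo]
  refine ⟨a, da, hxo, ?_, ?_, b.inv.edges, ?_, ?_⟩
  · rw [huv]; exact mem_cover_reach_iff.2 ⟨b, db, hyo, rfl⟩
  · exact mem_cover_reach_iff.2 ⟨c₁, dc₁, hua, (Path.mul_assoc hxo ac).symm⟩
  · intro e he
    simp only [Path.inv, List.mem_reverse, List.mem_map] at he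
    obtain ⟨f, hf, rfl⟩ := he
    exact fun h => (E.rev_mem_pos_iff f).1 h (db f hf)
  · rw [hv', Path.inv_mul_cancel_left (by rw [Path.mul_o, hxo]), Path.mul_edges hab]
    exact foldr_eq_append hred

theorem append_unique {S : Set E.Edge} {a b c d : List E.Edge} (ha : ∀ e ∈ a, e ∈ S)
    (hb : ∀ e ∈ b, e ∈ S) (hc : ∀ e ∈ c, e ∉ S) (hd : ∀ e ∈ d, e ∉ S)
    (h : a ++ c = b ++ d) : a = b := by
  induction a generalizing b with
  | nil =>
    cases b with
    | nil => rfl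
    | cons f b =>
      rw [List.nil_append] at h
      exact absurd (hb f List.mem_cons_self) (hc f (by rw [h]; simp))
  | cons e a ih =>
    cases b with
    | nil =>
      rw [List.nil_append] at h
      exact absurd (ha e List.mem_cons_self) (hd e (by rw [← h]; simp))
    | cons f b =>
      rw [List.cons_append, List.cons_append, List.cons.injEq] at h
      rw [h.1, ih (fun x hx => ha x (List.mem_cons_of_mem _ hx))
        (fun x hx => hb x (List.mem_cons_of_mem _ hx)) h.2]

variable (E)

theorem cover_branching : E.cover.Branching where
  notMem_reach := by
    rintro ⟨⟨p, q⟩, h, _⟩ ⟨e, he, he'⟩ hmem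
    obtain ⟨h1, rfl⟩ := Path.eq_mul_single (p := p) (q := q) h he'
    obtain ⟨d, hd, h2, h3⟩ := mem_cover_reach_iff.1 hmem
    change (p.mul (Path.single e)).t = d.o at h2
    change p = (p.mul (Path.single e)).mul d at h3
    have h4 : (Path.single e).t = d.o := by rw [← h2, Path.mul_t h1]
    rw [Path.mul_assoc h1 h4] at h3
    have h5 : (Path.single e).mul d = Path.nil p.t := by
      refine Path.mul_left_cancel (p := p) (by rw [Path.mul_o]; exact h1) rfl ?_
      rw [← h3, Path.mul_nil]
    have h6 := congrArg Path.edges h5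
    rw [(Path.isDirected_single he).mul_edges hd h4] at h6
    exact List.cons_ne_nil _ _ h6
  disjoint := by
    rintro ⟨⟨p, q⟩, h, _⟩ ⟨e, he, he'⟩ ⟨⟨p', q'⟩, h', _⟩ ⟨f, hf, hf'⟩ hpp hne
    change p = p' at hpp
    subst hpp
    obtain ⟨h1, rfl⟩ := Path.eq_mul_single (p := p) (q := q) h he'
    obtain ⟨h1', rfl⟩ := Path.eq_mul_single (p := p) (q := q') h' hf'
    refine Set.disjoint_left.2 fun w hw hw' => hne ?_
    obtain ⟨d, hd, h2, rfl⟩ := mem_cover_reach_iff.1 hw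
    obtain ⟨d', hd', h2', h3⟩ := mem_cover_reach_iff.1 hw'
    change (p.mul (Path.single e)).t = d.o at h2
    change (p.mul (Path.single f)).t = d'.o at h2'
    change (p.mul (Path.single e)).mul d = (p.mul (Path.single f)).mul d' at h3
    rw [Path.mul_t h1] at h2
    rw [Path.mul_t h1'] at h2'
    rw [Path.mul_assoc h1 h2, Path.mul_assoc h1' h2'] at h3
    have h4 := Path.mul_left_cancel (by rw [Path.mul_o]; exact h1) (by rw [Path.mul_o]; exact h1') h3
    have h5 := congrArg Path.edges h4
    rw [(Path.isDirected_single he).mul_edges hd h2,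
      (Path.isDirected_single hf).mul_edges hd' h2'] at h5
    have h6 : e = f := (List.cons.inj h5).1
    subst h6
    rfl
  meet := by
    intro u v
    by_cases h : Disjoint (E.cover.reach u) (E.cover.reach v)
    · exact Or.inl h
    obtain ⟨r, hu, hv⟩ := Set.not_disjoint_iff.1 h
    obtain ⟨a, ha, hao, hav, har, l, hl, hal⟩ := cover_meet hu hv
    refine Or.inr ⟨u.mul a, Set.Subset.antisymm ?_ ?_⟩
    · rintro s ⟨hsu, hsv⟩
      obtain ⟨b, hb, hbo, hbv, hbs, m, hm, hbm⟩ := cover_meet hsu hsv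
      have : a = b := by
        ext1
        · rw [← hao, hbo]
        · exact append_unique ha hb hl hm (hal.symm.trans hbm)
      rw [this]; exact hbs
    · refine Set.subset_inter (reach_subset ?_) (reach_subset hav)
      exact mem_cover_reach_iff.2 ⟨a, ha, hao, rfl⟩

theorem cover_isSetRing : MeasureTheory.IsSetRing E.cover.boolRing := E.cover_branching.isSetRing

/-! ### The action of the groupoid of paths on the spectrum of the universal cover -/

theorem exists_base (x : E.cover.Spectrum) :
    ∃ v : E.V, ∃ p : E.Path, p.o = v ∧ E.cover.reach p ∈ x.1 := by
  obtain ⟨p, hp⟩ := x.exists_reach E.cover_branching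
  exact ⟨_, p, rfl, hp⟩

/-- The fibre map `λ`: the ultrafilter `x` lives on the component of `Ẽ` consisting of the paths
with origin `λ(x)`. -/
noncomputable def base (x : E.cover.Spectrum) : E.V := (E.exists_base x).choose

variable {E}

theorem cover_reach_o {p q : E.Path} (h : q ∈ E.cover.reach p) : q.o = p.o := by
  obtain ⟨d, _, _, rfl⟩ := mem_cover_reach_iff.1 h
  exact Path.mul_o _ _

theorem base_eq {x : E.cover.Spectrum} {p : E.Path} (h : E.cover.reach p ∈ x.1) :
    E.base x = p.o := by
  obtain ⟨q, hq, hx⟩ := (E.exists_base x).choose_spec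
  obtain ⟨r, h1, h2⟩ := Set.not_disjoint_iff.1 (x.not_disjoint h hx)
  rw [← cover_reach_o h1, cover_reach_o h2, hq]; rfl

theorem exists_reach_base (x : E.cover.Spectrum) :
    ∃ p : E.Path, p.o = E.base x ∧ E.cover.reach p ∈ x.1 :=
  (E.exists_base x).choose_spec

/-- The part of the component over the source of `α` that left translation by `α` carries into
`B`. -/
def translate (α : E.Path) (B : Set E.cover.V) : Set E.cover.V :=
  {p : E.Path | α.t = p.o ∧ α.mul p ∈ B}

theorem translate_reach {α q : E.Path} (h : α.o = q.o) :
    translate α (E.cover.reach q) = E.cover.reach (α.inv.mul q) := by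
  have h1 : (α.inv.mul q).t = q.t := Path.mul_t (by rw [Path.inv_t, h])
  ext p
  constructor
  · rintro ⟨h2, h3⟩
    obtain ⟨d, hd, hdo, h4⟩ := mem_cover_reach_iff.1 h3
    refine mem_cover_reach_iff.2 ⟨d, hd, by rw [h1, hdo], ?_⟩
    rw [Path.mul_assoc (by rw [Path.inv_t, h]) hdo, ← h4, Path.inv_mul_cancel_left h2]
  · intro h2
    obtain ⟨d, hd, hdo, rfl⟩ := mem_cover_reach_iff.1 h2
    refine ⟨by rw [Path.mul_o, Path.mul_o, Path.inv_o], mem_cover_reach_iff.2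
      ⟨d, hd, by rw [← h1, hdo], ?_⟩⟩
    rw [← Path.mul_assoc (by rw [Path.mul_o, Path.inv_o]) hdo, Path.mul_inv_cancel_left h]

theorem translate_reach_of_ne {α q : E.Path} (h : α.o ≠ q.o) :
    translate α (E.cover.reach q) = ∅ := by
  refine Set.eq_empty_of_forall_notMem fun p hp => h ?_
  rw [← cover_reach_o hp.2, Path.mul_o]

theorem translate_mem_ring (α : E.Path) {B : Set E.cover.V} (hB : B ∈ E.cover.boolRing) :
    translate α B ∈ E.cover.boolRing := by
  have hR := E.cover_isSetRing
  have hr : ∀ q, translate α (E.cover.reach q) ∈ E.cover.boolRing := by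
    intro q
    by_cases h : α.o = Path.o q
    · rw [translate_reach h]; exact reach_mem_ring _
    · rw [translate_reach_of_ne h]; exact empty_mem_ring
  obtain ⟨I, hI, _, rfl⟩ := hB
  have h1 : translate α (⋃₀ (I : Set (Set E.cover.V))) = ⋃ D ∈ I, translate α D := by
    ext p
    have h1 : ∀ B : Set E.cover.V, p ∈ translate α B ↔ α.t = Path.o p ∧ α.mul p ∈ B :=
      fun B => Iff.rfl
    simp only [h1, Set.mem_sUnion, Set.mem_iUnion, Finset.mem_coe, exists_prop]
    constructor
    · rintro ⟨h, D, hD, hp⟩; exact ⟨D, hD, h, hp⟩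
    · rintro ⟨D, hD, h, hp⟩; exact ⟨h, D, hD, hp⟩
  rw [h1]
  refine hR.biUnion_mem I fun D hD => ?_
  rcases hI hD with rfl | ⟨q, F, hF, fF, rfl⟩
  · have : translate α (∅ : Set E.cover.V) = ∅ := Set.eq_empty_of_forall_notMem fun p hp => hp.2
    rw [this]; exact empty_mem_ring
  · have : translate α (E.cover.reachOff q F) = translate α (E.cover.reach q) \
        ⋃ e ∈ fF.toFinset, translate α (E.cover.reach (E.cover.t e)) := by
      rw [E.cover_branching.reachOff_eq hF]
      ext p
      have h1 : ∀ B : Set E.cover.V, p ∈ translate α B ↔ α.t = Path.o p ∧ α.mul p ∈ B :=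
        fun B => Iff.rfl
      simp only [h1, Set.mem_sdiff, Set.mem_iUnion, Set.Finite.mem_toFinset, exists_prop]
      constructor
      · rintro ⟨h, h2, h3⟩; exact ⟨⟨h, h2⟩, fun ⟨e, he, _, h4⟩ => h3 ⟨e, he, h4⟩⟩
      · rintro ⟨⟨h, h2⟩, h3⟩; exact ⟨h, h2, fun ⟨e, he, h4⟩ => h3 ⟨e, he, h, h4⟩⟩
    rw [this]
    exact hR.sdiff_mem (hr q) (hR.biUnion_mem _ fun e _ => hr _)

theorem act_maximal {α : E.Path} {x : E.cover.Spectrum} (h : α.t = E.base x) :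
    Maximal E.cover.IsFilter {B | B ∈ E.cover.boolRing ∧ translate α B ∈ x.1} := by
  have hR := E.cover_isSetRing
  have hx := x.isFilter
  have hf : E.cover.IsFilter {B | B ∈ E.cover.boolRing ∧ translate α B ∈ x.1} := by
    refine ⟨fun B hB => hB.1, ?_, ?_, ?_, ?_⟩
    · obtain ⟨p, hp, hpx⟩ := exists_reach_base x
      refine ⟨E.cover.reach (α.mul p), reach_mem_ring _, ?_⟩
      rw [translate_reach (Path.mul_o _ _).symm, Path.inv_mul_cancel_left (by rw [h, hp])]
      exact hpx
    · rintro ⟨_, h1⟩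
      have : translate α (∅ : Set E.cover.V) = ∅ := Set.eq_empty_of_forall_notMem fun p hp => hp.2
      rw [this] at h1; exact hx.empty_notMem h1
    · rintro B ⟨hB, hB'⟩ C ⟨hC, hC'⟩
      refine ⟨hR.inter_mem hB hC, ?_⟩
      have : translate α (B ∩ C) = translate α B ∩ translate α C := by
        ext p; simp only [translate]; constructor
        · rintro ⟨h, h1, h2⟩; exact ⟨⟨h, h1⟩, h, h2⟩
        · rintro ⟨⟨h, h1⟩, _, h2⟩; exact ⟨h, h1, h2⟩
      rw [this]; exact hx.inter_mem _ hB' _ hC'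
    · rintro B ⟨hB, hB'⟩ C hC hBC
      exact ⟨hC, hx.mem_of_superset _ hB' _ (translate_mem_ring α hC) fun p hp => ⟨hp.1, hBC hp.2⟩⟩
  refine (E.cover_branching.maximal_iff hf).2 ?_
  rintro B hB C ⟨hC, hC'⟩
  rcases x.mem_or E.cover_branching (translate_mem_ring α hB) hC' with h1 | h1
  · refine Or.inl ⟨hR.inter_mem hC hB, ?_⟩
    exact hx.mem_of_superset _ h1 _ (translate_mem_ring α (hR.inter_mem hC hB))
      fun p hp => ⟨hp.1.1, hp.1.2, hp.2.2⟩
  · refine Or.inr ⟨hR.sdiff_mem hC hB, ?_⟩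
    exact hx.mem_of_superset _ h1 _ (translate_mem_ring α (hR.sdiff_mem hC hB))
      fun p hp => ⟨hp.1.1, hp.1.2, fun h => hp.2 ⟨hp.1.1, h⟩⟩

open Classical in
/-- The action of the groupoid `G(E)` on the spectrum of `A(Ẽ)` induced by left translation,
defined when the source of `α` is `λ(x)` (otherwise `act α x` has the junk value `x`): a set `B`
belongs to `α x` if and only if `α⁻¹ B` belongs to `x`. -/
noncomputable def act (α : E.Path) (x : E.cover.Spectrum) : E.cover.Spectrum :=
  if h : α.t = E.base x then
    ⟨{B | B ∈ E.cover.boolRing ∧ translate α B ∈ x.1}, act_maximal h⟩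
  else x

theorem mem_act {α : E.Path} {x : E.cover.Spectrum} (h : α.t = E.base x) {B : Set E.cover.V} :
    B ∈ (act α x).1 ↔ B ∈ E.cover.boolRing ∧ translate α B ∈ x.1 := by
  rw [act, dif_pos h]; rfl

theorem base_act {α : E.Path} {x : E.cover.Spectrum} (h : α.t = E.base x) :
    E.base (act α x) = α.o := by
  obtain ⟨p, hp, hpx⟩ := exists_reach_base x
  have : E.cover.reach (α.mul p) ∈ (act α x).1 := by
    rw [mem_act h, translate_reach (Path.mul_o _ _).symm,
      Path.inv_mul_cancel_left (by rw [h, hp])]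
    exact ⟨reach_mem_ring _, hpx⟩
  rw [base_eq this, Path.mul_o]

theorem act_nil (x : E.cover.Spectrum) : act (Path.nil (E.base x)) x = x := by
  have h : (Path.nil (E.base x)).t = E.base x := rfl
  obtain ⟨p, hp, hpx⟩ := exists_reach_base x
  refine Spectrum.ext (Set.ext fun B => ?_)
  rw [mem_act h]
  constructor
  · rintro ⟨hB, hB'⟩
    refine x.isFilter.mem_of_superset _ hB' _ hB fun q hq => ?_
    have := hq.2
    rwa [show E.base x = Path.o q from hq.1, Path.nil_mul] at this
  · intro hB
    have hB' := x.isFilter.subset hB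
    refine ⟨hB', x.isFilter.mem_of_superset _ (x.isFilter.inter_mem _ hB _ hpx) _
      (translate_mem_ring _ hB') fun q hq => ?_⟩
    have hq' : Path.o q = E.base x := (cover_reach_o hq.2).trans hp
    refine ⟨hq'.symm, ?_⟩
    rw [← hq', Path.nil_mul]; exact hq.1

theorem act_act {α β : E.Path} {x : E.cover.Spectrum} (h : α.t = β.o) (h' : β.t = E.base x) :
    act α (act β x) = act (α.mul β) x := by
  have h1 : α.t = E.base (act β x) := by rw [base_act h', h]
  have h2 : (α.mul β).t = E.base x := by rw [Path.mul_t h, h']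
  refine Spectrum.ext (Set.ext fun B => ?_)
  rw [mem_act h1, mem_act h', mem_act h2]
  have : translate β (translate α B) = translate (α.mul β) B := by
    ext p
    constructor
    · rintro ⟨h3, h4, h5⟩
      exact ⟨by rw [Path.mul_t h, h3], by rwa [Path.mul_assoc h h3]⟩
    · rintro ⟨h3, h4⟩
      rw [Path.mul_t h] at h3
      exact ⟨h3, by rw [Path.mul_o, h], by rwa [Path.mul_assoc h h3] at h4⟩
  rw [this]
  exact ⟨fun h => ⟨h.1, h.2.2⟩, fun h => ⟨h.1, translate_mem_ring α h.1, h.2⟩⟩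

theorem isClopen_base (v : E.V) : IsClopen {x : E.cover.Spectrum | E.base x = v} := by
  have : ∀ S : Set E.V, IsOpen {x : E.cover.Spectrum | E.base x ∈ S} := by
    intro S
    have : {x : E.cover.Spectrum | E.base x ∈ S} =
        ⋃ p ∈ {p : E.Path | p.o ∈ S}, E.cover.cyl (E.cover.reach p) := by
      ext x
      simp only [Set.mem_iUnion]
      constructor
      · intro hx
        obtain ⟨p, hp, hpx⟩ := exists_reach_base x
        exact ⟨p, show p.o ∈ S from hp ▸ hx, hpx⟩
      · rintro ⟨p, hp, hpx⟩
        change E.base x ∈ S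
        rw [base_eq hpx]; exact hp
    rw [this]
    exact isOpen_biUnion fun p _ => Spectrum.isOpen_cyl (reach_mem_ring _)
  exact ⟨⟨this {v}ᶜ⟩, this {v}⟩

theorem continuous_act (α : E.Path) : Continuous (act α) := by
  refine continuous_generateFrom_iff.2 ?_
  rintro O ⟨B, hB, rfl⟩
  have : act α ⁻¹' E.cover.cyl B =
      ({x | E.base x = α.t} ∩ E.cover.cyl (translate α B)) ∪
      ({x | E.base x = α.t}ᶜ ∩ E.cover.cyl B) := by
    ext x
    by_cases h : E.base x = α.t
    · have h1 : x ∈ act α ⁻¹' E.cover.cyl B ↔ B ∈ (act α x).1 := Iff.rfl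
      rw [h1, mem_act h.symm]
      constructor
      · exact fun h2 => Or.inl ⟨h, h2.2⟩
      · rintro (h2 | h2)
        · exact ⟨hB, h2.2⟩
        · exact absurd h h2.1
    · have h1 : act α x = x := by rw [act, dif_neg (Ne.symm h)]
      have h2 : x ∈ act α ⁻¹' E.cover.cyl B ↔ B ∈ x.1 := by
        rw [← h1]; simp only [Set.mem_preimage, h1]; rfl
      rw [h2]
      constructor
      · exact fun h3 => Or.inr ⟨h, h3⟩
      · rintro (h3 | h3)
        · exact absurd h3.1 h
        · exact h3.2
  rw [this]
  exact ((isClopen_base _).isOpen.inter (Spectrum.isOpen_cyl (translate_mem_ring α hB))).union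
    ((isClopen_base _).compl.isOpen.inter (Spectrum.isOpen_cyl hB))

/-! ### The transversal of directed paths -/

/-- The point `x` of the spectrum of `A(Ẽ)` is represented by a directed path of `E`: either `x` is
the fixed ultrafilter of a finite directed path, or it is the ultrafilter of an infinite directed
path `p 0, p 1, …` of `Ẽ` starting at a path `p 0` of length zero. -/
def IsDirectedPoint (x : E.cover.Spectrum) : Prop :=
  (∃ p : E.Path, p.IsDirected ∧ x.1 = E.cover.fixedFilter p) ∨
  (∃ p : ℕ → E.Path, (∃ v, p 0 = Path.nil v) ∧ (∀ n, E.cover.Step (p n) (p (n + 1))) ∧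
    x.1 = E.cover.endFilter p)

theorem isDirectedPoint_iff {x : E.cover.Spectrum} :
    IsDirectedPoint x ↔ E.cover.reach (Path.nil (E.base x)) ∈ x.1 := by
  have hnil : ∀ {v : E.V}, E.cover.reach (Path.nil v) ∈ x.1 → E.base x = v := fun h => base_eq h
  constructor
  · rintro (⟨p, hp, hx⟩ | ⟨p, ⟨v, hv⟩, _, hx⟩)
    · have h1 : E.cover.reach (Path.nil p.o) ∈ x.1 := by
        rw [hx]
        exact ⟨reach_mem_ring _, mem_cover_reach_iff.2 ⟨p, hp, rfl, (Path.nil_mul p).symm⟩⟩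
      rwa [hnil h1]
    · have h1 : E.cover.reach (Path.nil v) ∈ x.1 := by
        rw [hx]
        exact ⟨reach_mem_ring _, 0, by rw [hv]⟩
      rwa [hnil h1]
  · intro h0
    have hT := E.cover_branching
    have hR := E.cover_isSetRing
    have hx := x.isFilter
    have hdir : ∀ p : E.Path, p ∈ E.cover.reach (Path.nil (E.base x)) →
        p.IsDirected ∧ p.o = E.base x := by
      intro p hp
      obtain ⟨d, hd, hdo, rfl⟩ := mem_cover_reach_iff.1 hp
      have h1 : (Path.nil (E.base x)).mul d = d := by
        rw [show E.base x = d.o from hdo, Path.nil_mul]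
      rw [h1]; exact ⟨hd, hdo.symm⟩
    by_cases H : ∃ p : E.Path, p ∈ E.cover.reach (Path.nil (E.base x)) ∧
        E.cover.reach p ∈ x.1 ∧ ∀ q, E.cover.Step p q → E.cover.reach q ∉ x.1
    · obtain ⟨p, hp, hpx, hpn⟩ := H
      have hsub : E.cover.fixedFilter p ⊆ x.1 := by
        rintro B ⟨hB, hpB⟩
        obtain ⟨I, hI, _, rfl⟩ := id hB
        obtain ⟨D, hD, hpD⟩ := hpB
        rcases hI hD with rfl | ⟨q, F, hF, fF, rfl⟩
        · exact absurd hpD (Set.notMem_empty _)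
        have hDr : E.cover.reachOff q F ∈ E.cover.boolRing :=
          basic_mem_ring (reachOff_mem_basic hF fF)
        refine hx.mem_of_superset (E.cover.reachOff q F) ?_ _ hB (Set.subset_sUnion_of_mem hD)
        rcases hpD with hpq | hpq
        · rw [Set.mem_singleton_iff] at hpq
          subst hpq
          rcases x.mem_or hT hDr hpx with h | h
          · exact hx.mem_of_superset _ h _ hDr Set.inter_subset_right
          · have h2 : E.cover.reach p \ E.cover.reachOff p F =
                ⋃₀ ((fF.toFinset.image fun e => E.cover.reach (E.cover.t e) :
                  Finset (Set E.cover.V)) : Set (Set E.cover.V)) := by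
              rw [hT.reachOff_eq hF, sdiff_sdiff_right_self, Finset.coe_image, Set.sUnion_image]
              simp only [Set.Finite.coe_toFinset]
              exact Set.inter_eq_right.2 (Set.iUnion₂_subset fun e he => reach_edge_subset (hF he))
            rw [h2] at h
            obtain ⟨C, hC, hCx⟩ := x.exists_mem_of_sUnion hT _ (by
              intro C hC
              obtain ⟨e, _, rfl⟩ := Finset.mem_image.1 hC
              exact reach_mem_ring _) h
            obtain ⟨e, he, rfl⟩ := Finset.mem_image.1 hC
            have he' := hF (fF.mem_toFinset.1 he)
            exact absurd hCx (hpn _ ⟨e, he'.1, he'.2, rfl⟩)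
        · simp only [Set.mem_iUnion] at hpq
          obtain ⟨e, he, hpe⟩ := hpq
          refine hx.mem_of_superset _ hpx _ hDr fun w hw => Or.inr ?_
          simp only [Set.mem_iUnion]
          exact ⟨e, he, reach_subset hpe hw⟩
      refine Or.inl ⟨p, (hdir p hp).1, Set.Subset.antisymm (fun B hB => ?_) hsub⟩
      refine ⟨hx.subset hB, ?_⟩
      by_contra hpB
      have h1 : E.cover.reach p \ B ∈ x.1 :=
        hsub ⟨hR.sdiff_mem (reach_mem_ring _) (hx.subset hB), self_mem_reach (T := E.cover) p, hpB⟩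
      exact x.not_disjoint h1 hB disjoint_sdiff_left
    · push Not at H
      have H' : ∀ p : {p : E.Path // p ∈ E.cover.reach (Path.nil (E.base x)) ∧
          E.cover.reach p ∈ x.1}, ∃ q : {p : E.Path // p ∈ E.cover.reach (Path.nil (E.base x)) ∧
          E.cover.reach p ∈ x.1}, E.cover.Step p.1 q.1 := by
        rintro ⟨p, hp, hpx⟩
        obtain ⟨q, hq, hqx⟩ := H p hp hpx
        exact ⟨⟨q, reach_subset hp (Relation.ReflTransGen.single hq), hqx⟩, hq⟩
      choose nxt hnxt using H'
      let s : ℕ → {p : E.Path // p ∈ E.cover.reach (Path.nil (E.base x)) ∧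
          E.cover.reach p ∈ x.1} := fun n =>
        nxt^[n] ⟨Path.nil (E.base x), self_mem_reach (T := E.cover) _, h0⟩
      have hs : ∀ n, E.cover.Step (s n).1 (s (n + 1)).1 := by
        intro n
        simp only [s, Function.iterate_succ_apply']
        exact hnxt _
      have hlen : ∀ n, (s n).1.edges.length = n := by
        intro n
        induction n with
        | zero => rfl
        | succ n ih =>
          obtain ⟨e, he, h1, h2⟩ := cover_step_iff.1 (hs n)
          rw [h2, (hdir _ (s n).2.1).1.mul_edges (Path.isDirected_single he) h1, List.length_append,
            ih]
          rfl
      refine Or.inr ⟨fun n => (s n).1, ⟨_, rfl⟩, hs, Set.Subset.antisymm (fun B hB => ?_) ?_⟩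
      · refine ⟨hx.subset hB, ?_⟩
        obtain ⟨q, F, hF, fF, hDx, hDB⟩ := x.exists_basic hT hB
        have hqx : E.cover.reach q ∈ x.1 :=
          hx.mem_of_superset _ hDx _ (reach_mem_ring q) (reachOff_subset_reach q F)
        rcases hT.meet q (Path.nil (E.base x)) with hd | ⟨m, hm⟩
        · exact absurd hd (x.not_disjoint hqx h0)
        have hmm : m ∈ E.cover.reach q ∩ E.cover.reach (Path.nil (E.base x)) :=
          hm ▸ self_mem_reach (T := E.cover) m
        have hmx : E.cover.reach m ∈ x.1 := hm ▸ hx.inter_mem _ hqx _ h0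
        set j := m.edges.length with hj
        obtain ⟨r, hr1, hr2⟩ := Set.not_disjoint_iff.1 (x.not_disjoint hmx (s j).2.2)
        have hms : m = (s j).1 := by
          obtain ⟨a, ha, hao, hra⟩ := mem_cover_reach_iff.1 hr1
          obtain ⟨b, hb, hbo, hrb⟩ := mem_cover_reach_iff.1 hr2
          have h1 := (hdir _ hmm.2).1.mul_edges ha hao
          have h2 := (hdir _ (s j).2.1).1.mul_edges hb hbo
          rw [← hra, hrb, h2] at h1
          ext1
          · rw [(hdir _ hmm.2).2, (hdir _ (s j).2.1).2]
          · exact ((List.append_inj h1 (by rw [hlen])).1).symm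
        have hq1 : (s (j + 1)).1 ∈ E.cover.reach q := by
          refine reach_subset hmm.1 ?_
          rw [hms]; exact Relation.ReflTransGen.single (hs j)
        have hne : (s (j + 1)).1 ≠ q := by
          intro h
          obtain ⟨d, hd, hdo, h1⟩ := mem_cover_reach_iff.1 hmm.1
          have h2 : q.IsDirected := by rw [← h]; exact (hdir _ (s (j + 1)).2.1).1
          have h3 := congrArg List.length (h2.mul_edges hd hdo)
          rw [← h1, List.length_append, ← h, hlen] at h3
          omega
        obtain ⟨e, he, h1, h2 | h2⟩ := hT.cases_reachOff hF hq1 hne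
        · exact absurd (h2.2.mono_right (reach_subset h1)) (x.not_disjoint hDx (s (j + 1)).2.2)
        · exact ⟨j + 1, (reach_subset h1).trans (h2.2.trans hDB)⟩
      · rintro B ⟨hB, j, hj⟩
        exact hx.mem_of_superset _ (s j).2.2 _ hB hj

/-- The points of `∂(Ẽ,S̃)`, where `S̃` is the set of paths ending in `S`, represented by directed
paths of `E`: the clopen transversal `X(E,S)`. -/
def transversal (S : Set E.V) : Set E.cover.Spectrum :=
  {x | x ∈ E.cover.boundary {p | Path.t p ∈ S} ∧ IsDirectedPoint x}

theorem isClopen_isDirectedPoint : IsClopen {x : E.cover.Spectrum | IsDirectedPoint x} := by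
  have h1 : {x : E.cover.Spectrum | IsDirectedPoint x} =
      ⋃ v : E.V, E.cover.cyl (E.cover.reach (Path.nil v)) := by
    ext x
    simp only [Set.mem_iUnion]
    constructor
    · exact fun h => ⟨_, isDirectedPoint_iff.1 h⟩
    · rintro ⟨v, hv⟩
      refine isDirectedPoint_iff.2 ?_
      have : E.base x = v := base_eq hv
      rw [this]; exact hv
  have h2 : {x : E.cover.Spectrum | IsDirectedPoint x}ᶜ =
      ⋃ v : E.V, {x | E.base x = v} ∩ (E.cover.cyl (E.cover.reach (Path.nil v)))ᶜ := by
    ext x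
    simp only [Set.mem_iUnion]
    constructor
    · exact fun h => ⟨E.base x, rfl, fun h' => h (isDirectedPoint_iff.2 h')⟩
    · rintro ⟨v, rfl, hv⟩ h
      exact hv (isDirectedPoint_iff.1 h)
  refine ⟨⟨?_⟩, ?_⟩
  · rw [h2]
    exact isOpen_iUnion fun v => (isClopen_base v).isOpen.inter
      (Spectrum.isClopen_cyl E.cover_branching (reach_mem_ring _)).compl.isOpen
  · rw [h1]
    exact isOpen_iUnion fun v => Spectrum.isOpen_cyl (reach_mem_ring _)

theorem mem_boundary_act_iff (S : Set E.V) {α : E.Path} {x : E.cover.Spectrum}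
    (h : α.t = E.base x) : act α x ∈ E.cover.boundary {p | Path.t p ∈ S} ↔
      x ∈ E.cover.boundary {p | Path.t p ∈ S} := by
  have key : ∀ (β : E.Path) (y : E.cover.Spectrum), β.t = E.base y →
      y ∉ E.cover.boundary {p | Path.t p ∈ S} →
      act β y ∉ E.cover.boundary {p | Path.t p ∈ S} := by
    intro β y hβ hy hay
    simp only [boundary, Set.mem_ofPred_eq, not_forall, not_not] at hy hay
    obtain ⟨p, hp, hyp⟩ := hy
    have hpo : β.t = p.o := by
      rw [hβ]
      refine base_eq ?_
      rw [hyp]; exact ⟨reach_mem_ring _, self_mem_reach (T := E.cover) p⟩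
    refine hay (β.mul p) (by rw [Path.mul_t hpo]; exact hp) ?_
    ext B
    rw [mem_act hβ, hyp]
    exact ⟨fun h => ⟨h.1, h.2.2.2⟩, fun h => ⟨h.1, translate_mem_ring β h.1, hpo, h.2⟩⟩
  refine ⟨fun h1 => by_contra fun h2 => key α x h h2 h1, fun h1 => by_contra fun h2 => ?_⟩
  refine key α.inv (act α x) (by rw [Path.inv_t, base_act h]) h2 ?_
  rw [act_act (Path.inv_t α) h, Path.inv_mul, h, act_nil]
  exact h1

/-! ### The Toeplitz graph groupoid and its convolution algebra -/

instance : TopologicalSpace E.Path := ⊥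
instance : DiscreteTopology E.Path := ⟨rfl⟩

variable (E) in
/-- The Toeplitz graph groupoid: the restriction to the transversal `X(E,S)` of the transformation
groupoid of the action of `G(E)` on `∂(Ẽ,S̃)`. Its elements are the pairs `(α,x)` such that the
source of `α` is `λ(x)` and both `x` and `αx` belong to `X(E,S)`. -/
@[ext]
structure ToeplitzGroupoid (S : Set E.V) where
  /-- the element `α` of `G(E)` -/
  path : E.Path
  /-- the point `x` -/
  point : E.cover.Spectrum
  composable : path.t = E.base point
  point_mem : point ∈ transversal S
  act_mem : act path point ∈ transversal S

namespace ToeplitzGroupoid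

variable {S : Set E.V}

/-- The topology is the relative product topology, where `G(E)` is discrete. -/
noncomputable instance : TopologicalSpace (E.ToeplitzGroupoid S) :=
  TopologicalSpace.induced (fun γ => (γ.path, γ.point)) inferInstance

/-- The source `s(α,x) = x`. -/
def src (γ : E.ToeplitzGroupoid S) : E.cover.Spectrum := γ.point

/-- The range `r(α,x) = αx`. -/
noncomputable def rng (γ : E.ToeplitzGroupoid S) : E.cover.Spectrum := act γ.path γ.point

theorem comp_aux {γ δ : E.ToeplitzGroupoid S} (h : γ.src = δ.rng) : γ.path.t = δ.path.o := by
  rw [γ.composable, ← base_act δ.composable]; exact congrArg E.base h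

/-- The product `(α,βx)(β,x) = (αβ,x)`. -/
noncomputable def mul (γ δ : E.ToeplitzGroupoid S) (h : γ.src = δ.rng) : E.ToeplitzGroupoid S where
  path := γ.path.mul δ.path
  point := δ.point
  composable := by rw [Path.mul_t (comp_aux h), δ.composable]
  point_mem := δ.point_mem
  act_mem := by
    rw [← act_act (comp_aux h) δ.composable]
    have : act δ.path δ.point = γ.point := h.symm
    rw [this]; exact γ.act_mem

/-- The inverse `(α,x)⁻¹ = (α⁻¹,αx)`. -/
noncomputable def inv (γ : E.ToeplitzGroupoid S) : E.ToeplitzGroupoid S where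
  path := γ.path.inv
  point := γ.rng
  composable := by rw [Path.inv_t, rng, base_act γ.composable]
  point_mem := γ.act_mem
  act_mem := by
    rw [rng, act_act (Path.inv_t _) γ.composable, Path.inv_mul, γ.composable, act_nil]
    exact γ.point_mem

theorem src_inv (γ : E.ToeplitzGroupoid S) : γ.inv.src = γ.rng := rfl

theorem rng_inv (γ : E.ToeplitzGroupoid S) : γ.inv.rng = γ.src := by
  change act γ.path.inv (act γ.path γ.point) = γ.point
  rw [act_act (Path.inv_t _) γ.composable, Path.inv_mul, γ.composable, act_nil]

theorem isEmbedding : IsEmbedding (fun γ : E.ToeplitzGroupoid S => (γ.path, γ.point)) :=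
  ⟨⟨rfl⟩, fun _ _ h => ToeplitzGroupoid.ext (congrArg Prod.fst h) (congrArg Prod.snd h)⟩

instance : T2Space (E.ToeplitzGroupoid S) := by
  have := Spectrum.t2Space E.cover_branching
  exact isEmbedding.t2Space

theorem continuous_path : Continuous (fun γ : E.ToeplitzGroupoid S => γ.path) :=
  continuous_fst.comp isEmbedding.continuous

theorem continuous_point : Continuous (fun γ : E.ToeplitzGroupoid S => γ.point) :=
  continuous_snd.comp isEmbedding.continuous

theorem continuous_act_uncurry : Continuous fun z : E.Path × E.cover.Spectrum => act z.1 z.2 :=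
  continuous_prod_of_discrete_left.2 continuous_act

theorem continuous_rng : Continuous (rng (S := S)) :=
  continuous_act_uncurry.comp isEmbedding.continuous

theorem continuous_of_comp {Z : Type*} [TopologicalSpace Z] {φ : Z → E.ToeplitzGroupoid S}
    (h1 : Continuous fun z => (φ z).path) (h2 : Continuous fun z => (φ z).point) :
    Continuous φ :=
  isEmbedding.continuous_iff.2 (h1.prodMk h2)

theorem continuous_inv : Continuous (inv (S := S)) :=
  continuous_of_comp ((continuous_of_discreteTopology (f := Path.inv)).comp continuous_path)
    continuous_rng

theorem continuous_mul {Z : Type*} [TopologicalSpace Z] {φ ψ : Z → E.ToeplitzGroupoid S}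
    (hφ : Continuous φ) (hψ : Continuous ψ) (h : ∀ z, (φ z).src = (ψ z).rng) :
    Continuous fun z => (φ z).mul (ψ z) (h z) :=
  continuous_of_comp
    ((continuous_of_discreteTopology (f := fun z : E.Path × E.Path => z.1.mul z.2)).comp
      ((continuous_path.comp hφ).prodMk (continuous_path.comp hψ)))
    (show Continuous fun z => (ψ z).point from continuous_point.comp hψ)

/-- The convolution `(f * g)(γ) = ∑ f(γβ⁻¹) g(β)`, the sum being taken over the `β` with the same
source as `γ`; for functions of compact support it has finitely many nonzero terms. -/
noncomputable def convFun (f g : C_c(E.ToeplitzGroupoid S, ℂ)) (γ : E.ToeplitzGroupoid S) : ℂ :=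
  ∑ᶠ β : {β : E.ToeplitzGroupoid S // β.src = γ.src},
    f (γ.mul β.1.inv (by rw [rng_inv, β.2])) * g β.1

/-- The `γ` for which `(a, γ.point)` is an element of the groupoid. -/
def slice (S : Set E.V) (a : E.Path) : Set (E.ToeplitzGroupoid S) :=
  {γ | a.t = E.base γ.point ∧ act a γ.point ∈ transversal S}

/-- The element `(a, γ.point)` of the groupoid. -/
def ofSlice {a : E.Path} (γ : E.ToeplitzGroupoid S) (h : γ ∈ slice S a) : E.ToeplitzGroupoid S :=
  ⟨a, γ.point, h.1, γ.point_mem, h.2⟩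

theorem isClopen_slice (a : E.Path) : IsClopen (slice S a) := by
  have h1 : slice S a = (fun γ : E.ToeplitzGroupoid S => γ.point) ⁻¹'
      ({x | E.base x = a.t} ∩ act a ⁻¹' {x | IsDirectedPoint x}) := by
    ext γ
    constructor
    · rintro ⟨h, h'⟩; exact ⟨h.symm, h'.2⟩
    · rintro ⟨h, h'⟩
      exact ⟨Eq.symm h, (mem_boundary_act_iff S (Eq.symm h)).2 γ.point_mem.1, h'⟩
  rw [h1]
  exact ((isClopen_base _).inter (isClopen_isDirectedPoint.preimage (continuous_act a))).preimage
    continuous_point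

open Classical in
/-- One term of the convolution. -/
noncomputable def term (f g : C_c(E.ToeplitzGroupoid S, ℂ)) (a : E.Path)
    (γ : E.ToeplitzGroupoid S) : ℂ :=
  if h : γ ∈ slice S a then f (γ.mul (γ.ofSlice h).inv (by rw [rng_inv]; rfl)) * g (γ.ofSlice h)
  else 0

theorem continuous_term (f g : C_c(E.ToeplitzGroupoid S, ℂ)) (a : E.Path) :
    Continuous (term f g a) := by
  have hc := isClopen_slice (S := S) a
  rw [← continuousOn_univ, ← Set.union_compl_self (slice S a)]
  refine ContinuousOn.union_of_isOpen ?_ ?_ hc.isOpen hc.compl.isOpen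
  · rw [continuousOn_iff_continuous_domRestrict]
    have h1 : Continuous fun z : slice S a => z.1.ofSlice z.2 :=
      continuous_of_comp continuous_const
        (show Continuous fun z : slice S a => z.1.point from
          continuous_point.comp continuous_subtype_val)
    have h2 : (slice S a).domRestrict (term f g a) = fun z : slice S a =>
        f (z.1.mul (z.1.ofSlice z.2).inv (by rw [rng_inv]; rfl)) * g (z.1.ofSlice z.2) := by
      funext z; simp only [Set.domRestrict_apply, term, dif_pos z.2]
    rw [h2]
    exact (f.continuous.comp (continuous_mul continuous_subtype_val
      (continuous_inv.comp h1) _)).mul (g.continuous.comp h1)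
  · refine continuousOn_const (c := (0 : ℂ)) |>.congr fun γ hγ => ?_
    simp only [term, dif_neg hγ]

theorem convFun_eq_sum (f g : C_c(E.ToeplitzGroupoid S, ℂ)) (A : Finset E.Path)
    (hA : ∀ γ, g γ ≠ 0 → γ.path ∈ A) (γ : E.ToeplitzGroupoid S) :
    convFun f g γ = ∑ a ∈ A, term f g a γ := by
  let e : {β : E.ToeplitzGroupoid S // β.src = γ.src} ≃ {a : E.Path | γ ∈ slice S a} :=
    { toFun := fun β => ⟨β.1.path, by
        have h := β.2
        have h1 : β.1.point = γ.point := h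
        exact ⟨by rw [← h1]; exact β.1.composable, by rw [← h1]; exact β.1.act_mem⟩⟩
      invFun := fun a => ⟨γ.ofSlice a.2, rfl⟩
      left_inv := fun β => Subtype.ext (ToeplitzGroupoid.ext rfl β.2.symm)
      right_inv := fun a => rfl }
  have h1 : convFun f g γ = ∑ᶠ a : {a : E.Path | γ ∈ slice S a}, term f g a γ := by
    unfold convFun
    rw [← finsum_comp_equiv e.symm]
    refine finsum_congr fun a => ?_
    have h : γ ∈ slice S a.1 := a.2
    simp only [term, dif_pos h]; rfl
  have h0 : ∀ a, γ ∉ slice S a → term f g a γ = 0 := fun a h => by simp only [term, dif_neg h]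
  have h2 : Function.support (fun a => term f g a γ) ⊆ {a : E.Path | γ ∈ slice S a} := by
    intro a ha
    by_contra h
    exact ha (h0 a h)
  rw [h1, finsum_set_coe_eq_finsum_mem (f := fun a => term f g a γ) {a : E.Path | γ ∈ slice S a},
    finsum_mem_def, Set.indicator_eq_self.2 h2]
  refine finsum_eq_finsetSum_of_support_subset _ fun a ha => ?_
  have h := h2 ha
  have h' : γ ∈ slice S a := h
  simp only [Function.mem_support, term, dif_pos h'] at ha
  exact hA _ (right_ne_zero_of_mul ha)

theorem exists_finset (g : C_c(E.ToeplitzGroupoid S, ℂ)) :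
    ∃ A : Finset E.Path, ∀ γ, g γ ≠ 0 → γ.path ∈ A := by
  have h := (g.hasCompactSupport.isCompact.image continuous_path).finite_of_discrete
  exact ⟨h.toFinset, fun γ hγ => h.mem_toFinset.2 ⟨γ, subset_tsupport _ hγ, rfl⟩⟩

theorem continuous_convFun (f g : C_c(E.ToeplitzGroupoid S, ℂ)) : Continuous (convFun f g) := by
  obtain ⟨A, hA⟩ := exists_finset g
  rw [funext (convFun_eq_sum f g A hA)]
  exact continuous_finsetSum _ fun a _ => continuous_term f g a

theorem hasCompactSupport_convFun (f g : C_c(E.ToeplitzGroupoid S, ℂ)) :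
    HasCompactSupport (convFun f g) := by
  let P : Set (E.ToeplitzGroupoid S × E.ToeplitzGroupoid S) := {z | z.1.src = z.2.rng}
  have := Spectrum.t2Space E.cover_branching
  have hP : IsClosed P :=
    isClosed_eq (continuous_point.comp continuous_fst) (continuous_rng.comp continuous_snd)
  let m : P → E.ToeplitzGroupoid S := fun z => z.1.1.mul z.1.2 z.2
  have hm : Continuous m := continuous_mul (continuous_fst.comp continuous_subtype_val)
    (continuous_snd.comp continuous_subtype_val) _
  have hK := (hP.isClosedEmbedding_subtypeVal.isCompact_preimage
    (f.hasCompactSupport.isCompact.prod g.hasCompactSupport.isCompact)).image hm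
  refine HasCompactSupport.intro hK fun γ hγ => ?_
  unfold convFun
  refine (finsum_congr fun β => ?_).trans finsum_zero
  by_contra hne
  have hβ : β.1.point = γ.point := β.2
  refine hγ ⟨⟨(γ.mul β.1.inv (by rw [rng_inv, β.2]), β.1), ?_⟩, ⟨?_, ?_⟩, ?_⟩
  · rfl
  · exact subset_tsupport _ (left_ne_zero_of_mul hne)
  · exact subset_tsupport _ (right_ne_zero_of_mul hne)
  · have h1 : γ.path.t = β.1.path.t := by rw [γ.composable, β.1.composable, hβ]
    refine ToeplitzGroupoid.ext ?_ hβ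
    change (γ.path.mul β.1.path.inv).mul β.1.path = γ.path
    have h2 := Path.mul_inv_cancel_right (p := γ.path) (q := β.1.path.inv) (by rw [Path.inv_o, h1])
    rwa [Path.inv_inv] at h2

/-- The convolution product on `C_c`. -/
noncomputable def conv (f g : C_c(E.ToeplitzGroupoid S, ℂ)) : C_c(E.ToeplitzGroupoid S, ℂ) :=
  ⟨⟨convFun f g, continuous_convFun f g⟩, hasCompactSupport_convFun f g⟩

theorem inv_inv (γ : E.ToeplitzGroupoid S) : γ.inv.inv = γ :=
  ToeplitzGroupoid.ext (Path.inv_inv _) γ.rng_inv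

/-- The involution `f*(γ) = conj (f(γ⁻¹))` on `C_c`. -/
noncomputable def invol (f : C_c(E.ToeplitzGroupoid S, ℂ)) : C_c(E.ToeplitzGroupoid S, ℂ) where
  toFun γ := star (f γ.inv)
  continuous_toFun := continuous_star.comp (f.continuous.comp continuous_inv)
  hasCompactSupport' := by
    refine HasCompactSupport.intro (f.hasCompactSupport.isCompact.image continuous_inv)
      fun γ hγ => ?_
    have : f γ.inv = 0 := by
      by_contra h
      exact hγ ⟨γ.inv, subset_tsupport _ h, γ.inv_inv⟩
    simp [this]

/-! ### Boundedness of the representations of the convolution algebra -/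

/-- The unit `(λ(x),x)` over the source of `γ` is `γ` itself. -/
def IsUnitElt (γ : E.ToeplitzGroupoid S) : Prop := γ.path = Path.nil (E.base γ.point)

theorem IsUnitElt.rng {γ : E.ToeplitzGroupoid S} (h : γ.IsUnitElt) : γ.rng = γ.point := by
  rw [ToeplitzGroupoid.rng, show γ.path = Path.nil (E.base γ.point) from h, act_nil]

theorem IsUnitElt.inv {γ : E.ToeplitzGroupoid S} (h : γ.IsUnitElt) : γ.inv = γ := by
  refine ToeplitzGroupoid.ext ?_ h.rng
  change γ.path.inv = γ.path
  rw [show γ.path = Path.nil (E.base γ.point) from h]; rfl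

theorem eq_of_isUnitElt {γ β : E.ToeplitzGroupoid S} (h : β.point = γ.point)
    (hβ : β.IsUnitElt) (hγ : (γ.mul β.inv (by rw [rng_inv]; exact h.symm)).IsUnitElt) : β = γ := by
  have h1 : γ.mul β.inv (by rw [rng_inv]; exact h.symm) = γ := by
    refine ToeplitzGroupoid.ext ?_ ?_
    · change γ.path.mul β.inv.path = γ.path
      rw [hβ.inv, show β.path = Path.nil (E.base β.point) from hβ, h, ← γ.composable, Path.mul_nil]
    · change β.inv.point = γ.point
      rw [hβ.inv, h]
  rw [h1] at hγ
  refine ToeplitzGroupoid.ext ?_ h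
  rw [show β.path = Path.nil (E.base β.point) from hβ, h]; exact hγ.symm

theorem conv_units (G : C_c(E.ToeplitzGroupoid S, ℂ)) (hG : ∀ γ, G γ ≠ 0 → γ.IsUnitElt)
    (γ : E.ToeplitzGroupoid S) : conv G G γ = G γ * G γ := by
  change convFun G G γ = _
  unfold convFun
  rw [finsum_eq_single _ ⟨γ, rfl⟩]
  · by_cases h : G γ = 0
    · simp only [h, mul_zero]
    · have h1 : γ.mul γ.inv γ.rng_inv.symm = γ := by
        have hu := hG γ h
        refine ToeplitzGroupoid.ext ?_ ?_
        · change γ.path.mul γ.inv.path = γ.path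
          rw [hu.inv]
          nth_rewrite 2 [show γ.path = Path.nil (E.base γ.point) from hu]
          rw [← γ.composable, Path.mul_nil]
        · change γ.inv.point = γ.point
          rw [hu.inv]
      simp only [h1]
  · rintro ⟨β, hβ⟩ hne
    by_contra h
    refine hne (Subtype.ext (eq_of_isUnitElt hβ (hG _ (right_ne_zero_of_mul h))
      (hG _ (left_ne_zero_of_mul h))))

theorem invol_units (G : C_c(E.ToeplitzGroupoid S, ℂ)) (hG : ∀ γ, G γ ≠ 0 → γ.IsUnitElt)
    (hr : ∀ γ, star (G γ) = G γ) : invol G = G := by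
  ext γ
  change star (G γ.inv) = G γ
  by_cases h : G γ = 0
  · by_cases h' : G γ.inv = 0
    · rw [h', h, star_zero]
    · have := (hG _ h').inv
      rw [inv_inv] at this
      exact absurd (this ▸ h) h'
  · rw [(hG _ h).inv, hr]

theorem conv_invol_self (h : C_c(E.ToeplitzGroupoid S, ℂ)) {a : E.Path} {M : ℝ}
    (ha : ∀ γ, h γ ≠ 0 → γ.path = a) (hM : ∀ γ, ‖h γ‖ ≤ M) (γ : E.ToeplitzGroupoid S) :
    (∃ r : ℝ, conv (invol h) h γ = r ∧ 0 ≤ r ∧ r ≤ M ^ 2) ∧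
      (conv (invol h) h γ ≠ 0 → γ.IsUnitElt) := by
  have h1 : conv (invol h) h γ = term (invol h) h a γ :=
    (convFun_eq_sum _ _ {a} (fun γ hγ => Finset.mem_singleton.2 (ha γ hγ)) γ).trans
      (Finset.sum_singleton _ _)
  have h0 : (∃ r : ℝ, (0 : ℂ) = r ∧ 0 ≤ r ∧ r ≤ M ^ 2) ∧ ((0 : ℂ) ≠ 0 → γ.IsUnitElt) :=
    ⟨⟨0, by simp, le_rfl, sq_nonneg M⟩, fun h => absurd rfl h⟩
  rw [h1]
  by_cases hs : γ ∈ slice S a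
  · by_cases hz : term (invol h) h a γ = 0
    · rw [hz]; exact h0
    · simp only [term, dif_pos hs] at hz ⊢
      set β := γ.ofSlice hs with hβ
      set δ := (γ.mul β.inv (by rw [rng_inv]; rfl)) with hδ
      have hd : h δ.inv ≠ 0 := fun hd => hz (by
        change star (h δ.inv) * h β = 0
        rw [hd, star_zero, zero_mul])
      have hp : δ.inv.path = a := ha _ hd
      have hp1 : γ.path.mul a.inv = a.inv := by
        have : δ.path = a.inv := by rw [← hp]; exact (Path.inv_inv _).symm
        exact this
      have hta : γ.path.t = a.inv.o := by rw [γ.composable, Path.inv_o, hs.1]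
      have hu : γ.IsUnitElt := by
        have h2 := Path.mul_inv_cancel_right (p := γ.path) (q := a.inv) hta
        rw [hp1, Path.mul_inv] at h2
        change γ.path = _
        rw [← h2, Path.inv_o, hs.1]
      have hδβ : δ.inv = β := by
        refine ToeplitzGroupoid.ext hp ?_
        change act (γ.path.mul a.inv) (act a γ.point) = γ.point
        rw [hp1, act_act (Path.inv_t _) hs.1, Path.inv_mul, hs.1, act_nil]
      refine ⟨⟨‖h β‖ ^ 2, ?_, sq_nonneg _, pow_le_pow_left₀ (norm_nonneg _) (hM β) 2⟩,
        fun _ => hu⟩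
      change star (h δ.inv) * h β = _
      rw [hδβ]
      have := Complex.conj_mul' (h β)
      rw [Complex.ofReal_pow]
      exact this
  · have hz : term (invol h) h a γ = 0 := by simp only [term, dif_neg hs]
    rw [hz]; exact h0

/-- `h* * h = M² (2 G - G * G)` for a suitable `G = G*`. -/
theorem exists_root (h : C_c(E.ToeplitzGroupoid S, ℂ)) {a : E.Path} {M : ℝ} (hM0 : 0 < M)
    (ha : ∀ γ, h γ ≠ 0 → γ.path = a) (hM : ∀ γ, ‖h γ‖ ≤ M) :
    ∃ G : C_c(E.ToeplitzGroupoid S, ℂ), invol G = G ∧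
      conv (invol h) h = ((M : ℂ) ^ 2) • ((2 : ℂ) • G - conv G G) := by
  let w : C(ℂ, ℂ) := ⟨fun z => ((1 - √(1 - z.re / M ^ 2) : ℝ) : ℂ), by fun_prop⟩
  have hw : w 0 = 0 := by simp [w]
  set k := conv (invol h) h with hk
  have hGk : ∀ γ, k.compLeft w γ = w (k γ) := CompactlySupportedContinuousMap.compLeft_apply hw k
  have hG : ∀ γ, k.compLeft w γ ≠ 0 → γ.IsUnitElt := by
    intro γ hγ
    refine (conv_invol_self h ha hM γ).2 fun h0 => hγ ?_
    rw [hGk]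
    have h0' : k γ = 0 := h0
    rw [h0', hw]
  refine ⟨k.compLeft w, invol_units _ hG fun γ => ?_, ?_⟩
  · rw [hGk]; exact Complex.conj_ofReal _
  · ext γ
    obtain ⟨r, hr, hr0, hr1⟩ := (conv_invol_self h ha hM γ).1
    have hr' : k γ = r := hr
    have e1 : ((M : ℂ) ^ 2 • ((2 : ℂ) • k.compLeft w - conv (k.compLeft w) (k.compLeft w))) γ =
        (M : ℂ) ^ 2 * (2 * k.compLeft w γ - conv (k.compLeft w) (k.compLeft w) γ) := rfl
    rw [e1, conv_units _ hG, hGk, hr']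
    simp only [w, ContinuousMap.coe_mk, Complex.ofReal_re]
    have hM2 : 0 < M ^ 2 := by positivity
    have hs : √(1 - r / M ^ 2) * √(1 - r / M ^ 2) = 1 - r / M ^ 2 :=
      Real.mul_self_sqrt (by rw [sub_nonneg, div_le_one hM2]; exact hr1)
    have : r = M ^ 2 * (2 * (1 - √(1 - r / M ^ 2)) -
        (1 - √(1 - r / M ^ 2)) * (1 - √(1 - r / M ^ 2))) := by
      have h3 : 2 * (1 - √(1 - r / M ^ 2)) - (1 - √(1 - r / M ^ 2)) * (1 - √(1 - r / M ^ 2)) =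
          1 - √(1 - r / M ^ 2) * √(1 - r / M ^ 2) := by ring
      rw [h3, hs]; field_simp; ring
    exact_mod_cast congrArg (fun x : ℝ => (x : ℂ)) this

open Classical in
/-- The restriction of `f` to the elements `(a,x)` with fixed `a`. -/
noncomputable def piece (f : C_c(E.ToeplitzGroupoid S, ℂ)) (a : E.Path) :
    C_c(E.ToeplitzGroupoid S, ℂ) where
  toFun γ := if γ.path = a then f γ else 0
  continuous_toFun := by
    have hc : IsClopen {γ : E.ToeplitzGroupoid S | γ.path = a} :=
      (isClopen_discrete {a}).preimage continuous_path
    exact continuous_if (fun γ hγ => absurd hγ (by rw [hc.frontier_eq]; exact Set.notMem_empty _))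
      f.continuous.continuousOn continuousOn_const
  hasCompactSupport' := by
    refine HasCompactSupport.intro f.hasCompactSupport.isCompact fun γ hγ => ?_
    split_ifs
    · exact image_eq_zero_of_notMem_tsupport hγ
    · rfl

theorem sum_piece (f : C_c(E.ToeplitzGroupoid S, ℂ)) (A : Finset E.Path)
    (hA : ∀ γ, f γ ≠ 0 → γ.path ∈ A) : f = ∑ a ∈ A, piece f a := by
  classical
  ext γ
  rw [CompactlySupportedContinuousMap.coe_sum, Finset.sum_apply]
  have h1 : ∀ a, piece f a γ = if γ.path = a then f γ else 0 := fun a => by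
    change (if _ then _ else _) = _
    congr
  simp only [h1, Finset.sum_ite_eq]
  split_ifs with h
  · rfl
  · by_contra h2; exact h (hA γ h2)

end ToeplitzGroupoid

/-- A `*`-representation of the convolution algebra `C_c(TG(E,S))` by bounded operators on a
Hilbert space. -/
structure Rep (S : Set E.V) where
  /-- the Hilbert space -/
  H : Type u
  [normed : NormedAddCommGroup H]
  [innerProduct : InnerProductSpace ℂ H]
  [complete : CompleteSpace H]
  /-- the representation -/
  π : C_c(E.ToeplitzGroupoid S, ℂ) →ₗ[ℂ] (H →L[ℂ] H)
  map_conv : ∀ f g, π (ToeplitzGroupoid.conv f g) = π f * π g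
  map_invol : ∀ f, π (ToeplitzGroupoid.invol f) = star (π f)

attribute [instance] Rep.normed Rep.innerProduct Rep.complete

namespace Rep

variable {S : Set E.V}

theorem norm_le_of_slice (ρ : Rep S) (h : C_c(E.ToeplitzGroupoid S, ℂ)) {a : E.Path} {M : ℝ}
    (hM0 : 0 < M) (ha : ∀ γ, h γ ≠ 0 → γ.path = a) (hM : ∀ γ, ‖h γ‖ ≤ M) : ‖ρ.π h‖ ≤ M := by
  obtain ⟨G, hG, hk⟩ := ToeplitzGroupoid.exists_root h hM0 ha hM
  have h1 := congrArg ρ.π hk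
  rw [ρ.map_conv, ρ.map_invol, map_smul, map_sub, map_smul, ρ.map_conv] at h1
  have h2 := ρ.map_invol G
  rw [hG] at h2
  set B := ρ.π G with hB
  set T := ρ.π h with hT
  refine ContinuousLinearMap.opNorm_le_bound _ hM0.le fun x => ?_
  have h3 : star (1 - B) * (1 - B) = 1 - ((2 : ℂ) • B - B * B) := by
    rw [star_sub, star_one, ← h2, sub_mul, mul_sub, mul_sub, two_smul]
    simp only [one_mul, mul_one]; abel
  have h4 : star T * T = ((M : ℂ) ^ 2) • (1 - star (1 - B) * (1 - B)) := by
    rw [h1, h3, sub_sub_cancel]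
  have h5 : ∀ C : ρ.H →L[ℂ] ρ.H, inner ℂ ((star C * C) x) x = ((‖C x‖ : ℂ)) ^ 2 := by
    intro C
    rw [mul_apply_eq_comp, ContinuousLinearMap.star_eq_adjoint,
      ContinuousLinearMap.adjoint_inner_left, inner_self_eq_norm_sq_to_K]; rfl
  have h6 : ((‖T x‖ : ℂ)) ^ 2 = (M : ℂ) ^ 2 * ((‖x‖ : ℂ) ^ 2 - (‖(1 - B) x‖ : ℂ) ^ 2) := by
    rw [← h5 T, h4, smul_apply, inner_smul_left,
      sub_apply, inner_sub_left, h5, one_apply_eq_self,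
      inner_self_eq_norm_sq_to_K]
    simp
  have h7 : ‖T x‖ ^ 2 = M ^ 2 * (‖x‖ ^ 2 - ‖(1 - B) x‖ ^ 2) := by exact_mod_cast h6
  refine abs_le_of_sq_le_sq' ?_ (by positivity) |>.2
  rw [h7, mul_pow]
  gcongr
  nlinarith [sq_nonneg ‖(1 - B) x‖]

open Classical in
/-- The representations of `C_c(TG(E,S))` are uniformly bounded. -/
theorem exists_bound (f : C_c(E.ToeplitzGroupoid S, ℂ)) : ∃ C : ℝ, ∀ ρ : Rep S, ‖ρ.π f‖ ≤ C := by
  obtain ⟨A, hA⟩ := ToeplitzGroupoid.exists_finset f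
  obtain ⟨M, hM⟩ := f.hasCompactSupport.exists_bound_of_continuous f.continuous
  refine ⟨∑ a ∈ A, (|M| + 1), fun ρ => ?_⟩
  have h1 := congrArg ρ.π (ToeplitzGroupoid.sum_piece f A hA)
  rw [h1, map_sum]
  refine norm_sum_le_of_le _ fun a _ => ρ.norm_le_of_slice _ (a := a) (by positivity) ?_ ?_
  · intro γ hγ
    by_contra h
    exact hγ (if_neg h)
  · intro γ
    rw [show ToeplitzGroupoid.piece f a γ = if γ.path = a then f γ else 0 from rfl]
    split_ifs
    · exact (hM γ).trans ((le_abs_self M).trans (by linarith))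
    · rw [norm_zero]; positivity

end Rep
/-! ### The C*-algebra of the Toeplitz graph groupoid -/

/-- The universal representation of `C_c(TG(E,S))`: the direct sum of all representations. -/
noncomputable def univRep (S : Set E.V) (f : C_c(E.ToeplitzGroupoid S, ℂ)) :
    lp (fun ρ : Rep S => ρ.H →L[ℂ] ρ.H) ∞ :=
  ⟨fun ρ => ρ.π f, by
    obtain ⟨C, hC⟩ := Rep.exists_bound f
    exact memℓp_infty ⟨C, by rintro _ ⟨ρ, rfl⟩; exact hC ρ⟩⟩

/-- The image of `C_c(TG(E,S))` in its universal representation. -/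
noncomputable def toeplitzRange (S : Set E.V) :
    NonUnitalStarSubalgebra ℂ (lp (fun ρ : Rep S => ρ.H →L[ℂ] ρ.H) ∞) where
  carrier := Set.range (univRep S)
  add_mem' := by
    rintro _ _ ⟨f, rfl⟩ ⟨g, rfl⟩
    exact ⟨f + g, Subtype.ext (funext fun ρ => map_add ρ.π f g)⟩
  zero_mem' := ⟨0, Subtype.ext (funext fun ρ => map_zero ρ.π)⟩
  smul_mem' := by
    rintro c _ ⟨f, rfl⟩
    exact ⟨c • f, Subtype.ext (funext fun ρ => map_smul ρ.π c f)⟩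
  mul_mem' := by
    rintro _ _ ⟨f, rfl⟩ ⟨g, rfl⟩
    exact ⟨ToeplitzGroupoid.conv f g, Subtype.ext (funext fun ρ => ρ.map_conv f g)⟩
  star_mem' := by
    rintro _ ⟨f, rfl⟩
    exact ⟨ToeplitzGroupoid.invol f, Subtype.ext (funext fun ρ => ρ.map_invol f)⟩

variable (E) in
/-- `TO(E,S) = C*(TG(E,S))`: the completion of `C_c(TG(E,S))` in the supremum of the seminorms
given by all of its `*`-representations on Hilbert spaces. -/
def TO (S : Set E.V) : Type (u + 1) := (toeplitzRange S).topologicalClosure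

noncomputable instance (S : Set E.V) : NonUnitalCStarAlgebra (E.TO S) :=
  NonUnitalStarSubalgebra.nonUnitalCStarAlgebra (toeplitzRange S).topologicalClosure
    (h_closed := (toeplitzRange S).isClosed_topologicalClosure)

/-- The canonical map from `C_c(TG(E,S))` to `TO(E,S)`. -/
noncomputable def toTO {S : Set E.V} (f : C_c(E.ToeplitzGroupoid S, ℂ)) : E.TO S :=
  ⟨univRep S f, (toeplitzRange S).le_topologicalClosure ⟨f, rfl⟩⟩

/-! ### The generators -/

theorem cover_out_finite {p : E.Path} (h : p.t ∈ E.regular) : (E.cover.out p).Finite := by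
  refine ((h.2.image fun e => (p, p.mul (Path.single e))).preimage
    Subtype.val_injective.injOn).subset ?_
  rintro ⟨⟨p', q⟩, hpq, _⟩ ⟨⟨e, he, he'⟩, rfl⟩
  obtain ⟨h1, h2⟩ := Path.eq_mul_single (p := p') (q := q) hpq he'
  exact ⟨e, ⟨he, h1.symm⟩, Prod.ext rfl h2.symm⟩

theorem isClosed_boundary {S : Set E.V} (hS : S ⊆ E.regular) :
    IsClosed (E.cover.boundary {p | Path.t p ∈ S}) := by
  have h1 : ∀ (p : E.Path), p.t ∈ S →
      {x : E.cover.Spectrum | x.1 = E.cover.fixedFilter p} = E.cover.cyl {p} ∧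
        ({p} : Set E.cover.V) ∈ E.cover.boolRing := by
    intro p hp
    have hr : ({p} : Set E.cover.V) ∈ E.cover.boolRing := by
      have h2 : E.cover.reachOff p (E.cover.out p) = {p} := by
        simp only [reachOff, sdiff_self, Set.mem_empty_iff_false,
          Set.iUnion_of_empty, Set.iUnion_empty, Set.union_empty]
      rw [← h2]
      exact basic_mem_ring (reachOff_mem_basic subset_rfl (cover_out_finite (hS hp)))
    refine ⟨Set.ext fun x => ⟨fun hx => ?_, fun hx => Set.Subset.antisymm (fun B hB => ?_) ?_⟩, hr⟩
    · change ({p} : Set E.cover.V) ∈ x.1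
      rw [show x.1 = E.cover.fixedFilter p from hx]
      exact ⟨hr, rfl⟩
    · refine ⟨x.isFilter.subset hB, ?_⟩
      by_contra h
      exact x.not_disjoint hB hx (Set.disjoint_singleton_right.2 h)
    · rintro B ⟨hB, hpB⟩
      exact x.isFilter.mem_of_superset _ hx _ hB (Set.singleton_subset_iff.2 hpB)
  have h2 : (E.cover.boundary {p | Path.t p ∈ S})ᶜ =
      ⋃ p ∈ {p : E.Path | p.t ∈ S}, E.cover.cyl {p} := by
    ext x
    simp only [Set.mem_compl_iff, boundary, Set.mem_ofPred_eq, not_forall, not_not, Set.mem_iUnion,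
      exists_prop]
    constructor
    · rintro ⟨p, hp, hx⟩
      exact ⟨p, hp, (h1 p hp).1 ▸ hx⟩
    · rintro ⟨p, hp, hx⟩
      rw [← (h1 p hp).1] at hx
      exact ⟨p, hp, hx⟩
  refine ⟨?_⟩
  rw [h2]
  exact isOpen_biUnion fun p hp => Spectrum.isOpen_cyl (h1 p hp).2

namespace ToeplitzGroupoid

variable {S : Set E.V}

/-- `{α} × V(t(α))`. -/
def bisection (S : Set E.V) (α : E.Path) : Set (E.ToeplitzGroupoid S) :=
  {γ | γ.path = α ∧ E.cover.reach (Path.nil α.t) ∈ γ.point.sets}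

theorem isClopen_bisection (α : E.Path) : IsClopen (bisection S α) :=
  ((isClopen_discrete {α}).preimage continuous_path).inter
    ((Spectrum.isClopen_cyl E.cover_branching (reach_mem_ring _)).preimage continuous_point)

theorem isCompact_bisection (hS : S ⊆ E.regular) (α : E.Path) : IsCompact (bisection S α) := by
  rw [isEmbedding.isInducing.isCompact_iff]
  let C : Set E.cover.Spectrum := E.cover.cyl (E.cover.reach (Path.nil α.t)) ∩
    ({x | E.base x = α.t} ∩ (E.cover.boundary {p | Path.t p ∈ S} ∩ ({x | IsDirectedPoint x} ∩
      act α ⁻¹' {x | IsDirectedPoint x})))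
  have hC : IsCompact C := (Spectrum.isCompact_cyl E.cover_branching _).inter_right
    ((isClopen_base _).isClosed.inter ((isClosed_boundary hS).inter
      (isClopen_isDirectedPoint.isClosed.inter
        (isClopen_isDirectedPoint.isClosed.preimage (continuous_act α)))))
  have h1 : (fun γ : E.ToeplitzGroupoid S => (γ.path, γ.point)) '' bisection S α = {α} ×ˢ C := by
    ext ⟨β, x⟩
    constructor
    · rintro ⟨γ, ⟨rfl, hγ⟩, hx⟩
      cases hx
      exact ⟨rfl, hγ, γ.composable.symm, γ.point_mem.1, γ.point_mem.2, γ.act_mem.2⟩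
    · rintro ⟨rfl, hx, hb, h2, h3, h4⟩
      have hb' : β.t = E.base x := Eq.symm hb
      exact ⟨⟨β, x, hb', ⟨h2, h3⟩, (mem_boundary_act_iff S hb').2 h2, h4⟩, ⟨rfl, hx⟩, rfl⟩
  rw [h1]
  exact isCompact_singleton.prod hC

open Classical in
/-- The characteristic function of `{α} × V(t(α))`, for `S ⊆ Σ(E)`. -/
noncomputable def charFun (hS : S ⊆ E.regular) (α : E.Path) : C_c(E.ToeplitzGroupoid S, ℂ) where
  toFun := (bisection S α).indicator 1
  continuous_toFun := (isClopen_bisection α).continuous_indicator continuous_one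
  hasCompactSupport' := HasCompactSupport.intro (isCompact_bisection hS α)
    fun _ h => Set.indicator_of_notMem h _

end ToeplitzGroupoid

/-- The generator `P_u` of `TO(E,S)`: the characteristic function of `V(u)`, as a set of units. -/
noncomputable def vertexProj {S : Set E.V} (hS : S ⊆ E.regular) (u : E.V) : E.TO S :=
  toTO (ToeplitzGroupoid.charFun hS (Path.nil u))

/-- The generator `S_e` of `TO(E,S)`: the characteristic function of `{e} × V(t(e))`. -/
noncomputable def edgeIsom {S : Set E.V} (hS : S ⊆ E.regular) (e : E.Edge) : E.TO S :=
  toTO (ToeplitzGroupoid.charFun hS (Path.single e))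

end Paths

/-! ### Inclusions of directed graphs -/

/-- A monomorphism of directed graphs, by which `E₁` is viewed as a subgraph of `E₂`. -/
@[ext]
structure Inclusion (E₁ E₂ : DirectedGraph.{u}) where
  /-- the map on vertices -/
  vertex : E₁.V → E₂.V
  /-- the map on edges -/
  edge : E₁.Edge → E₂.Edge
  vertex_injective : Function.Injective vertex
  edge_injective : Function.Injective edge
  map_o : ∀ e, E₂.o (edge e) = vertex (E₁.o e)
  map_t : ∀ e, E₂.t (edge e) = vertex (E₁.t e)
  map_rev : ∀ e, edge (E₁.rev e) = E₂.rev (edge e)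
  map_pos : ∀ e ∈ E₁.pos, edge e ∈ E₂.pos

namespace Inclusion

variable {E₁ E₂ E₃ : DirectedGraph.{u}}

/-- The identity inclusion. -/
protected def id (E : DirectedGraph.{u}) : Inclusion E E where
  vertex := id
  edge := id
  vertex_injective := Function.injective_id
  edge_injective := Function.injective_id
  map_o _ := rfl
  map_t _ := rfl
  map_rev _ := rfl
  map_pos _ h := h

/-- The composition of inclusions `E₁ ⊆ E₂ ⊆ E₃`. -/
protected def comp (ψ : Inclusion E₂ E₃) (φ : Inclusion E₁ E₂) : Inclusion E₁ E₃ where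
  vertex := ψ.vertex ∘ φ.vertex
  edge := ψ.edge ∘ φ.edge
  vertex_injective := ψ.vertex_injective.comp φ.vertex_injective
  edge_injective := ψ.edge_injective.comp φ.edge_injective
  map_o e := by simp only [Function.comp, ψ.map_o, φ.map_o]
  map_t e := by simp only [Function.comp, ψ.map_t, φ.map_t]
  map_rev e := by simp only [Function.comp, ψ.map_rev, φ.map_rev]
  map_pos e h := ψ.map_pos _ (φ.map_pos e h)

theorem mem_pos_iff (φ : Inclusion E₁ E₂) (e : E₁.Edge) : φ.edge e ∈ E₂.pos ↔ e ∈ E₁.pos := by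
  refine ⟨fun h => by_contra fun h' => ?_, φ.map_pos e⟩
  have h1 := φ.map_pos _ ((E₁.rev_mem_pos_iff e).2 h')
  rw [φ.map_rev] at h1
  exact (E₂.rev_mem_pos_iff _).1 h1 h

/-- The set `S₁ = {v ∈ E₁⁰ ∩ S₂ | Δ₁(v) ⊆ (E₁)¹₊}`, with `Δ₁(v)` formed in `E₂`, induced on the
subgraph `E₁` by a set `S₂` of vertices of `E₂`. -/
def inducedSet (φ : Inclusion E₁ E₂) (S₂ : Set E₂.V) : Set E₁.V :=
  {v | φ.vertex v ∈ S₂ ∧ E₂.out (φ.vertex v) ⊆ φ.edge '' E₁.pos}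

theorem image_out (φ : Inclusion E₁ E₂) {S₂ : Set E₂.V} {v : E₁.V} (h : v ∈ φ.inducedSet S₂) :
    φ.edge '' E₁.out v = E₂.out (φ.vertex v) := by
  ext f
  constructor
  · rintro ⟨e, ⟨he, rfl⟩, rfl⟩
    exact ⟨φ.map_pos e he, φ.map_o e⟩
  · intro hf
    obtain ⟨e, he, rfl⟩ := h.2 hf
    exact ⟨e, ⟨he, φ.vertex_injective ((φ.map_o e).symm.trans hf.2)⟩, rfl⟩

theorem inducedSet_subset_regular (φ : Inclusion E₁ E₂) {S₂ : Set E₂.V} (hS : S₂ ⊆ E₂.regular) :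
    φ.inducedSet S₂ ⊆ E₁.regular := by
  intro v hv
  have h := hS hv.1
  rw [regular, Set.mem_ofPred_eq, ← φ.image_out hv] at h
  exact ⟨h.1.of_image, h.2.of_finite_image φ.edge_injective.injOn⟩

theorem inducedSet_id (E : DirectedGraph.{u}) (S : Set E.V) :
    (Inclusion.id E).inducedSet S = S := by
  ext v
  refine ⟨fun h => h.1, fun h => ⟨h, fun e he => ⟨e, he.1, rfl⟩⟩⟩

theorem inducedSet_comp (ψ : Inclusion E₂ E₃) (φ : Inclusion E₁ E₂) (S : Set E₃.V) :
    (ψ.comp φ).inducedSet S = φ.inducedSet (ψ.inducedSet S) := by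
  ext v
  constructor
  · rintro ⟨h1, h2⟩
    have h3 : E₃.out (ψ.vertex (φ.vertex v)) ⊆ (ψ.edge ∘ φ.edge) '' E₁.pos := h2
    have h4 : φ.vertex v ∈ ψ.inducedSet S := ⟨h1, fun f hf => by
      obtain ⟨e, he, rfl⟩ := h3 hf
      exact ⟨φ.edge e, φ.map_pos e he, rfl⟩⟩
    refine ⟨h4, fun f hf => ?_⟩
    have h5 : ψ.edge f ∈ E₃.out (ψ.vertex (φ.vertex v)) := ψ.image_out h4 ▸ ⟨f, hf, rfl⟩
    obtain ⟨e, he, h6⟩ := h3 h5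
    exact ⟨e, he, ψ.edge_injective h6⟩
  · rintro ⟨h1, h2⟩
    refine ⟨h1.1, fun f hf => ?_⟩
    have hf' : f ∈ E₃.out (ψ.vertex (φ.vertex v)) := hf
    rw [← ψ.image_out h1] at hf'
    obtain ⟨g, hg, rfl⟩ := hf'
    obtain ⟨e, he, rfl⟩ := h2 hg
    exact ⟨e, he, rfl⟩

end Inclusion
end DirectedGraph

/-! ### The category on which the functor is defined -/

/-- A directed graph `E` with a subset `S` of `Σ(E)`. -/
structure GraphPair where
  /-- the directed graph -/
  E : DirectedGraph.{u}
  /-- the set of vertices -/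
  S : Set E.V
  subset : S ⊆ E.regular

namespace GraphPair

/-- A morphism `(E₁,S₁) ⟶ (E₂,S₂)` is an inclusion `E₁ ⊆ E₂` such that `S₁` is the set induced by
`S₂`. -/
@[ext]
structure Hom (P Q : GraphPair.{u}) where
  /-- the inclusion of directed graphs -/
  incl : DirectedGraph.Inclusion P.E Q.E
  eq_inducedSet : P.S = incl.inducedSet Q.S

instance : CategoryTheory.Category GraphPair.{u} where
  Hom P Q := Hom P Q
  id P := ⟨DirectedGraph.Inclusion.id P.E, (DirectedGraph.Inclusion.inducedSet_id P.E P.S).symm⟩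
  comp φ ψ := ⟨ψ.incl.comp φ.incl, by
    rw [DirectedGraph.Inclusion.inducedSet_comp, ← ψ.eq_inducedSet, ← φ.eq_inducedSet]⟩

/-- The pair `(E₁,S₁)` determined by an inclusion `E₁ ⊆ E₂` and a set `S₂ ⊆ Σ(E₂)`. -/
def induced {E₁ E₂ : DirectedGraph.{u}} (φ : DirectedGraph.Inclusion E₁ E₂) {S₂ : Set E₂.V}
    (h : S₂ ⊆ E₂.regular) : GraphPair.{u} :=
  ⟨E₁, φ.inducedSet S₂, φ.inducedSet_subset_regular h⟩

/-- The morphism `(E₁,S₁) ⟶ (E₂,S₂)` given by an arbitrary inclusion `E₁ ⊆ E₂` and an arbitrary set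
`S₂ ⊆ Σ(E₂)`. -/
def ofInclusion {E₁ E₂ : DirectedGraph.{u}} (φ : DirectedGraph.Inclusion E₁ E₂) {S₂ : Set E₂.V}
    (h : S₂ ⊆ E₂.regular) :
    Quiver.Hom (V := GraphPair.{u}) (induced φ h) ⟨E₂, S₂, h⟩ :=
  ⟨φ, rfl⟩

end GraphPair

/-!
# Functoriality of the Toeplitz C*-algebra of a directed graph

Let `φ : E₁ ⊆ E₂` be an inclusion with `S₁` induced by `S₂`. The homomorphism `TO(E₁,S₁) →
TO(E₂,S₂)` extends a pullback of functions along a partially defined map of groupoids `TG(E₂,S₂) →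
TG(E₁,S₁)`. A point `x` of the transversal of `E₂` which is based at a vertex of `E₁` lies over the
point `y` of the transversal of `E₁` represented by the part of the path `x` up to the first edge
outside `E₁`: this is the relation `Inclusion.Over`. The hypothesis on `S₁` ensures that `y`
always belongs to `∂(Ẽ₁,S̃₁)`: if `x` leaves `E₁` at `v`, then `Δ₁(v)` is not contained in `E₁`, so
`v ∉ S₁`, and if `x` itself ends at `v`, then `v ∉ S₂`. The element `(h,x)` lies over `(h,y)`, for
`h ∈ G(E₁)`, and `pull f (h,x) = f (h,y)`, with `pull f` equal to zero at the elements whose path is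
not in `E₁`. This is a `*`-homomorphism of the convolution algebras which respects characteristic
functions, identities and compositions (`pull_conv`, `pull_invol`, `pull_charFun`, `pull_id`,
`pull_comp`). Since representations of the algebra of `E₂` can be composed with `pull`, it does not
increase the universal norm, and extends to the completions (`mapTO`).

The point is that `mapTO` is isometric; equivalently, that `pull` does not decrease the universal
norm. The projection `x ↦ y` has a section `sec`: a path `y` of `E₁` is regarded as a path of `E₂`,
unless it is finite and ends at a vertex of `S₂`. In that case this vertex is not in `S₁`, so some
directed edge leads from it out of `E₁`, and `y` is continued by a boundary path, chosen once for
each vertex, which begins with such an edge (`exists_exits`, `Exits.sec`). The section is continuous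
and equivariant under `G(E₁)`, so that `(h,y) ↦ (h, sec y)` embeds `TG(E₁,S₁)` in `TG(E₂,S₂)`, and
restriction of functions along this embedding is a linear map `restrict` with `restrict (pull f) =
f`. It is positive, as the restriction of functions from a group to a subgroup is: a convolution
square on `E₂` restricts to a finite sum of convolution squares indexed by the cosets of `G(E₁)`
(`restrict_conv_invol`). Here each coset has a shortest element `c`, and by minimality `(c h, sec y)
∈ TG(E₂,S₂)` forces `(h,y) ∈ TG(E₁,S₁)` (`admissible_of_mul`), so that the functions `(h,y) ↦ f (c
h, sec y)` are again of compact support.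

Consequently a vector `ξ` of a representation `ρ` of the algebra of `E₁` defines the positive
functional `f ↦ ⟪ξ, ρ(restrict f) ξ⟫` on the algebra of `E₂`. The representation that it generates
contains, over the image of `pull`, a copy of the cyclic subrepresentation of `ρ` generated by `ξ`
(`Rep.norm_vec_pull`), which bounds `‖ρ(f)‖` by the universal norm of `pull f`
(`Rep.norm_le_norm_univRep_pull`).
-/

namespace DirectedGraph

/-! ### Ultrafilters of `𝒜(T)` and the sets `V(v)` they contain -/

section Tree

variable {T : DirectedGraph.{u}}

theorem reachOff_anti {v : T.V} {F G : Set T.Edge} (h : F ⊆ G) :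
    T.reachOff v G ⊆ T.reachOff v F := by
  rintro w (hw | hw)
  · exact Or.inl hw
  · simp only [mem_iUnion] at hw
    obtain ⟨e, he, hw⟩ := hw
    refine Or.inr ?_
    simp only [mem_iUnion]
    exact ⟨e, ⟨he.1, fun h' => he.2 (h h')⟩, hw⟩

theorem self_mem_reachOff (v : T.V) (F : Set T.Edge) : v ∈ T.reachOff v F := Or.inl rfl

namespace Spectrum

/-- The vertices `v` for which `V(v)` belongs to the ultrafilter `x`. They determine `x`, and every
construction of a point below is made by prescribing them. -/
def nbhd (x : T.Spectrum) : Set T.V := {v | T.reach v ∈ x.sets}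

theorem mem_nbhd {x : T.Spectrum} {v : T.V} : v ∈ x.nbhd ↔ T.reach v ∈ x.sets := Iff.rfl

theorem nbhd_nonempty (hT : T.Branching) (x : T.Spectrum) : x.nbhd.Nonempty := x.exists_reach hT

theorem mem_nbhd_of_mem_reach {x : T.Spectrum} {v w : T.V} (hw : w ∈ x.nbhd)
    (h : w ∈ T.reach v) : v ∈ x.nbhd :=
  x.isFilter.mem_of_superset _ hw _ (reach_mem_ring v) (reach_subset h)

theorem exists_meet (hT : T.Branching) {x : T.Spectrum} {v w : T.V} (hv : v ∈ x.nbhd)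
    (hw : w ∈ x.nbhd) : ∃ m ∈ x.nbhd, T.reach v ∩ T.reach w = T.reach m := by
  rcases hT.meet v w with h | ⟨m, hm⟩
  · exact absurd h (x.not_disjoint hv hw)
  · have h := x.isFilter.inter_mem _ hv _ hw
    rw [hm] at h
    exact ⟨m, h, hm⟩

theorem exists_mem_reach_inter (hT : T.Branching) {x : T.Spectrum} {v w : T.V} (hv : v ∈ x.nbhd)
    (hw : w ∈ x.nbhd) : ∃ m ∈ x.nbhd, m ∈ T.reach v ∧ m ∈ T.reach w := by
  obtain ⟨m, hm, h⟩ := exists_meet hT hv hw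
  have h' : m ∈ T.reach v ∩ T.reach w := h ▸ self_mem_reach m
  exact ⟨m, hm, h'.1, h'.2⟩

theorem reachOff_mem_iff (hT : T.Branching) (x : T.Spectrum) {v : T.V} {F : Set T.Edge}
    (hF : F ⊆ T.out v) (fF : F.Finite) :
    T.reachOff v F ∈ x.sets ↔ v ∈ x.nbhd ∧ ∀ e ∈ F, T.t e ∉ x.nbhd := by
  have hr : T.reachOff v F ∈ T.boolRing := basic_mem_ring (reachOff_mem_basic hF fF)
  constructor
  · intro h
    refine ⟨x.isFilter.mem_of_superset _ h _ (reach_mem_ring v) (reachOff_subset_reach v F),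
      fun e he h' => x.not_disjoint h h' ?_⟩
    rw [hT.reachOff_eq hF]
    exact Set.disjoint_left.2 fun y hy hy' => hy.2 (mem_iUnion₂.2 ⟨e, he, hy'⟩)
  · rintro ⟨h, h'⟩
    rcases x.mem_or hT hr h with h1 | h1
    · exact x.isFilter.mem_of_superset _ h1 _ hr inter_subset_right
    · classical
      have h2 : T.reach v \ T.reachOff v F =
          ⋃₀ ((fF.toFinset.image fun e => T.reach (T.t e) : Finset (Set T.V)) : Set (Set T.V)) := by
        rw [hT.reachOff_eq hF, sdiff_sdiff_right_self, Finset.coe_image, Set.sUnion_image]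
        simp only [Set.Finite.coe_toFinset]
        exact Set.inter_eq_right.2 (Set.iUnion₂_subset fun e he => reach_edge_subset (hF he))
      rw [h2] at h1
      obtain ⟨C, hC, hCx⟩ := x.exists_mem_of_sUnion hT _ (by
        intro C hC
        obtain ⟨e, _, rfl⟩ := Finset.mem_image.1 hC
        exact reach_mem_ring _) h1
      obtain ⟨e, he, rfl⟩ := Finset.mem_image.1 hC
      exact absurd hCx (h' e (fF.mem_toFinset.1 he))

theorem ext_nbhd (hT : T.Branching) {x y : T.Spectrum} (h : x.nbhd = y.nbhd) : x = y := by
  have key : ∀ x y : T.Spectrum, x.nbhd = y.nbhd → x.sets ⊆ y.sets := by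
    intro x y h B hB
    obtain ⟨v, F, hF, fF, h1, h2⟩ := x.exists_basic hT hB
    rw [reachOff_mem_iff hT x hF fF, h, ← reachOff_mem_iff hT y hF fF] at h1
    exact y.isFilter.mem_of_superset _ h1 _ (x.isFilter.subset hB) h2
  exact Spectrum.ext ((key x y h).antisymm (key y x h.symm))

theorem isClopen_nbhd (hT : T.Branching) (v : T.V) : IsClopen {x : T.Spectrum | v ∈ x.nbhd} :=
  isClopen_cyl hT (reach_mem_ring v)

theorem continuous_of_isClopen (hT : T.Branching) {Z : Type*} [TopologicalSpace Z]
    {f : Z → T.Spectrum} (h : ∀ v, IsClopen {z | v ∈ (f z).nbhd}) : Continuous f := by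
  refine continuous_generateFrom_iff.2 ?_
  rintro O ⟨B, hB, rfl⟩
  have : f ⁻¹' T.cyl B = ⋃ (v : T.V) (F : Set T.Edge) (_ : F ⊆ T.out v ∧ F.Finite ∧
      T.reachOff v F ⊆ B), ({z | v ∈ (f z).nbhd} ∩ ⋂ e ∈ F, {z | T.t e ∈ (f z).nbhd}ᶜ) := by
    ext z
    simp only [mem_iUnion, mem_inter_iff, mem_iInter, mem_compl_iff, exists_prop]
    constructor
    · intro hz
      obtain ⟨v, F, hF, fF, h1, h2⟩ := (f z).exists_basic hT hz
      exact ⟨v, F, ⟨hF, fF, h2⟩, (reachOff_mem_iff hT _ hF fF).1 h1⟩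
    · rintro ⟨v, F, ⟨hF, fF, h2⟩, h1⟩
      exact (f z).isFilter.mem_of_superset _ ((reachOff_mem_iff hT _ hF fF).2 h1) _ hB h2
  rw [this]
  refine isOpen_iUnion fun v => isOpen_iUnion fun F => isOpen_iUnion fun hF => ?_
  exact (h v).isOpen.inter (hF.2.1.isOpen_biInter fun e _ => (h _).compl.isOpen)

end Spectrum

/-- A nonempty set of vertices which is directed downwards: it determines an ultrafilter. -/
structure IsBase (D : Set T.V) : Prop where
  nonempty : D.Nonempty
  directed : ∀ v ∈ D, ∀ w ∈ D, ∃ m ∈ D, m ∈ T.reach v ∧ m ∈ T.reach w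

/-- The vertices above some element of `D`. -/
def upper (D : Set T.V) : Set T.V := {v | ∃ d ∈ D, d ∈ T.reach v}

/-- The sets containing some `V(v;F)` with `v` above `D` and no edge of `F` leading to a vertex
above `D`. -/
def baseFilter (D : Set T.V) : Set (Set T.V) :=
  {B | B ∈ T.boolRing ∧ ∃ v ∈ upper D, ∃ F ⊆ T.out v, F.Finite ∧
    (∀ e ∈ F, T.t e ∉ upper D) ∧ T.reachOff v F ⊆ B}

theorem mem_upper_of_mem_reach {D : Set T.V} {v w : T.V} (hw : w ∈ upper D)
    (h : w ∈ T.reach v) : v ∈ upper D := by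
  obtain ⟨d, hd, hdw⟩ := hw
  exact ⟨d, hd, reach_subset h hdw⟩

namespace IsBase

variable {D : Set T.V}

theorem upper_directed (hD : IsBase D) {v w : T.V} (hv : v ∈ upper D) (hw : w ∈ upper D) :
    ∃ m ∈ upper D, m ∈ T.reach v ∧ m ∈ T.reach w := by
  obtain ⟨d, hd, hdv⟩ := hv
  obtain ⟨d', hd', hdw⟩ := hw
  obtain ⟨m, hm, h1, h2⟩ := hD.directed d hd d' hd'
  exact ⟨m, ⟨m, hm, self_mem_reach m⟩, reach_subset hdv h1, reach_subset hdw h2⟩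

theorem exists_lower (hT : T.Branching) {v m : T.V} {F : Set T.Edge} (hF : F ⊆ T.out v)
    (hn : ∀ e ∈ F, T.t e ∉ upper D) (hm : m ∈ upper D) (hmv : m ∈ T.reach v) (fF : F.Finite) :
    ∃ G ⊆ T.out m, G.Finite ∧ (∀ e ∈ G, T.t e ∉ upper D) ∧ T.reachOff m G ⊆ T.reachOff v F := by
  by_cases h : m = v
  · subst h; exact ⟨F, hF, fF, hn, Subset.rfl⟩
  · obtain ⟨e, _, h1, h2⟩ := hT.cases_reachOff hF hmv h
    rcases h2 with h2 | h2
    · exact absurd (mem_upper_of_mem_reach hm h1) (hn e h2.1)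
    · refine ⟨∅, empty_subset _, finite_empty, fun e he => absurd he (notMem_empty e), ?_⟩
      rw [reachOff_empty]
      exact (reach_subset h1).trans h2.2

theorem exists_inter (hT : T.Branching) (hD : IsBase D) {v w : T.V} {F G : Set T.Edge}
    (hv : v ∈ upper D) (hF : F ⊆ T.out v) (fF : F.Finite) (hn : ∀ e ∈ F, T.t e ∉ upper D)
    (hw : w ∈ upper D) (hG : G ⊆ T.out w) (fG : G.Finite) (hn' : ∀ e ∈ G, T.t e ∉ upper D) :
    ∃ m ∈ upper D, ∃ H ⊆ T.out m, H.Finite ∧ (∀ e ∈ H, T.t e ∉ upper D) ∧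
      T.reachOff m H ⊆ T.reachOff v F ∩ T.reachOff w G := by
  obtain ⟨m, hm, h1, h2⟩ := hD.upper_directed hv hw
  obtain ⟨A, hA, fA, nA, sA⟩ := exists_lower hT hF hn hm h1 fF
  obtain ⟨B, hB, fB, nB, sB⟩ := exists_lower hT hG hn' hm h2 fG
  refine ⟨m, hm, A ∪ B, union_subset hA hB, fA.union fB, ?_, subset_inter ?_ ?_⟩
  · rintro e (he | he)
    · exact nA e he
    · exact nB e he
  · exact (reachOff_anti subset_union_left).trans sA
  · exact (reachOff_anti subset_union_right).trans sB

theorem isFilter (hT : T.Branching) (hD : IsBase D) : T.IsFilter (baseFilter D) where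
  subset _ h := h.1
  nonempty := by
    obtain ⟨d, hd⟩ := hD.nonempty
    refine ⟨T.reach d, reach_mem_ring d, d, ⟨d, hd, self_mem_reach d⟩, ∅, empty_subset _,
      finite_empty, fun e he => absurd he (notMem_empty e), ?_⟩
    rw [reachOff_empty]
  empty_notMem := by
    rintro ⟨_, v, _, F, _, _, _, h⟩
    exact h (self_mem_reachOff v F)
  inter_mem := by
    rintro B ⟨hB, v, hv, F, hF, fF, nF, sF⟩ C ⟨hC, w, hw, G, hG, fG, nG, sG⟩
    obtain ⟨m, hm, H, hH, fH, nH, sH⟩ := hD.exists_inter hT hv hF fF nF hw hG fG nG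
    exact ⟨hT.isSetRing.inter_mem hB hC, m, hm, H, hH, fH, nH,
      sH.trans (inter_subset_inter sF sG)⟩
  mem_of_superset := by
    rintro B ⟨hB, v, hv, F, hF, fF, nF, sF⟩ C hC hBC
    exact ⟨hC, v, hv, F, hF, fF, nF, sF.trans hBC⟩

/-- If `m` is not above `D`, then the edges leading from a vertex above `D` towards `m` leave the
set of vertices above `D` at some point. -/
theorem exists_disjoint_reach (hT : T.Branching) {v m : T.V} (hv : v ∈ upper D)
    (h : m ∈ T.reach v) (hm : m ∉ upper D) :
    ∃ w ∈ upper D, ∃ F ⊆ T.out w, F.Finite ∧ (∀ e ∈ F, T.t e ∉ upper D) ∧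
      w ∈ T.reach v ∧ Disjoint (T.reachOff w F) (T.reach m) := by
  induction h using Relation.ReflTransGen.head_induction_on with
  | refl => exact absurd hv hm
  | @head a c hac hcm ih =>
    by_cases hc : c ∈ upper D
    · obtain ⟨w, hw, F, hF, fF, nF, hwc, h⟩ := ih hc
      exact ⟨w, hw, F, hF, fF, nF, Relation.ReflTransGen.head hac hwc, h⟩
    · obtain ⟨e, he, ho, rfl⟩ := hac
      refine ⟨a, hv, {e}, singleton_subset_iff.2 ⟨he, ho⟩, finite_singleton e, ?_,
        self_mem_reach a, ?_⟩
      · rintro f rfl; exact hc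
      · have := hT.disjoint_insert_reach (u := a) (e := e) (F := ∅) ⟨he, ho⟩ (empty_subset _)
        rw [insert_empty_eq] at this
        exact this.mono_right (reach_subset hcm)

theorem dichotomy (hT : T.Branching) (hD : IsBase D) {B : Set T.V} (hB : B ∈ T.boolRing) :
    ∃ v ∈ upper D, ∃ F ⊆ T.out v, F.Finite ∧ (∀ e ∈ F, T.t e ∉ upper D) ∧
      (T.reachOff v F ⊆ B ∨ Disjoint (T.reachOff v F) B) := by
  classical
  obtain ⟨d, hd⟩ := hD.nonempty
  have hd' : d ∈ upper D := ⟨d, hd, self_mem_reach d⟩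
  obtain ⟨I, hI, hdisj, rfl⟩ := hB
  clear hdisj
  induction I using Finset.induction with
  | empty =>
    refine ⟨d, hd', ∅, empty_subset _, finite_empty, fun e he => absurd he (notMem_empty e),
      Or.inr ?_⟩
    simp
  | insert B I _ ih =>
    rw [Finset.coe_insert, insert_subset_iff] at hI
    obtain ⟨v, hv, F, hF, fF, nF, h⟩ := ih hI.2
    rw [Finset.coe_insert, sUnion_insert]
    rcases h with h | h
    · exact ⟨v, hv, F, hF, fF, nF, Or.inl (h.trans subset_union_right)⟩
    have hbasic : ∃ v ∈ upper D, ∃ F ⊆ T.out v, F.Finite ∧ (∀ e ∈ F, T.t e ∉ upper D) ∧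
        (T.reachOff v F ⊆ B ∨ Disjoint (T.reachOff v F) B) := by
      rcases hI.1 with rfl | ⟨w, G, hG, fG, rfl⟩
      · exact ⟨v, hv, F, hF, fF, nF, Or.inr (by simp)⟩
      by_cases hw : w ∈ upper D
      · by_cases hn : ∃ e ∈ G, T.t e ∈ upper D
        · obtain ⟨e, he, hen⟩ := hn
          refine ⟨T.t e, hen, ∅, empty_subset _, finite_empty,
            fun e he => absurd he (notMem_empty e), Or.inr ?_⟩
          rw [reachOff_empty, hT.reachOff_eq hG]
          exact Set.disjoint_left.2 fun y hy hy' => hy'.2 (mem_iUnion₂.2 ⟨e, he, hy⟩)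
        · push Not at hn
          exact ⟨w, hw, G, hG, fG, hn, Or.inl Subset.rfl⟩
      · rcases hT.meet d w with hdw | ⟨m, hm⟩
        · refine ⟨d, hd', ∅, empty_subset _, finite_empty,
            fun e he => absurd he (notMem_empty e), Or.inr ?_⟩
          rw [reachOff_empty]
          exact hdw.mono_right (reachOff_subset_reach w G)
        · have hmm : m ∈ T.reach d ∩ T.reach w := hm ▸ self_mem_reach m
          obtain ⟨v', hv', F', hF', fF', nF', hvd, hdis⟩ := exists_disjoint_reach hT hd' hmm.1
            fun h => hw (mem_upper_of_mem_reach h hmm.2)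
          refine ⟨v', hv', F', hF', fF', nF', Or.inr (Set.disjoint_left.2 fun y hy hy' => ?_)⟩
          refine Set.disjoint_left.1 hdis hy (hm ▸ ⟨?_, reachOff_subset_reach w G hy'⟩)
          exact reach_subset hvd (reachOff_subset_reach v' F' hy)
    obtain ⟨w, hw, G, hG, fG, nG, h'⟩ := hbasic
    rcases h' with h' | h'
    · exact ⟨w, hw, G, hG, fG, nG, Or.inl (h'.trans subset_union_left)⟩
    · obtain ⟨m, hm, H, hH, fH, nH, sH⟩ := hD.exists_inter hT hv hF fF nF hw hG fG nG
      refine ⟨m, hm, H, hH, fH, nH, Or.inr (disjoint_union_right.2 ⟨h'.mono_left ?_,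
        h.mono_left ?_⟩)⟩
      · exact sH.trans inter_subset_right
      · exact sH.trans inter_subset_left

theorem maximal (hT : T.Branching) (hD : IsBase D) : Maximal T.IsFilter (baseFilter D) := by
  refine (hT.maximal_iff (hD.isFilter hT)).2 ?_
  rintro B hB C ⟨hC, w, hw, G, hG, fG, nG, sG⟩
  obtain ⟨v, hv, F, hF, fF, nF, h⟩ := hD.dichotomy hT hB
  obtain ⟨m, hm, H, hH, fH, nH, sH⟩ := hD.exists_inter hT hv hF fF nF hw hG fG nG
  have hC' := (sH.trans inter_subset_right).trans sG
  rcases h with h | h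
  · exact Or.inl ⟨hT.isSetRing.inter_mem hC hB, m, hm, H, hH, fH, nH,
      subset_inter hC' ((sH.trans inter_subset_left).trans h)⟩
  · refine Or.inr ⟨hT.isSetRing.sdiff_mem hC hB, m, hm, H, hH, fH, nH, fun y hy => ⟨hC' hy, ?_⟩⟩
    exact Set.disjoint_left.1 h (sH hy).1

/-- The ultrafilter determined by a downwards directed set of vertices. -/
def point (hT : T.Branching) (hD : IsBase D) : T.Spectrum := ⟨baseFilter D, hD.maximal hT⟩

theorem mem_nbhd_point (hT : T.Branching) (hD : IsBase D) {v : T.V} :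
    v ∈ (hD.point hT).nbhd ↔ ∃ d ∈ D, d ∈ T.reach v := by
  constructor
  · rintro ⟨_, w, hw, F, _, _, _, h⟩
    exact mem_upper_of_mem_reach hw (h (self_mem_reachOff w F))
  · intro h
    refine ⟨reach_mem_ring v, v, h, ∅, empty_subset _, finite_empty,
      fun e he => absurd he (notMem_empty e), ?_⟩
    rw [reachOff_empty]

end IsBase

namespace Spectrum

/-- The point `x` is the fixed ultrafilter of `v`. -/
def FixedAt (x : T.Spectrum) (v : T.V) : Prop := ∀ w, w ∈ x.nbhd ↔ v ∈ T.reach w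

theorem exists_fixedAt (hT : T.Branching) (v : T.V) : ∃ x : T.Spectrum, x.FixedAt v := by
  have hD : IsBase ({v} : Set T.V) := ⟨⟨v, rfl⟩, by
    rintro a rfl b rfl
    exact ⟨_, rfl, self_mem_reach _, self_mem_reach _⟩⟩
  refine ⟨hD.point hT, fun w => ?_⟩
  rw [hD.mem_nbhd_point hT]
  simp

theorem fixedAt_iff (hT : T.Branching) {x : T.Spectrum} {v : T.V} :
    x.FixedAt v ↔ x.sets = T.fixedFilter v := by
  constructor
  · intro h
    have hsub : x.sets ⊆ T.fixedFilter v := by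
      intro B hB
      refine ⟨x.isFilter.subset hB, ?_⟩
      obtain ⟨w, F, hF, fF, h1, h2⟩ := x.exists_basic hT hB
      rw [reachOff_mem_iff hT x hF fF] at h1
      refine h2 ?_
      rw [hT.reachOff_eq hF]
      refine ⟨(h w).1 h1.1, fun h3 => ?_⟩
      obtain ⟨e, he, h3⟩ := mem_iUnion₂.1 h3
      exact h1.2 e he ((h _).2 h3)
    refine x.maximal.eq_of_subset ⟨fun B hB => hB.1, ?_, fun h => h.2, ?_, ?_⟩ hsub
    · exact ⟨_, reach_mem_ring v, self_mem_reach v⟩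
    · exact fun B hB C hC => ⟨hT.isSetRing.inter_mem hB.1 hC.1, hB.2, hC.2⟩
    · exact fun B hB C hC hBC => ⟨hC, hBC hB.2⟩
  · intro h w
    rw [mem_nbhd, h]
    exact ⟨fun h => h.2, fun h => ⟨reach_mem_ring w, h⟩⟩

theorem FixedAt.self_mem {x : T.Spectrum} {v : T.V} (h : x.FixedAt v) : v ∈ x.nbhd :=
  (h v).2 (self_mem_reach v)

theorem fixedAt_of_forall_out (hT : T.Branching) {x : T.Spectrum} {v : T.V} (hv : v ∈ x.nbhd)
    (h : ∀ e ∈ T.out v, T.t e ∉ x.nbhd) : x.FixedAt v := by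
  refine fun w => ⟨fun hw => ?_, fun hw => mem_nbhd_of_mem_reach hv hw⟩
  obtain ⟨m, hm, h1, h2⟩ := exists_mem_reach_inter hT hv hw
  rcases mem_reach_cases h1 with rfl | ⟨e, he, hme⟩
  · exact h2
  · exact absurd (mem_nbhd_of_mem_reach hm hme) (h e he)

theorem FixedAt.notMem_out (hT : T.Branching) {x : T.Spectrum} {v : T.V} (h : x.FixedAt v)
    {e : T.Edge} (he : e ∈ T.out v) : T.t e ∉ x.nbhd := by
  intro h'
  refine hT.notMem_reach e he.1 ?_
  rw [he.2]
  exact (h _).1 h'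

/-- The fixed ultrafilter of a vertex of finite exit valence is an isolated point. -/
theorem isClopen_fixedAt (hT : T.Branching) {v : T.V} (hv : (T.out v).Finite) :
    IsClopen {x : T.Spectrum | x.FixedAt v} := by
  have : {x : T.Spectrum | x.FixedAt v} =
      {x | v ∈ x.nbhd} ∩ ⋂ e ∈ T.out v, {x | T.t e ∈ x.nbhd}ᶜ := by
    ext x
    simp only [mem_inter_iff, mem_iInter, mem_compl_iff]
    exact ⟨fun h => ⟨FixedAt.self_mem h, fun e he => FixedAt.notMem_out hT h he⟩,
      fun h => fixedAt_of_forall_out hT h.1 h.2⟩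
  rw [this]
  exact (isClopen_nbhd hT v).inter (hv.isClopen_biInter fun e _ => (isClopen_nbhd hT _).compl)

theorem mem_boundary_iff (hT : T.Branching) {x : T.Spectrum} {S : Set T.V} :
    x ∈ T.boundary S ↔ ∀ v ∈ S, ¬ x.FixedAt v := by
  simp only [boundary, fixedAt_iff hT]
  rfl

end Spectrum

end Tree

end DirectedGraph

namespace DirectedGraph

theorem Branching.reach_antisymm {T : DirectedGraph.{u}} (hT : T.Branching) {v w : T.V}
    (h : w ∈ T.reach v) (h' : v ∈ T.reach w) : v = w := by
  rcases mem_reach_cases h with h1 | ⟨e, he, h1⟩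
  · exact h1.symm
  · refine absurd ?_ (hT.notMem_reach e he.1)
    rw [he.2]
    exact reach_subset h1 h'

theorem Branching.notMem_reach_of_step {T : DirectedGraph.{u}} (hT : T.Branching) {v w : T.V}
    (h : T.Step v w) : v ∉ T.reach w := by
  obtain ⟨e, he, rfl, rfl⟩ := h
  exact hT.notMem_reach e he

section Paths

variable {E : DirectedGraph.{u}}

/-! ### Points of the spectrum of the universal cover -/

namespace Path

theorem mul_mem_reach_iff {a p q : E.Path} (hp : a.t = p.o) (hq : a.t = q.o) :
    a.mul q ∈ E.cover.reach (a.mul p) ↔ q ∈ E.cover.reach p := by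
  rw [mem_cover_reach_iff, mem_cover_reach_iff]
  constructor
  · rintro ⟨d, hd, hdo, h⟩
    rw [mul_t hp] at hdo
    rw [mul_assoc hp hdo] at h
    exact ⟨d, hd, hdo, mul_left_cancel hq (by rw [mul_o, hp]) h⟩
  · rintro ⟨d, hd, hdo, rfl⟩
    exact ⟨d, hd, by rw [mul_t hp, hdo], (mul_assoc hp hdo).symm⟩

theorem mem_reach_nil_iff {p : E.Path} {v : E.V} :
    p ∈ E.cover.reach (nil v) ↔ p.IsDirected ∧ p.o = v := by
  rw [mem_cover_reach_iff]
  constructor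
  · rintro ⟨d, hd, hdo, rfl⟩
    rw [show v = d.o from hdo, nil_mul]
    exact ⟨hd, rfl⟩
  · rintro ⟨hp, rfl⟩
    exact ⟨p, hp, rfl, (nil_mul p).symm⟩

theorem mem_reach_inv_iff {a d : E.Path} (h : a.t = d.o) :
    d ∈ E.cover.reach a.inv ↔ (a.mul d).IsDirected := by
  have h1 : a.mul a.inv = nil a.o := mul_inv a
  rw [← mul_mem_reach_iff (a := a) rfl h, h1, mem_reach_nil_iff, mul_o]
  simp

theorem mul_inv_mul_cancel {a b : E.Path} (h : a.t = b.t) : (a.mul b.inv).mul b = a := by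
  have := mul_inv_cancel_right (p := a) (q := b.inv) h
  rwa [inv_inv] at this

theorem inv_mul_rev {a b : E.Path} (h : a.t = b.o) : (a.mul b).inv = b.inv.mul a.inv := by
  have h1 : b.inv.t = a.inv.o := by rw [inv_t, inv_o, h]
  refine mul_left_cancel (p := a.mul b) rfl (by rw [mul_t h, mul_o, inv_o]) ?_
  rw [mul_inv, mul_o, mul_assoc h (by rw [mul_o, inv_o]), mul_inv_cancel_left (by rw [inv_o, h]),
    mul_inv]

theorem mul_nil' {p : E.Path} {v : E.V} (h : p.t = v) : p.mul (nil v) = p := by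
  rw [← h, mul_nil]

end Path

open Spectrum

theorem nbhd_o {x : E.cover.Spectrum} {p : E.Path} (h : p ∈ x.nbhd) : p.o = E.base x :=
  (base_eq h).symm

theorem mem_nbhd_act {α : E.Path} {x : E.cover.Spectrum} (h : α.t = E.base x) {q : E.Path} :
    q ∈ (act α x).nbhd ↔ q.o = α.o ∧ α.inv.mul q ∈ x.nbhd := by
  change E.cover.reach q ∈ (act α x).sets ↔ _
  rw [mem_act h]
  by_cases hq : α.o = q.o
  · rw [translate_reach hq]
    exact ⟨fun h' => ⟨hq.symm, h'.2⟩, fun h' => ⟨reach_mem_ring _, h'.2⟩⟩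
  · rw [translate_reach_of_ne hq]
    exact ⟨fun h' => absurd h'.2 x.isFilter.empty_notMem, fun h' => absurd h'.1.symm hq⟩

theorem mul_mem_nbhd_act {α : E.Path} {x : E.cover.Spectrum} (h : α.t = E.base x) {q : E.Path}
    (hq : α.t = q.o) : α.mul q ∈ (act α x).nbhd ↔ q ∈ x.nbhd := by
  rw [mem_nbhd_act h, Path.mul_o, Path.inv_mul_cancel_left hq]
  simp

theorem fixedAt_o {x : E.cover.Spectrum} {p : E.Path} (h : x.FixedAt p) : p.o = E.base x :=
  nbhd_o h.self_mem

theorem fixedAt_act {α p : E.Path} {x : E.cover.Spectrum} (h : α.t = E.base x)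
    (hp : x.FixedAt p) : (act α x).FixedAt (α.mul p) := by
  have hpo : α.t = p.o := h.trans (fixedAt_o hp).symm
  intro q
  rw [mem_nbhd_act h, hp]
  constructor
  · rintro ⟨h1, h2⟩
    rw [← Path.mul_mem_reach_iff (a := α) (by rw [Path.mul_o, Path.inv_o]) hpo,
      Path.mul_inv_cancel_left h1.symm] at h2
    exact h2
  · intro h1
    have h2 : Path.o q = α.o := by rw [← cover_reach_o h1, Path.mul_o]
    refine ⟨h2, ?_⟩
    rw [← Path.mul_mem_reach_iff (a := α) (by rw [Path.mul_o, Path.inv_o]) hpo,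
      Path.mul_inv_cancel_left h2.symm]
    exact h1

theorem mem_transversal_iff {S : Set E.V} {x : E.cover.Spectrum} :
    x ∈ transversal S ↔
      (∀ p : E.Path, p.t ∈ S → ¬ x.FixedAt p) ∧ Path.nil (E.base x) ∈ x.nbhd := by
  rw [transversal, Set.mem_ofPred_eq, isDirectedPoint_iff, mem_boundary_iff E.cover_branching]
  exact Iff.rfl

theorem nil_mem_nbhd {S : Set E.V} {x : E.cover.Spectrum} (hx : x ∈ transversal S) {v : E.V}
    (hv : v = E.base x) : Path.nil v ∈ x.nbhd := hv ▸ (mem_transversal_iff.1 hx).2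

theorem isDirected_of_nil_mem_nbhd {x : E.cover.Spectrum}
    (hx : Path.nil (E.base x) ∈ x.nbhd) {q : E.Path} (hq : q ∈ x.nbhd) :
    ∃ d ∈ x.nbhd, Path.IsDirected d ∧ d ∈ E.cover.reach q := by
  obtain ⟨d, hd, h1, h2⟩ := exists_mem_reach_inter E.cover_branching hx hq
  exact ⟨d, hd, (Path.mem_reach_nil_iff.1 h1).1, h2⟩

theorem act_mem_transversal_iff {S : Set E.V} {a : E.Path} {x : E.cover.Spectrum}
    (h : a.t = E.base x) (hx : x ∈ transversal S) :
    act a x ∈ transversal S ↔ a.inv ∈ x.nbhd := by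
  rw [transversal, Set.mem_ofPred_eq, isDirectedPoint_iff, mem_boundary_act_iff S h]
  refine (and_iff_right hx.1).trans ?_
  change Path.nil _ ∈ (act a x).nbhd ↔ _
  rw [mem_nbhd_act h, base_act h, Path.mul_nil' (Path.inv_t a)]
  exact and_iff_right rfl

/-- A map into the directed points is continuous if it is so when tested on directed paths. -/
theorem continuous_of_isClopen_directed {Z : Type*} [TopologicalSpace Z]
    {f : Z → E.cover.Spectrum} (hf : ∀ z, Path.nil (E.base (f z)) ∈ (f z).nbhd)
    (h : ∀ d : E.Path, d.IsDirected → IsClopen {z | d ∈ (f z).nbhd}) : Continuous f := by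
  refine continuous_of_isClopen E.cover_branching fun q => ?_
  have hb : ∀ z, q ∈ (f z).nbhd → Path.nil (Path.o q) ∈ (f z).nbhd := fun z hz => by
    rw [nbhd_o hz]; exact hf z
  rcases E.cover_branching.meet (Path.nil (Path.o q)) q with hd | ⟨m, hm⟩
  · have : {z | q ∈ (f z).nbhd} = ∅ := by
      refine Set.eq_empty_of_forall_notMem fun z hz => ?_
      exact (f z).not_disjoint (hb z hz) hz hd
    rw [this]; exact isClopen_empty
  · have hmm : m ∈ E.cover.reach (Path.nil (Path.o q)) ∩ E.cover.reach q :=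
      hm ▸ self_mem_reach (T := E.cover) m
    have : {z | q ∈ (f z).nbhd} = {z | m ∈ (f z).nbhd} := by
      ext z
      refine ⟨fun hz => ?_, fun hz => mem_nbhd_of_mem_reach hz hmm.2⟩
      have := (f z).isFilter.inter_mem _ (hb z hz) _ hz
      rw [hm] at this
      exact this
    rw [this]
    exact h m (Path.mem_reach_nil_iff.1 hmm.1).1

/-! ### The convolution algebra in coordinates -/

namespace ToeplitzGroupoid

variable {S : Set E.V}

/-- The pair `(a,x)` is an element of the groupoid `TG(E,S)`. -/
structure Admissible (S : Set E.V) (a : E.Path) (x : E.cover.Spectrum) : Prop where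
  composable : a.t = E.base x
  point_mem : x ∈ transversal S
  act_mem : act a x ∈ transversal S

/-- The element of the groupoid given by an admissible pair. -/
def Admissible.elt {a : E.Path} {x : E.cover.Spectrum} (h : Admissible S a x) :
    E.ToeplitzGroupoid S := ⟨a, x, h.composable, h.point_mem, h.act_mem⟩

theorem admissible (γ : E.ToeplitzGroupoid S) : Admissible S γ.path γ.point :=
  ⟨γ.composable, γ.point_mem, γ.act_mem⟩

theorem admissible_iff {a : E.Path} {x : E.cover.Spectrum} (h : a.t = E.base x)
    (hx : x ∈ transversal S) : Admissible S a x ↔ a.inv ∈ x.nbhd :=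
  ⟨fun h' => (act_mem_transversal_iff h hx).1 h'.act_mem,
    fun h' => ⟨h, hx, (act_mem_transversal_iff h hx).2 h'⟩⟩

theorem Admissible.mul_inv {a b : E.Path} {x : E.cover.Spectrum} (ha : Admissible S a x)
    (hb : Admissible S b x) : Admissible S (a.mul b.inv) (act b x) := by
  have h : a.t = b.inv.o := ha.composable.trans hb.composable.symm
  refine ⟨by rw [Path.mul_t h, Path.inv_t, base_act hb.composable], hb.act_mem, ?_⟩
  rw [act_act (by rw [Path.mul_t h, Path.inv_t]) hb.composable, Path.mul_inv_mul_cancel h]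
  exact ha.act_mem

theorem Admissible.inv {a : E.Path} {x : E.cover.Spectrum} (ha : Admissible S a x) :
    Admissible S a.inv (act a x) := by
  refine ⟨by rw [Path.inv_t, base_act ha.composable], ha.act_mem, ?_⟩
  rw [act_act (Path.inv_t a) ha.composable, Path.inv_mul, ha.composable, act_nil]
  exact ha.point_mem

theorem Admissible.mul {a b : E.Path} {x : E.cover.Spectrum} (hb : Admissible S b x)
    (ha : Admissible S a (act b x)) : Admissible S (a.mul b) x := by
  have h : a.t = b.o := ha.composable.trans (base_act hb.composable)
  refine ⟨by rw [Path.mul_t h, hb.composable], hb.point_mem, ?_⟩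
  rw [← act_act h hb.composable]
  exact ha.act_mem

open Classical in
/-- The value of `f` at the pair `(a,x)`, and zero if the pair is not in the groupoid. -/
noncomputable def ev (f : C_c(E.ToeplitzGroupoid S, ℂ)) (a : E.Path) (x : E.cover.Spectrum) : ℂ :=
  if h : Admissible S a x then f h.elt else 0

variable {f g h : C_c(E.ToeplitzGroupoid S, ℂ)} {a b : E.Path} {x : E.cover.Spectrum}

theorem ev_of_admissible (f : C_c(E.ToeplitzGroupoid S, ℂ)) (h : Admissible S a x) :
    ev f a x = f h.elt := dif_pos h

theorem ev_path_point (f : C_c(E.ToeplitzGroupoid S, ℂ)) (γ : E.ToeplitzGroupoid S) :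
    ev f γ.path γ.point = f γ := ev_of_admissible f γ.admissible

theorem ev_of_not_admissible (h : ¬ Admissible S a x) : ev f a x = 0 := dif_neg h

theorem admissible_of_ev_ne_zero (h : ev f a x ≠ 0) : Admissible S a x :=
  by_contra fun h' => h (ev_of_not_admissible h')

theorem mem_of_ev_ne_zero {A : Finset E.Path} (hA : ∀ γ, f γ ≠ 0 → γ.path ∈ A)
    (h : ev f a x ≠ 0) : a ∈ A := by
  have h' := admissible_of_ev_ne_zero h
  rw [ev_of_admissible f h'] at h
  exact hA _ h

theorem ext_ev (h : ∀ a x, Admissible S a x → ev f a x = ev g a x) : f = g := by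
  ext γ
  rw [← ev_path_point, ← ev_path_point]
  exact h _ _ γ.admissible

theorem ev_add (f g : C_c(E.ToeplitzGroupoid S, ℂ)) (a : E.Path) (x : E.cover.Spectrum) :
    ev (f + g) a x = ev f a x + ev g a x := by
  by_cases h : Admissible S a x
  · simp only [ev_of_admissible _ h]; rfl
  · simp only [ev_of_not_admissible h, add_zero]

theorem ev_smul (c : ℂ) (f : C_c(E.ToeplitzGroupoid S, ℂ)) (a : E.Path) (x : E.cover.Spectrum) :
    ev (c • f) a x = c * ev f a x := by
  by_cases h : Admissible S a x
  · simp only [ev_of_admissible _ h]; rfl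
  · simp only [ev_of_not_admissible h, mul_zero]

theorem ev_conv (f : C_c(E.ToeplitzGroupoid S, ℂ)) {g : C_c(E.ToeplitzGroupoid S, ℂ)}
    {B : Finset E.Path} (hB : ∀ γ, g γ ≠ 0 → γ.path ∈ B) (ha : a.t = E.base x) :
    ev (conv f g) a x = ∑ b ∈ B, ev f (a.mul b.inv) (act b x) * ev g b x := by
  by_cases h : Admissible S a x
  · rw [ev_of_admissible _ h]
    refine (convFun_eq_sum f g B hB _).trans (Finset.sum_congr rfl fun b _ => ?_)
    by_cases hb : Admissible S b x
    · have hs : h.elt ∈ slice S b := ⟨hb.composable, hb.act_mem⟩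
      rw [ev_of_admissible g hb, ev_of_admissible f (h.mul_inv hb)]
      simp only [term, dif_pos hs]
      rfl
    · have hs : h.elt ∉ slice S b := fun hs => hb ⟨hs.1, h.point_mem, hs.2⟩
      simp only [term, dif_neg hs, ev_of_not_admissible hb, mul_zero]
  · rw [ev_of_not_admissible h, eq_comm]
    refine Finset.sum_eq_zero fun b _ => ?_
    by_contra hne
    have hb := admissible_of_ev_ne_zero (right_ne_zero_of_mul hne)
    have hab := hb.mul (admissible_of_ev_ne_zero (left_ne_zero_of_mul hne))
    rw [Path.mul_inv_mul_cancel (ha.trans hb.composable.symm)] at hab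
    exact h hab

theorem ev_invol (f : C_c(E.ToeplitzGroupoid S, ℂ)) (ha : a.t = E.base x) :
    ev (invol f) a x = star (ev f a.inv (act a x)) := by
  by_cases h : Admissible S a x
  · rw [ev_of_admissible _ h, ev_of_admissible _ h.inv]
    rfl
  · rw [ev_of_not_admissible h, ev_of_not_admissible, star_zero]
    intro h'
    have h2 := h'.inv
    rw [act_act (Path.inv_t a) ha, Path.inv_mul, ha, act_nil, Path.inv_inv] at h2
    exact h h2

theorem conv_add (f g h : C_c(E.ToeplitzGroupoid S, ℂ)) :
    conv f (g + h) = conv f g + conv f h := by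
  classical
  obtain ⟨A, hA⟩ := exists_finset g
  obtain ⟨B, hB⟩ := exists_finset h
  refine ext_ev fun a x ha => ?_
  have h1 : ∀ γ, g γ ≠ 0 → γ.path ∈ A ∪ B := fun γ hγ => Finset.mem_union_left _ (hA γ hγ)
  have h2 : ∀ γ, h γ ≠ 0 → γ.path ∈ A ∪ B := fun γ hγ => Finset.mem_union_right _ (hB γ hγ)
  have h3 : ∀ γ, (g + h) γ ≠ 0 → γ.path ∈ A ∪ B := by
    intro γ hγ
    by_contra hn
    refine hγ ?_
    change g γ + h γ = 0
    rw [not_imp_comm.1 (h1 γ) hn, not_imp_comm.1 (h2 γ) hn, add_zero]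
  rw [ev_add, ev_conv f h1 ha.composable, ev_conv f h2 ha.composable, ev_conv f h3 ha.composable,
    ← Finset.sum_add_distrib]
  simp only [ev_add, mul_add]

theorem add_conv (f g h : C_c(E.ToeplitzGroupoid S, ℂ)) :
    conv (f + g) h = conv f h + conv g h := by
  obtain ⟨B, hB⟩ := exists_finset h
  refine ext_ev fun a x ha => ?_
  rw [ev_add, ev_conv _ hB ha.composable, ev_conv _ hB ha.composable, ev_conv _ hB ha.composable,
    ← Finset.sum_add_distrib]
  simp only [ev_add, add_mul]

theorem conv_smul (c : ℂ) (f g : C_c(E.ToeplitzGroupoid S, ℂ)) :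
    conv f (c • g) = c • conv f g := by
  obtain ⟨B, hB⟩ := exists_finset g
  have hB' : ∀ γ, (c • g) γ ≠ 0 → γ.path ∈ B := fun γ hγ => hB γ (right_ne_zero_of_mul (a := c) hγ)
  refine ext_ev fun a x ha => ?_
  rw [ev_smul, ev_conv _ hB' ha.composable, ev_conv _ hB ha.composable, Finset.mul_sum]
  simp only [ev_smul, mul_left_comm]

theorem smul_conv (c : ℂ) (f g : C_c(E.ToeplitzGroupoid S, ℂ)) :
    conv (c • f) g = c • conv f g := by
  obtain ⟨B, hB⟩ := exists_finset g
  refine ext_ev fun a x ha => ?_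
  rw [ev_smul, ev_conv _ hB ha.composable, ev_conv _ hB ha.composable, Finset.mul_sum]
  simp only [ev_smul, mul_assoc]

theorem invol_add (f g : C_c(E.ToeplitzGroupoid S, ℂ)) : invol (f + g) = invol f + invol g := by
  ext γ
  change star (f γ.inv + g γ.inv) = star (f γ.inv) + star (g γ.inv)
  rw [star_add]

theorem invol_smul (c : ℂ) (f : C_c(E.ToeplitzGroupoid S, ℂ)) :
    invol (c • f) = star c • invol f := by
  ext γ
  change star (c * f γ.inv) = star c * star (f γ.inv)
  rw [star_mul, mul_comm]

theorem invol_invol (f : C_c(E.ToeplitzGroupoid S, ℂ)) : invol (invol f) = f := by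
  ext γ
  change star (star (f γ.inv.inv)) = f γ
  rw [star_star, inv_inv]

theorem conv_assoc (f g h : C_c(E.ToeplitzGroupoid S, ℂ)) :
    conv (conv f g) h = conv f (conv g h) := by
  classical
  obtain ⟨B, hB⟩ := exists_finset g
  obtain ⟨C, hC⟩ := exists_finset h
  obtain ⟨D, hD⟩ := exists_finset (conv g h)
  set D' := D ∪ Finset.image₂ Path.mul B C with hD'_def
  have hD' : ∀ γ, conv g h γ ≠ 0 → γ.path ∈ D' := fun γ hγ => Finset.mem_union_left _ (hD γ hγ)
  refine ext_ev fun a x ha => ?_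
  have hax := ha.composable
  rw [ev_conv _ hC hax, ev_conv _ hD' hax]
  have h1 : ∀ d ∈ D', ev f (a.mul d.inv) (act d x) * ev (conv g h) d x =
      ∑ c ∈ C, if d.t = E.base x then
        ev f (a.mul d.inv) (act d x) * (ev g (d.mul c.inv) (act c x) * ev h c x) else 0 := by
    intro d _
    by_cases hd : d.t = E.base x
    · simp only [if_pos hd]
      rw [ev_conv g hC hd, Finset.mul_sum]
    · simp only [if_neg hd, Finset.sum_const_zero]
      rw [ev_of_not_admissible fun h' => hd h'.composable, mul_zero]
  rw [Finset.sum_congr rfl h1, Finset.sum_comm]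
  refine Finset.sum_congr rfl fun c hc => ?_
  by_cases hcx : Admissible S c x
  swap
  · simp only [ev_of_not_admissible hcx, mul_zero, ite_self, Finset.sum_const_zero]
  have hct := hcx.composable
  have hac : a.t = c.inv.o := hax.trans hct.symm
  rw [ev_conv f hB (x := act c x) (by rw [Path.mul_t hac, Path.inv_t, base_act hct]),
    Finset.sum_mul]
  refine Finset.sum_bij_ne_zero (fun b _ _ => b.mul c) ?_ ?_ ?_ ?_
  · intro b hb _
    exact Finset.mem_union_right _ (Finset.mem_image₂_of_mem hb hc)
  · intro b hb h1 b' hb' h2 h3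
    have e1 : b.t = c.o := (admissible_of_ev_ne_zero
      (right_ne_zero_of_mul (left_ne_zero_of_mul h1))).composable.trans (base_act hct)
    have e2 : b'.t = c.o := (admissible_of_ev_ne_zero
      (right_ne_zero_of_mul (left_ne_zero_of_mul h2))).composable.trans (base_act hct)
    rw [← Path.mul_inv_cancel_right e1, h3, Path.mul_inv_cancel_right e2]
  · intro d hd hne
    by_cases hdt : d.t = E.base x
    · rw [if_pos hdt] at hne
      have e1 : (d.mul c.inv).mul c = d := Path.mul_inv_mul_cancel (hdt.trans hct.symm)
      have e2 : (d.mul c.inv).t = c.o := by rw [Path.mul_t (hdt.trans hct.symm), Path.inv_t]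
      refine ⟨d.mul c.inv, mem_of_ev_ne_zero hB
        (left_ne_zero_of_mul (right_ne_zero_of_mul hne)), ?_, e1⟩
      have e3 : (a.mul c.inv).mul (d.mul c.inv).inv = a.mul d.inv := by
        rw [Path.inv_mul_rev (hdt.trans hct.symm), Path.inv_inv,
          Path.mul_assoc hac (by rw [Path.mul_o, Path.inv_t]), Path.inv_mul_cancel_left]
        rw [Path.inv_o, hdt, hct]
      rw [e3, act_act e2 hct, e1, mul_assoc]
      exact hne
    · rw [if_neg hdt] at hne
      exact absurd rfl hne
  · intro b hb hne
    have e1 : b.t = c.o := (admissible_of_ev_ne_zero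
      (right_ne_zero_of_mul (left_ne_zero_of_mul hne))).composable.trans (base_act hct)
    have e2 : (b.mul c).t = E.base x := by rw [Path.mul_t e1, hct]
    have e3 : (a.mul c.inv).mul b.inv = a.mul (b.mul c).inv := by
      rw [Path.inv_mul_rev e1, Path.mul_assoc hac]
      rw [Path.inv_t, Path.inv_o, e1]
    rw [if_pos e2, Path.mul_inv_cancel_right e1, e3, act_act e1 hct, mul_assoc]

theorem invol_conv (f g : C_c(E.ToeplitzGroupoid S, ℂ)) :
    invol (conv f g) = conv (invol g) (invol f) := by
  classical
  obtain ⟨B, hB⟩ := exists_finset g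
  obtain ⟨D, hD⟩ := exists_finset (invol f)
  refine ext_ev fun a x ha => ?_
  have hax := ha.composable
  rw [ev_conv _ hD hax, ev_invol _ hax, ev_conv f hB ha.inv.composable, star_sum]
  have hcancel : ∀ b : E.Path, b.t = a.o → (b.mul a).inv = a.inv.mul b.inv :=
    fun b hb => Path.inv_mul_rev hb
  refine Finset.sum_bij_ne_zero (fun b _ _ => b.mul a) ?_ ?_ ?_ ?_
  · intro b hb hne
    rw [star_mul] at hne
    have e1 : b.t = a.o := (admissible_of_ev_ne_zero
      (star_ne_zero.1 (left_ne_zero_of_mul hne))).composable.trans (base_act hax)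
    refine mem_of_ev_ne_zero hD (x := x) ?_
    rw [ev_invol _ (by rw [Path.mul_t e1, hax]), hcancel b e1, ← act_act e1 hax]
    exact right_ne_zero_of_mul hne
  · intro b hb h1 b' hb' h2 h3
    rw [star_mul] at h1 h2
    have e1 : b.t = a.o := (admissible_of_ev_ne_zero
      (star_ne_zero.1 (left_ne_zero_of_mul h1))).composable.trans (base_act hax)
    have e2 : b'.t = a.o := (admissible_of_ev_ne_zero
      (star_ne_zero.1 (left_ne_zero_of_mul h2))).composable.trans (base_act hax)
    rw [← Path.mul_inv_cancel_right e1, h3, Path.mul_inv_cancel_right e2]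
  · intro d hd hne
    have hdx := admissible_of_ev_ne_zero (right_ne_zero_of_mul hne)
    have hda : d.t = a.t := hdx.composable.trans hax.symm
    have e1 : (d.mul a.inv).mul a = d := Path.mul_inv_mul_cancel hda
    have e2 : (d.mul a.inv).t = a.o := by rw [Path.mul_t hda, Path.inv_t]
    have e3 : (a.mul d.inv).t = E.base (act d x) := by
      rw [Path.mul_t hda.symm, Path.inv_t, base_act hdx.composable]
    have e4 : a.inv.mul (d.mul a.inv).inv = d.inv := by
      rw [← hcancel _ e2, e1]
    have e5 : act (a.mul d.inv) (act d x) = act a x := by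
      rw [act_act (by rw [Path.mul_t hda.symm, Path.inv_t]) hdx.composable,
        Path.mul_inv_mul_cancel hda.symm]
    have e6 : (a.mul d.inv).inv = d.mul a.inv := by
      rw [Path.inv_mul_rev hda.symm, Path.inv_inv]
    rw [ev_invol _ e3, ev_invol _ hdx.composable, e5, e6] at hne
    refine ⟨d.mul a.inv, mem_of_ev_ne_zero hB (star_ne_zero.1 (left_ne_zero_of_mul hne)), ?_, e1⟩
    rw [e4, act_act e2 hax, e1, star_mul]
    exact hne
  · intro b hb hne
    rw [star_mul] at hne
    have e1 : b.t = a.o := (admissible_of_ev_ne_zero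
      (star_ne_zero.1 (left_ne_zero_of_mul hne))).composable.trans (base_act hax)
    have hdx : (b.mul a).t = E.base x := by rw [Path.mul_t e1, hax]
    have hda : (b.mul a).t = a.t := Path.mul_t e1
    have e3 : (a.mul (b.mul a).inv).t = E.base (act (b.mul a) x) := by
      rw [Path.mul_t hda.symm, Path.inv_t, base_act hdx]
    have e5 : act (a.mul (b.mul a).inv) (act (b.mul a) x) = act a x := by
      rw [act_act (by rw [Path.mul_t hda.symm, Path.inv_t]) hdx,
        Path.mul_inv_mul_cancel hda.symm]
    have e6 : (a.mul (b.mul a).inv).inv = b := by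
      rw [Path.inv_mul_rev hda.symm, Path.inv_inv, Path.mul_inv_cancel_right e1]
    rw [ev_invol _ e3, ev_invol _ hdx, e5, e6, hcancel b e1, act_act e1 hax, star_mul]

/-- A function on the groupoid is continuous if it is so on each clopen set `{γ | γ.path = b}`. -/
theorem continuous_of_path {Z : Type*} [TopologicalSpace Z] {F : E.ToeplitzGroupoid S → Z}
    (h : ∀ b : E.Path, ContinuousOn F {γ | γ.path = b}) : Continuous F := by
  refine continuous_iff_continuousAt.2 fun γ => (h γ.path).continuousAt ?_
  exact ((isOpen_discrete {γ.path}).preimage continuous_path).mem_nhds rfl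

/-- For `S ⊆ Σ(E)` the sets `{γ | γ.path = a}` are compact, so that a continuous function has
compact support as soon as only finitely many paths occur in its support. -/
def mkOfPath (hS : S ⊆ E.regular) (F : E.ToeplitzGroupoid S → ℂ) (hF : Continuous F)
    (hA : ∃ A : Finset E.Path, ∀ γ, F γ ≠ 0 → γ.path ∈ A) : C_c(E.ToeplitzGroupoid S, ℂ) where
  toFun := F
  continuous_toFun := hF
  hasCompactSupport' := by
    obtain ⟨A, hA⟩ := hA
    refine HasCompactSupport.intro (K := ⋃ a ∈ A, bisection S a)
      (A.isCompact_biUnion fun a _ => isCompact_bisection hS a) fun γ hγ => ?_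
    by_contra hne
    refine hγ (Set.mem_iUnion₂.2 ⟨γ.path, hA γ hne, rfl, ?_⟩)
    rw [γ.composable]
    exact isDirectedPoint_iff.1 γ.point_mem.2

end ToeplitzGroupoid

end Paths

end DirectedGraph

namespace DirectedGraph

open Spectrum

namespace Inclusion

variable {E₁ E₂ E₃ : DirectedGraph.{u}}

/-! ### Paths of a subgraph -/

section Lists

variable (φ : Inclusion E₁ E₂)

theorem isWalk_map_iff {v : E₁.V} {l : List E₁.Edge} :
    E₂.IsWalk (φ.vertex v) (l.map φ.edge) ↔ E₁.IsWalk v l := by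
  induction l generalizing v with
  | nil => exact Iff.rfl
  | cons e l ih =>
    simp only [List.map_cons, IsWalk, φ.map_o, φ.map_t, φ.vertex_injective.eq_iff, ih]

theorem endpoint_map (v : E₁.V) (l : List E₁.Edge) :
    E₂.endpoint (φ.vertex v) (l.map φ.edge) = φ.vertex (E₁.endpoint v l) := by
  induction l generalizing v with
  | nil => rfl
  | cons e l ih =>
    simp only [List.map_cons, endpoint, φ.map_t, ih]

theorem noBacktrack_map_iff {l : List E₁.Edge} :
    E₂.NoBacktrack (l.map φ.edge) ↔ E₁.NoBacktrack l := by
  unfold NoBacktrack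
  rw [List.isChain_map]
  simp only [← φ.map_rev, ne_eq, φ.edge_injective.eq_iff]

theorem consRed_map (e : E₁.Edge) (l : List E₁.Edge) :
    consRed (φ.edge e) (l.map φ.edge) = (consRed e l).map φ.edge := by
  cases l with
  | nil => rfl
  | cons f l =>
    have h : φ.edge f = E₂.rev (φ.edge e) ↔ f = E₁.rev e := by
      rw [← φ.map_rev, φ.edge_injective.eq_iff]
    by_cases hf : f = E₁.rev e
    · simp only [List.map_cons, consRed, if_pos hf, if_pos (h.2 hf)]
    · simp only [List.map_cons, consRed, if_neg hf, if_neg (h.not.2 hf)]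

theorem foldr_map (l m : List E₁.Edge) :
    (l.map φ.edge).foldr consRed (m.map φ.edge) = (l.foldr consRed m).map φ.edge := by
  induction l with
  | nil => rfl
  | cons e l ih => rw [List.map_cons, List.foldr_cons, ih, consRed_map]; rfl

end Lists

variable (φ : Inclusion E₁ E₂)

/-- The functor `G(E₁) → G(E₂)` on reduced paths induced by an inclusion. -/
def mapPath (p : E₁.Path) : E₂.Path :=
  ⟨φ.vertex p.o, p.edges.map φ.edge, φ.isWalk_map_iff.2 p.isWalk,
    φ.noBacktrack_map_iff.2 p.noBacktrack⟩

theorem mapPath_o (p : E₁.Path) : (φ.mapPath p).o = φ.vertex p.o := rfl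

theorem mapPath_edges (p : E₁.Path) : (φ.mapPath p).edges = p.edges.map φ.edge := rfl

theorem mapPath_t (p : E₁.Path) : (φ.mapPath p).t = φ.vertex p.t := φ.endpoint_map _ _

theorem mapPath_injective : Function.Injective φ.mapPath := fun p q h => by
  ext1
  · exact φ.vertex_injective (congrArg Path.o h)
  · exact φ.edge_injective.list_map (congrArg Path.edges h)

theorem mapPath_nil (v : E₁.V) : φ.mapPath (Path.nil v) = Path.nil (φ.vertex v) := rfl

theorem mapPath_single (e : E₁.Edge) : φ.mapPath (Path.single e) = Path.single (φ.edge e) := by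
  ext1
  · exact (φ.map_o e).symm
  · rfl

theorem mapPath_composable {p q : E₁.Path} : (φ.mapPath p).t = (φ.mapPath q).o ↔ p.t = q.o := by
  rw [mapPath_t, mapPath_o, φ.vertex_injective.eq_iff]

theorem mapPath_mul {p q : E₁.Path} (h : p.t = q.o) :
    φ.mapPath (p.mul q) = (φ.mapPath p).mul (φ.mapPath q) := by
  ext1
  · rw [Path.mul_o, mapPath_o, mapPath_o, Path.mul_o]
  · rw [Path.mul_edges (φ.mapPath_composable.2 h), mapPath_edges, mapPath_edges, mapPath_edges,
      Path.mul_edges h, foldr_map]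

theorem mapPath_inv (p : E₁.Path) : φ.mapPath p.inv = (φ.mapPath p).inv := by
  ext1
  · rw [mapPath_o, Path.inv_o, Path.inv_o, mapPath_t]
  · simp only [Path.inv, mapPath_edges, List.map_reverse, List.map_map]
    congr 2
    exact funext φ.map_rev

theorem isDirected_mapPath {p : E₁.Path} : (φ.mapPath p).IsDirected ↔ p.IsDirected := by
  simp only [Path.IsDirected, mapPath_edges, List.mem_map, forall_exists_index, and_imp,
    forall_apply_eq_imp_iff₂, φ.mem_pos_iff]

/-- The paths of the subgraph are those which start in it and all of whose edges belong to it. -/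
theorem exists_mapPath_eq {q : E₂.Path} {v : E₁.V} (hv : φ.vertex v = q.o)
    (h : ∀ e ∈ q.edges, e ∈ Set.range φ.edge) : ∃ p : E₁.Path, p.o = v ∧ φ.mapPath p = q := by
  obtain ⟨l, hl⟩ : ∃ l : List E₁.Edge, l.map φ.edge = q.edges := by
    have : q.edges ∈ Set.range (List.map φ.edge) := by
      rw [Set.range_list_map]; exact h
    exact this
  refine ⟨⟨v, l, ?_, ?_⟩, rfl, ?_⟩
  · rw [← φ.isWalk_map_iff, hv, hl]; exact q.isWalk
  · rw [← φ.noBacktrack_map_iff, hl]; exact q.noBacktrack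
  · ext1
    · exact hv
    · exact hl

theorem rev_mem_range {e : E₂.Edge} : E₂.rev e ∈ Set.range φ.edge ↔ e ∈ Set.range φ.edge := by
  have : ∀ e, e ∈ Set.range φ.edge → E₂.rev e ∈ Set.range φ.edge := by
    rintro _ ⟨e, rfl⟩
    exact ⟨E₁.rev e, φ.map_rev e⟩
  exact ⟨fun h => E₂.rev_rev e ▸ this _ h, this e⟩

theorem mem_range_of_mem_edges {p : E₁.Path} {e : E₂.Edge} (h : e ∈ (φ.mapPath p).edges) :
    e ∈ Set.range φ.edge := by
  obtain ⟨f, _, rfl⟩ := List.mem_map.1 h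
  exact ⟨f, rfl⟩

theorem mapPath_mem_reach_iff {p q : E₁.Path} :
    φ.mapPath q ∈ E₂.cover.reach (φ.mapPath p) ↔ q ∈ E₁.cover.reach p := by
  rw [mem_cover_reach_iff, mem_cover_reach_iff]
  constructor
  · rintro ⟨d, hd, hdo, h⟩
    have ho : p.o = q.o := by
      have := congrArg Path.o h
      rw [Path.mul_o] at this
      exact (φ.vertex_injective this).symm
    have h1 : d = φ.mapPath (p.inv.mul q) := by
      rw [φ.mapPath_mul (by rw [Path.inv_t, ho]), φ.mapPath_inv, h,
        Path.inv_mul_cancel_left hdo]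
    rw [h1, φ.isDirected_mapPath] at hd
    exact ⟨_, hd, by rw [Path.mul_o, Path.inv_o], (Path.mul_inv_cancel_left ho).symm⟩
  · rintro ⟨d, hd, hdo, rfl⟩
    exact ⟨φ.mapPath d, φ.isDirected_mapPath.2 hd, φ.mapPath_composable.2 hdo, φ.mapPath_mul hdo⟩

theorem mapPath_id (E : DirectedGraph.{u}) (p : E.Path) : (Inclusion.id E).mapPath p = p := by
  ext1
  · rfl
  · exact List.map_id _

theorem mapPath_comp (ψ : Inclusion E₂ E₃) (φ : Inclusion E₁ E₂) (p : E₁.Path) :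
    (ψ.comp φ).mapPath p = ψ.mapPath (φ.mapPath p) := by
  ext1
  · rfl
  · simp only [mapPath_edges, List.map_map]; rfl

/-! ### The projection of boundary points onto the subgraph -/

/-- The point `y` is the projection of `x`: for a directed path `x` of `E₂` starting at a vertex of
`E₁`, this is the longest initial segment of `x` contained in `E₁`. -/
def Over (y : E₁.cover.Spectrum) (x : E₂.cover.Spectrum) : Prop :=
  ∀ p : E₁.Path, p ∈ y.nbhd ↔ φ.mapPath p ∈ x.nbhd

variable {φ}

namespace Over

variable {y y' : E₁.cover.Spectrum} {x : E₂.cover.Spectrum}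

theorem unique (h : φ.Over y x) (h' : φ.Over y' x) : y = y' :=
  ext_nbhd E₁.cover_branching (Set.ext fun p => (h p).trans (h' p).symm)

theorem base_eq (h : φ.Over y x) : E₂.base x = φ.vertex (E₁.base y) := by
  obtain ⟨p, hp⟩ := y.nbhd_nonempty E₁.cover_branching
  rw [← nbhd_o hp, ← nbhd_o ((h p).1 hp)]
  rfl

theorem composable_iff (h : φ.Over y x) {a : E₁.Path} :
    (φ.mapPath a).t = E₂.base x ↔ a.t = E₁.base y := by
  rw [h.base_eq, mapPath_t, φ.vertex_injective.eq_iff]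

theorem act (h : φ.Over y x) {a : E₁.Path} (ha : a.t = E₁.base y) :
    φ.Over (act a y) (DirectedGraph.act (φ.mapPath a) x) := by
  intro p
  rw [mem_nbhd_act ha, mem_nbhd_act (h.composable_iff.2 ha), mapPath_o, mapPath_o,
    φ.vertex_injective.eq_iff]
  refine and_congr_right fun ho => ?_
  rw [h, φ.mapPath_mul (by rw [Path.inv_t, ho]), mapPath_inv]

theorem id_iff {E : DirectedGraph.{u}} {x y : E.cover.Spectrum} :
    (Inclusion.id E).Over y x ↔ y = x := by
  constructor
  · intro h
    refine h.unique fun p => ?_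
    rw [mapPath_id]
  · rintro rfl p
    rw [mapPath_id]

theorem comp {ψ : Inclusion E₂ E₃} {z : E₃.cover.Spectrum} (h' : ψ.Over x z) (h : φ.Over y x) :
    (ψ.comp φ).Over y z := fun p => by rw [h p, h' _, mapPath_comp]

/-- If `S₁` is induced by `S₂`, a path of `E₂` which is not removed from the boundary projects to a
path which is not removed: a path of `E₁` ending in `S₁` can be continued in `E₂` only by edges
of `E₁`. -/
theorem mem_transversal {S₁ : Set E₁.V} {S₂ : Set E₂.V} (hS : S₁ = φ.inducedSet S₂)
    (h : φ.Over y x) (hx : x ∈ transversal S₂) : y ∈ transversal S₁ := by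
  have hx' := hx
  rw [mem_transversal_iff] at hx ⊢
  refine ⟨fun p hp hy => ?_, ?_⟩
  swap
  · rw [h, mapPath_nil, ← h.base_eq]; exact hx.2
  rw [hS] at hp
  refine hx.1 (φ.mapPath p) (by rw [mapPath_t]; exact hp.1)
    (fixedAt_of_forall_out E₂.cover_branching ((h p).1 hy.self_mem) ?_)
  rintro ⟨⟨q, r⟩, hqr, hqr'⟩ ⟨⟨f, hf, hf'⟩, hq⟩ hr
  change q = φ.mapPath p at hq
  change r ∈ x.nbhd at hr
  obtain ⟨h1, h2⟩ := Path.eq_mul_single (p := q) (q := r) hqr hf'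
  rw [hq] at h1 h2
  rw [mapPath_t] at h1
  obtain ⟨e, he, rfl⟩ := hp.2 ⟨hf, h1.symm⟩
  rw [φ.map_o, φ.vertex_injective.eq_iff] at h1
  rw [h2, ← mapPath_single, ← φ.mapPath_mul (q := Path.single e) h1, ← h, hy] at hr
  have h3 : E₁.cover.Step p (p.mul (Path.single e)) := cover_step_iff.2 ⟨e, he, h1, rfl⟩
  exact E₁.cover_branching.notMem_reach_of_step h3 hr

end Over

theorem exists_over {x : E₂.cover.Spectrum} (hx : Path.nil (E₂.base x) ∈ x.nbhd) {v : E₁.V}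
    (hv : E₂.base x = φ.vertex v) : ∃ y, φ.Over y x := by
  have hD : IsBase (T := E₁.cover) {p : E₁.Path | φ.mapPath p ∈ x.nbhd} := by
    refine ⟨⟨Path.nil v, ?_⟩, ?_⟩
    · rw [hv] at hx; exact hx
    · intro p hp p' hp'
      obtain ⟨m, hm, hmm⟩ := exists_meet E₂.cover_branching hp hp'
      have hm' : m ∈ E₂.cover.reach (φ.mapPath p) ∩ E₂.cover.reach (φ.mapPath p') :=
        hmm ▸ self_mem_reach (T := E₂.cover) m
      obtain ⟨a, ha, hao, hap, hma, l, _, hl⟩ := cover_meet hm'.1 hm'.2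
      have ho : Path.o p = Path.o p' := φ.vertex_injective ((nbhd_o hp).trans (nbhd_o hp').symm)
      rw [← mapPath_inv, ← φ.mapPath_mul (by rw [Path.inv_t, ho])] at hl
      obtain ⟨b, hbo, rfl⟩ := φ.exists_mapPath_eq (q := a) (v := Path.t p)
        (by rw [← hao, mapPath_t]) fun e he =>
          φ.mem_range_of_mem_edges (by rw [hl]; exact List.mem_append_left _ he)
      rw [← φ.mapPath_mul (q := b) hbo.symm] at hap hma
      refine ⟨Path.mul p b, mem_nbhd_of_mem_reach hm hma, ?_, φ.mapPath_mem_reach_iff.1 hap⟩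
      exact mem_cover_reach_iff.2 ⟨b, φ.isDirected_mapPath.1 ha, hbo.symm, rfl⟩
  refine ⟨hD.point E₁.cover_branching, fun p => ?_⟩
  rw [hD.mem_nbhd_point]
  constructor
  · rintro ⟨d, hd, hdp⟩
    exact mem_nbhd_of_mem_reach hd (φ.mapPath_mem_reach_iff.2 hdp)
  · exact fun hp => ⟨p, hp, self_mem_reach (T := E₁.cover) p⟩

end Inclusion

namespace ToeplitzGroupoid

open Inclusion

variable {E₁ E₂ E₃ : DirectedGraph.{u}} {φ : Inclusion E₁ E₂} {S₁ : Set E₁.V} {S₂ : Set E₂.V}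

theorem admissible_mapPath_iff {a : E₁.Path} {y : E₁.cover.Spectrum} {x : E₂.cover.Spectrum}
    (h : φ.Over y x) (hy : y ∈ transversal S₁) (hx : x ∈ transversal S₂) :
    Admissible S₂ (φ.mapPath a) x ↔ Admissible S₁ a y := by
  by_cases ha : a.t = E₁.base y
  · rw [admissible_iff ha hy, admissible_iff (h.composable_iff.2 ha) hx, h, mapPath_inv]
  · exact ⟨fun h' => absurd (h.composable_iff.1 h'.composable) ha,
      fun h' => absurd h'.composable ha⟩

/-! ### The homomorphism of convolution algebras -/

variable (φ) in
/-- The element `γ'` of `TG(E₁,S₁)` is the projection of `γ`, an element of the clopen subgroupoid of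
`TG(E₂,S₂)` where the path lies in `E₁`. -/
def Lies (γ' : E₁.ToeplitzGroupoid S₁) (γ : E₂.ToeplitzGroupoid S₂) : Prop :=
  φ.mapPath γ'.path = γ.path ∧ φ.Over γ'.point γ.point

theorem Lies.unique {γ' γ'' : E₁.ToeplitzGroupoid S₁} {γ : E₂.ToeplitzGroupoid S₂}
    (h : Lies φ γ' γ) (h' : Lies φ γ'' γ) : γ' = γ'' :=
  ToeplitzGroupoid.ext (φ.mapPath_injective (h.1.trans h'.1.symm)) (h.2.unique h'.2)

theorem exists_lies (hS : S₁ = φ.inducedSet S₂) {γ : E₂.ToeplitzGroupoid S₂} {a : E₁.Path}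
    (h : φ.mapPath a = γ.path) : ∃ γ' : E₁.ToeplitzGroupoid S₁, Lies φ γ' γ ∧ γ'.path = a := by
  obtain ⟨y, hy⟩ := exists_over (φ := φ) (mem_transversal_iff.1 γ.point_mem).2 (v := a.t)
    (by rw [← γ.composable, ← h, mapPath_t])
  have hyt := hy.mem_transversal hS γ.point_mem
  have ha : Admissible S₁ a y := by
    rw [← admissible_mapPath_iff hy hyt γ.point_mem, h]
    exact γ.admissible
  exact ⟨ha.elt, ⟨h, hy⟩, rfl⟩

theorem Lies.inv {γ' : E₁.ToeplitzGroupoid S₁} {γ : E₂.ToeplitzGroupoid S₂}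
    (h : Lies φ γ' γ) : Lies φ γ'.inv γ.inv := by
  refine ⟨?_, ?_⟩
  · change φ.mapPath γ'.path.inv = γ.path.inv
    rw [mapPath_inv, h.1]
  · change φ.Over (act γ'.path γ'.point) (act γ.path γ.point)
    rw [← h.1]
    exact h.2.act γ'.composable

variable (φ) in
open Classical in
/-- The function on `TG(E₂,S₂)` obtained from a function on `TG(E₁,S₁)` by composition with the
projection, and extension by zero. -/
noncomputable def pullFun (f : E₁.ToeplitzGroupoid S₁ → ℂ) (γ : E₂.ToeplitzGroupoid S₂) : ℂ :=
  if h : ∃ γ' : E₁.ToeplitzGroupoid S₁, Lies φ γ' γ then f h.choose else 0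

theorem pullFun_of_lies (f : E₁.ToeplitzGroupoid S₁ → ℂ) {γ : E₂.ToeplitzGroupoid S₂}
    {γ' : E₁.ToeplitzGroupoid S₁} (h : Lies φ γ' γ) : pullFun φ f γ = f γ' := by
  have h' : ∃ γ' : E₁.ToeplitzGroupoid S₁, Lies φ γ' γ := ⟨γ', h⟩
  rw [pullFun, dif_pos h', h'.choose_spec.unique h]

theorem pullFun_eq_zero (f : E₁.ToeplitzGroupoid S₁ → ℂ) {γ : E₂.ToeplitzGroupoid S₂}
    (h : γ.path ∉ Set.range φ.mapPath) : pullFun φ f γ = 0 :=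
  dif_neg fun ⟨_, h'⟩ => h ⟨_, h'.1⟩

theorem continuous_pullFun (hS : S₁ = φ.inducedSet S₂) {f : E₁.ToeplitzGroupoid S₁ → ℂ}
    (hf : Continuous f) : Continuous (pullFun (S₂ := S₂) φ f) := by
  refine continuous_of_path fun b => ?_
  by_cases hb : b ∈ Set.range φ.mapPath
  · obtain ⟨a, rfl⟩ := hb
    have h1 : ∀ γ : {γ : E₂.ToeplitzGroupoid S₂ | γ.path = φ.mapPath a},
        ∃ γ' : E₁.ToeplitzGroupoid S₁, Lies φ γ' γ.1 ∧ γ'.path = a :=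
      fun γ => exists_lies hS (Eq.symm γ.2)
    choose π hπ hπa using h1
    have hc : Continuous π := by
      refine continuous_of_comp ?_ ?_
      · simp only [hπa]; exact continuous_const
      · refine continuous_of_isClopen E₁.cover_branching fun p => ?_
        have : {γ | p ∈ (π γ).point.nbhd} = (fun γ : {γ : E₂.ToeplitzGroupoid S₂ |
            γ.path = φ.mapPath a} => γ.1.point) ⁻¹' {x | φ.mapPath p ∈ x.nbhd} :=
          Set.ext fun γ => (hπ γ).2 p
        rw [this]
        exact (isClopen_nbhd E₂.cover_branching _).preimage
          (continuous_point.comp continuous_subtype_val)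
    rw [continuousOn_iff_continuous_domRestrict]
    refine (hf.comp hc).congr fun γ => ?_
    exact (pullFun_of_lies f (hπ γ)).symm
  · refine continuousOn_const (c := (0 : ℂ)) |>.congr fun γ hγ => ?_
    refine pullFun_eq_zero f ?_
    rw [show γ.path = b from hγ]
    exact hb

/-- The `*`-homomorphism `C_c(TG(E₁,S₁)) → C_c(TG(E₂,S₂))`. -/
noncomputable def pull (hS₂ : S₂ ⊆ E₂.regular) (hS : S₁ = φ.inducedSet S₂)
    (f : C_c(E₁.ToeplitzGroupoid S₁, ℂ)) : C_c(E₂.ToeplitzGroupoid S₂, ℂ) :=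
  mkOfPath hS₂ (pullFun φ f) (continuous_pullFun hS f.continuous) (by
    classical
    obtain ⟨A, hA⟩ := exists_finset f
    refine ⟨A.image φ.mapPath, fun γ hγ => ?_⟩
    by_cases h : γ.path ∈ Set.range φ.mapPath
    · obtain ⟨a, ha⟩ := h
      obtain ⟨γ', h', rfl⟩ := exists_lies hS ha
      rw [pullFun_of_lies _ h'] at hγ
      exact Finset.mem_image.2 ⟨_, hA _ hγ, ha⟩
    · exact absurd (pullFun_eq_zero _ h) hγ)

variable (hS₂ : S₂ ⊆ E₂.regular) (hS : S₁ = φ.inducedSet S₂)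

theorem pull_of_lies (f : C_c(E₁.ToeplitzGroupoid S₁, ℂ)) {γ : E₂.ToeplitzGroupoid S₂}
    {γ' : E₁.ToeplitzGroupoid S₁} (h : Lies φ γ' γ) : pull hS₂ hS f γ = f γ' :=
  pullFun_of_lies f h

theorem pull_eq_zero (f : C_c(E₁.ToeplitzGroupoid S₁, ℂ)) {γ : E₂.ToeplitzGroupoid S₂}
    (h : γ.path ∉ Set.range φ.mapPath) : pull hS₂ hS f γ = 0 := pullFun_eq_zero f h

theorem ev_pull (f : C_c(E₁.ToeplitzGroupoid S₁, ℂ)) {a : E₁.Path} {y : E₁.cover.Spectrum}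
    {x : E₂.cover.Spectrum} (h : φ.Over y x) (hy : y ∈ transversal S₁) (hx : x ∈ transversal S₂) :
    ev (pull hS₂ hS f) (φ.mapPath a) x = ev f a y := by
  by_cases ha : Admissible S₁ a y
  · have ha' := (admissible_mapPath_iff h hy hx).2 ha
    rw [ev_of_admissible _ ha, ev_of_admissible _ ha']
    exact pull_of_lies hS₂ hS f ⟨rfl, h⟩
  · rw [ev_of_not_admissible ha,
      ev_of_not_admissible ((admissible_mapPath_iff h hy hx).not.2 ha)]

theorem mem_range_of_ev_pull_ne_zero {f : C_c(E₁.ToeplitzGroupoid S₁, ℂ)} {b : E₂.Path}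
    {x : E₂.cover.Spectrum} (h : ev (pull hS₂ hS f) b x ≠ 0) : b ∈ Set.range φ.mapPath := by
  have hb := admissible_of_ev_ne_zero h
  rw [ev_of_admissible _ hb] at h
  by_contra h'
  exact h (pull_eq_zero hS₂ hS f h')

theorem pull_add (f g : C_c(E₁.ToeplitzGroupoid S₁, ℂ)) :
    pull hS₂ hS (f + g) = pull hS₂ hS f + pull hS₂ hS g := by
  ext γ
  by_cases h : γ.path ∈ Set.range φ.mapPath
  · obtain ⟨a, ha⟩ := h
    obtain ⟨γ', h', rfl⟩ := exists_lies hS ha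
    change _ = pull hS₂ hS f γ + pull hS₂ hS g γ
    simp only [pull_of_lies hS₂ hS _ h']
    rfl
  · change _ = pull hS₂ hS f γ + pull hS₂ hS g γ
    simp only [pull_eq_zero hS₂ hS _ h, add_zero]

theorem pull_smul (c : ℂ) (f : C_c(E₁.ToeplitzGroupoid S₁, ℂ)) :
    pull hS₂ hS (c • f) = c • pull hS₂ hS f := by
  ext γ
  by_cases h : γ.path ∈ Set.range φ.mapPath
  · obtain ⟨a, ha⟩ := h
    obtain ⟨γ', h', rfl⟩ := exists_lies hS ha
    change _ = c * pull hS₂ hS f γ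
    simp only [pull_of_lies hS₂ hS _ h']
    rfl
  · change _ = c * pull hS₂ hS f γ
    simp only [pull_eq_zero hS₂ hS _ h, mul_zero]

theorem pull_invol (f : C_c(E₁.ToeplitzGroupoid S₁, ℂ)) :
    pull hS₂ hS (invol f) = invol (pull hS₂ hS f) := by
  ext γ
  change _ = star (pull hS₂ hS f γ.inv)
  by_cases h : γ.path ∈ Set.range φ.mapPath
  · obtain ⟨a, ha⟩ := h
    obtain ⟨γ', h', rfl⟩ := exists_lies hS ha
    rw [pull_of_lies hS₂ hS _ h', pull_of_lies hS₂ hS _ h'.inv]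
    rfl
  · rw [pull_eq_zero hS₂ hS _ h, pull_eq_zero hS₂ hS, star_zero]
    rintro ⟨a, ha⟩
    refine h ⟨a.inv, ?_⟩
    rw [mapPath_inv, ha]
    exact Path.inv_inv _

theorem pull_conv (f g : C_c(E₁.ToeplitzGroupoid S₁, ℂ)) :
    pull hS₂ hS (conv f g) = conv (pull hS₂ hS f) (pull hS₂ hS g) := by
  classical
  obtain ⟨A, hA⟩ := exists_finset g
  have hA' : ∀ γ, pull hS₂ hS g γ ≠ 0 → γ.path ∈ A.image φ.mapPath := by
    intro γ hγ
    by_cases h : γ.path ∈ Set.range φ.mapPath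
    · obtain ⟨a, ha⟩ := h
      obtain ⟨γ', h', rfl⟩ := exists_lies hS ha
      rw [pull_of_lies hS₂ hS _ h'] at hγ
      exact Finset.mem_image.2 ⟨_, hA _ hγ, ha⟩
    · exact absurd (pull_eq_zero hS₂ hS _ h) hγ
  refine ext_ev fun b x hb => ?_
  rw [ev_conv _ hA' hb.composable, Finset.sum_image φ.mapPath_injective.injOn]
  by_cases h : b ∈ Set.range φ.mapPath
  · obtain ⟨a, rfl⟩ := h
    obtain ⟨y, hy⟩ := exists_over (φ := φ) (mem_transversal_iff.1 hb.point_mem).2 (v := a.t)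
      (by rw [← hb.composable, mapPath_t])
    have hyt := hy.mem_transversal hS hb.point_mem
    have hay := hy.composable_iff.1 hb.composable
    rw [ev_pull hS₂ hS _ hy hyt hb.point_mem, ev_conv _ hA hay]
    refine Finset.sum_congr rfl fun k _ => ?_
    rw [ev_pull hS₂ hS _ hy hyt hb.point_mem]
    by_cases hk : Admissible S₁ k y
    · have hk' := (admissible_mapPath_iff hy hyt hb.point_mem).2 hk
      rw [← mapPath_inv, ← φ.mapPath_mul (hay.trans hk.composable.symm),
        ev_pull hS₂ hS _ (hy.act hk.composable) hk.act_mem hk'.act_mem]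
    · rw [ev_of_not_admissible hk, mul_zero, mul_zero]
  · have h0 : ev (pull hS₂ hS (conv f g)) b x = 0 := by
      by_contra hne
      exact h (mem_range_of_ev_pull_ne_zero hS₂ hS hne)
    rw [h0, eq_comm]
    refine Finset.sum_eq_zero fun k _ => ?_
    by_contra hne
    obtain ⟨c, hc⟩ := mem_range_of_ev_pull_ne_zero hS₂ hS (left_ne_zero_of_mul hne)
    have hk := (admissible_of_ev_ne_zero (right_ne_zero_of_mul hne)).composable
    have hbk : b.t = (φ.mapPath k).t := hb.composable.trans hk.symm
    have hck : c.t = k.o := by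
      rw [← φ.mapPath_composable, hc, Path.mul_t hbk, Path.inv_t]
    refine h ⟨c.mul k, ?_⟩
    rw [φ.mapPath_mul hck, hc, Path.mul_inv_mul_cancel hbk]

theorem pull_id {E : DirectedGraph.{u}} {S : Set E.V} (hS : S ⊆ E.regular)
    (h : S = (Inclusion.id E).inducedSet S) (f : C_c(E.ToeplitzGroupoid S, ℂ)) :
    pull hS h f = f := by
  ext γ
  exact pull_of_lies hS h f ⟨mapPath_id E _, Over.id_iff.2 rfl⟩

theorem pull_comp {ψ : Inclusion E₂ E₃} {S₃ : Set E₃.V} (hS₃ : S₃ ⊆ E₃.regular)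
    (hS' : S₂ = ψ.inducedSet S₃) (hS'' : S₁ = (ψ.comp φ).inducedSet S₃)
    (f : C_c(E₁.ToeplitzGroupoid S₁, ℂ)) :
    pull hS₃ hS'' f = pull hS₃ hS' (pull hS₂ hS f) := by
  ext γ
  by_cases h : γ.path ∈ Set.range (ψ.comp φ).mapPath
  · obtain ⟨a, ha⟩ := h
    rw [mapPath_comp] at ha
    obtain ⟨γ₂, h₂, h2⟩ := exists_lies hS' ha
    obtain ⟨γ₁, h₁, _⟩ := exists_lies hS h2.symm
    rw [pull_of_lies hS₃ hS' _ h₂, pull_of_lies hS₂ hS _ h₁]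
    refine pull_of_lies hS₃ hS'' _ ⟨?_, h₂.2.comp h₁.2⟩
    rw [mapPath_comp, h₁.1, h₂.1]
  · rw [pull_eq_zero hS₃ hS'' _ h]
    by_cases h' : γ.path ∈ Set.range ψ.mapPath
    · obtain ⟨b, hb⟩ := h'
      obtain ⟨γ₂, h₂, rfl⟩ := exists_lies hS' hb
      rw [pull_of_lies hS₃ hS' _ h₂, pull_eq_zero hS₂ hS]
      rintro ⟨a, ha⟩
      exact h ⟨a, by rw [mapPath_comp, ha, hb]⟩
    · rw [pull_eq_zero hS₃ hS' _ h']

theorem pull_charFun (hS₁ : S₁ ⊆ E₁.regular) (α : E₁.Path) :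
    pull hS₂ hS (charFun hS₁ α) = charFun hS₂ (φ.mapPath α) := by
  classical
  have hmem : ∀ {E : DirectedGraph.{u}} {S : Set E.V} (hS : S ⊆ E.regular) (α : E.Path)
      (γ : E.ToeplitzGroupoid S), charFun hS α γ = if γ.path = α then 1 else 0 := by
    intro E S hS α γ
    change (bisection S α).indicator 1 γ = _
    rw [Set.indicator_apply]
    refine if_congr ⟨fun h => h.1, fun h => ⟨h, ?_⟩⟩ rfl rfl
    rw [← h]
    exact nil_mem_nbhd γ.point_mem γ.composable
  ext γ
  rw [hmem]
  by_cases h : γ.path ∈ Set.range φ.mapPath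
  · obtain ⟨a, ha⟩ := h
    obtain ⟨γ', h', rfl⟩ := exists_lies hS ha
    rw [pull_of_lies hS₂ hS _ h', hmem, ← ha]
    simp only [φ.mapPath_injective.eq_iff]
  · rw [pull_eq_zero hS₂ hS _ h, if_neg fun h' => h ⟨α, h'.symm⟩]

end ToeplitzGroupoid

end DirectedGraph

namespace DirectedGraph

open ToeplitzGroupoid

/-! ### Representations given by positive functionals -/

section GNS

variable {E : DirectedGraph.{u}} {S : Set E.V}

/-- The convolution as a bilinear map. -/
noncomputable def convBilin (S : Set E.V) : C_c(E.ToeplitzGroupoid S, ℂ) →ₗ[ℂ]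
    C_c(E.ToeplitzGroupoid S, ℂ) →ₗ[ℂ] C_c(E.ToeplitzGroupoid S, ℂ) :=
  LinearMap.mk₂ ℂ conv add_conv smul_conv conv_add conv_smul

/-- A positive linear functional on the convolution algebra `C_c(TG(E,S))`. Being hermitian does not
follow from positivity in an algebra without unit, and is part of the definition. -/
structure PosFunctional (S : Set E.V) where
  /-- the functional -/
  toLin : C_c(E.ToeplitzGroupoid S, ℂ) →ₗ[ℂ] ℂ
  map_invol : ∀ f, toLin (invol f) = star (toLin f)
  nonneg : ∀ f, 0 ≤ (toLin (conv (invol f) f)).re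

namespace PosFunctional

set_option linter.unusedVariables false in
/-- The convolution algebra with the semi-inner product `⟪f, g⟫ = φ(f* g)`; a type synonym of
`C_c(TG(E,S))`. -/
@[nolint unusedArguments]
def PreGNS (φ : PosFunctional S) : Type u := C_c(E.ToeplitzGroupoid S, ℂ)

variable (φ : PosFunctional S)

noncomputable instance : AddCommGroup φ.PreGNS :=
  inferInstanceAs (AddCommGroup C_c(E.ToeplitzGroupoid S, ℂ))
noncomputable instance : Module ℂ φ.PreGNS :=
  inferInstanceAs (Module ℂ C_c(E.ToeplitzGroupoid S, ℂ))

/-- The identity map from the convolution algebra to its semi-inner product space. -/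
noncomputable def toPre : C_c(E.ToeplitzGroupoid S, ℂ) ≃ₗ[ℂ] φ.PreGNS := LinearEquiv.refl ℂ _

theorem toLin_conv_invol (f g : C_c(E.ToeplitzGroupoid S, ℂ)) :
    star (φ.toLin (conv (invol f) g)) = φ.toLin (conv (invol g) f) := by
  rw [← φ.map_invol, invol_conv, invol_invol]

/-- The semi-inner product `⟪f, g⟫ = φ(f* g)`. -/
noncomputable abbrev core : PreInnerProductSpace.Core ℂ φ.PreGNS where
  inner a b := φ.toLin (conv (invol (φ.toPre.symm a)) (φ.toPre.symm b))
  conj_inner_symm a b := φ.toLin_conv_invol _ _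
  re_inner_nonneg a := φ.nonneg _
  add_left a b c := by rw [map_add, invol_add, add_conv, map_add]
  smul_left a b r := by
    rw [map_smul, invol_smul, smul_conv, map_smul]
    rfl

noncomputable instance : SeminormedAddCommGroup φ.PreGNS :=
  InnerProductSpace.Core.toSeminormedAddCommGroup (c := φ.core)
noncomputable instance : InnerProductSpace ℂ φ.PreGNS := InnerProductSpace.ofCore φ.core

theorem inner_toPre (f g : C_c(E.ToeplitzGroupoid S, ℂ)) :
    inner ℂ (φ.toPre f) (φ.toPre g) = φ.toLin (conv (invol f) g) := rfl

theorem norm_sq_toPre (f : C_c(E.ToeplitzGroupoid S, ℂ)) :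
    ((‖φ.toPre f‖ ^ 2 : ℝ) : ℂ) = φ.toLin (conv (invol f) f) := by
  rw [← inner_toPre, inner_self_eq_norm_sq_to_K]
  simp

theorem norm_conv_le_of_slice (h f : C_c(E.ToeplitzGroupoid S, ℂ)) {a : E.Path} {M : ℝ}
    (hM0 : 0 < M) (ha : ∀ γ, h γ ≠ 0 → γ.path = a) (hM : ∀ γ, ‖h γ‖ ≤ M) :
    ‖φ.toPre (conv h f)‖ ≤ M * ‖φ.toPre f‖ := by
  obtain ⟨G, hG, hk⟩ := exists_root h hM0 ha hM
  -- `h* h = M² (1 - (1 - G)* (1 - G))`, so that `‖h f‖² = M² (‖f‖² - ‖f - G f‖²)`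
  have h1 : φ.toLin (conv (invol (conv h f)) (conv h f)) =
      (M : ℂ) ^ 2 * (φ.toLin (conv (invol f) f) -
        φ.toLin (conv (invol (f - conv G f)) (f - conv G f))) := by
    have e1 : conv (invol (conv h f)) (conv h f) = conv (invol f) (conv (conv (invol h) h) f) := by
      rw [invol_conv, conv_assoc, conv_assoc]
    have e2 : invol (f - conv G f) = invol f - conv (invol f) G := by
      rw [eq_sub_iff_add_eq, ← hG, ← invol_conv, hG, ← invol_add, sub_add_cancel]
    have e3 : ∀ a b c : C_c(E.ToeplitzGroupoid S, ℂ), conv (a - b) c = conv a c - conv b c :=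
      fun a b c => (convBilin S).map_sub₂ a b c
    have e4 : ∀ a b c : C_c(E.ToeplitzGroupoid S, ℂ), conv a (b - c) = conv a b - conv a c :=
      fun a b c => ((convBilin S) a).map_sub b c
    have e5 : ∀ a : C_c(E.ToeplitzGroupoid S, ℂ), (2 : ℂ) • a = a + a := by
      intro a; ext γ; exact two_mul (a γ)
    rw [e1, hk, e2, smul_conv, conv_smul, map_smul, smul_eq_mul, ← map_sub]
    congr 2
    rw [e3, smul_conv, e3, e4, e4, e4, conv_smul, e5, conv_assoc, conv_assoc, conv_assoc]
    abel
  rw [← norm_sq_toPre, ← norm_sq_toPre, ← norm_sq_toPre] at h1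
  have h2 : ‖φ.toPre (conv h f)‖ ^ 2 =
      M ^ 2 * (‖φ.toPre f‖ ^ 2 - ‖φ.toPre (f - conv G f)‖ ^ 2) := by exact_mod_cast h1
  refine abs_le_of_sq_le_sq' ?_ (by positivity) |>.2
  rw [h2, mul_pow]
  gcongr
  nlinarith [sq_nonneg ‖φ.toPre (f - conv G f)‖]

open Classical in
theorem exists_bound (h : C_c(E.ToeplitzGroupoid S, ℂ)) :
    ∃ C : ℝ, ∀ f, ‖φ.toPre (conv h f)‖ ≤ C * ‖φ.toPre f‖ := by
  obtain ⟨A, hA⟩ := exists_finset h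
  obtain ⟨M, hM⟩ := h.hasCompactSupport.exists_bound_of_continuous h.continuous
  refine ⟨∑ a ∈ A, (|M| + 1), fun f => ?_⟩
  have h1 : conv h f = ∑ a ∈ A, conv (piece h a) f := by
    have h2 : conv (∑ a ∈ A, piece h a) f = ∑ a ∈ A, conv (piece h a) f :=
      (convBilin S).map_sum₂ A (piece h) f
    rw [← h2, ← sum_piece h A hA]
  rw [h1, map_sum, Finset.sum_mul]
  refine norm_sum_le_of_le _ fun a _ => ?_
  have hp : ∀ γ, piece h a γ = if γ.path = a then h γ else 0 := fun _ => rfl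
  refine φ.norm_conv_le_of_slice _ _ (a := a) (by positivity) ?_ ?_
  · intro γ hγ
    by_contra h'
    exact hγ (by rw [hp, if_neg h'])
  · intro γ
    rw [hp]
    split_ifs
    · exact (hM γ).trans ((le_abs_self M).trans (by linarith))
    · rw [norm_zero]; positivity

/-- Left multiplication on the semi-inner product space. -/
noncomputable def leftMul (h : C_c(E.ToeplitzGroupoid S, ℂ)) : φ.PreGNS →L[ℂ] φ.PreGNS :=
  (φ.toPre.toLinearMap ∘ₗ convBilin S h ∘ₗ φ.toPre.symm.toLinearMap).mkContinuous
    (φ.exists_bound h).choose fun f => (φ.exists_bound h).choose_spec (φ.toPre.symm f)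

theorem leftMul_toPre (h f : C_c(E.ToeplitzGroupoid S, ℂ)) :
    φ.leftMul h (φ.toPre f) = φ.toPre (conv h f) := rfl

open UniformSpace.Completion in
/-- The representation obtained from a positive functional by the construction of Gelfand, Naimark
and Segal. -/
noncomputable def gnsRep : Rep S where
  H := UniformSpace.Completion φ.PreGNS
  π :=
    { toFun := fun h => (φ.leftMul h).completion
      map_add' := fun f g => by
        ext c
        induction c using induction_on with
        | hp => exact isClosed_eq (ContinuousLinearMap.continuous _) (ContinuousLinearMap.continuous _)
        | ih c =>
          obtain ⟨c, rfl⟩ := φ.toPre.surjective c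
          simp only [ContinuousLinearMap.completion_apply_coe, add_apply,
            leftMul_toPre, add_conv, map_add, coe_add]
      map_smul' := fun m f => by
        ext c
        induction c using induction_on with
        | hp => exact isClosed_eq (ContinuousLinearMap.continuous _) (ContinuousLinearMap.continuous _)
        | ih c =>
          obtain ⟨c, rfl⟩ := φ.toPre.surjective c
          simp only [ContinuousLinearMap.completion_apply_coe, smul_apply,
            leftMul_toPre, smul_conv, map_smul, coe_smul, RingHom.id_apply] }
  map_conv f g := by
    ext c
    induction c using induction_on with
    | hp => apply isClosed_eq <;> fun_prop
    | ih c =>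
      obtain ⟨c, rfl⟩ := φ.toPre.surjective c
      simp only [LinearMap.coe_mk, AddHom.coe_mk, ContinuousLinearMap.completion_apply_coe,
        mul_apply_eq_comp, leftMul_toPre, conv_assoc]
  map_invol f := by
    refine (ContinuousLinearMap.eq_adjoint_iff (φ.leftMul (invol f)).completion
      (φ.leftMul f).completion).mpr ?_
    intro x y
    induction x, y using induction_on₂ with
    | hp => apply isClosed_eq <;> fun_prop
    | ih x y =>
      obtain ⟨x, rfl⟩ := φ.toPre.surjective x
      obtain ⟨y, rfl⟩ := φ.toPre.surjective y
      simp only [ContinuousLinearMap.completion_apply_coe, leftMul_toPre, inner_coe, inner_toPre,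
        invol_conv, invol_invol, conv_assoc]

/-- The vectors of the representation given by the elements of the convolution algebra. -/
noncomputable def vec (f : C_c(E.ToeplitzGroupoid S, ℂ)) : φ.gnsRep.H :=
  UniformSpace.Completion.coe' (φ.toPre f)

theorem gnsRep_vec (h f : C_c(E.ToeplitzGroupoid S, ℂ)) :
    φ.gnsRep.π h (φ.vec f) = φ.vec (conv h f) :=
  ContinuousLinearMap.completion_apply_coe _ _

theorem norm_sq_vec (f : C_c(E.ToeplitzGroupoid S, ℂ)) :
    ((‖φ.vec f‖ ^ 2 : ℝ) : ℂ) = φ.toLin (conv (invol f) f) := by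
  rw [← norm_sq_toPre]
  congr 2
  exact UniformSpace.Completion.norm_coe _

end PosFunctional

end GNS

end DirectedGraph

namespace DirectedGraph

open Spectrum

/-! ### Existence of boundary points -/

section Paths

variable {E : DirectedGraph.{u}}

theorem cover_out_finite_of_finite {p : E.Path} (h : (E.out p.t).Finite) :
    (E.cover.out p).Finite := by
  refine ((h.image fun e => (p, p.mul (Path.single e))).preimage
    Subtype.val_injective.injOn).subset ?_
  rintro ⟨⟨p', q⟩, hpq, _⟩ ⟨⟨e, he, he'⟩, rfl⟩
  obtain ⟨h1, h2⟩ := Path.eq_mul_single (p := p') (q := q) hpq he'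
  exact ⟨e, ⟨he, h1.symm⟩, Prod.ext rfl h2.symm⟩

theorem fixedAt_unique {x : E.cover.Spectrum} {p q : E.Path} (hp : x.FixedAt p)
    (hq : x.FixedAt q) : p = q :=
  E.cover_branching.reach_antisymm ((hq p).1 hp.self_mem) ((hp q).1 hq.self_mem)

/-- Every set `V(p)` contains a point of `∂(Ẽ,S̃)`. Otherwise it would be, by compactness, a finite set
of vertices with an outgoing edge each. -/
theorem exists_mem_nbhd_not_fixedAt {S : Set E.V} (hS : S ⊆ E.regular) (p : E.Path) :
    ∃ x : E.cover.Spectrum, p ∈ x.nbhd ∧ ∀ q : E.Path, q.t ∈ S → ¬ x.FixedAt q := by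
  by_contra! H
  have hT := E.cover_branching
  obtain ⟨t, ht⟩ := (isCompact_cyl hT (E.cover.reach p)).elim_finite_subcover
    (fun q : {q : E.Path // q.t ∈ S} => {x : E.cover.Spectrum | x.FixedAt q.1})
    (fun q => (isClopen_fixedAt hT (cover_out_finite (hS q.2))).isOpen)
    fun x hx => by
      obtain ⟨q, hq, hxq⟩ := H x hx
      exact mem_iUnion.2 ⟨⟨q, hq⟩, hxq⟩
  have hsub : E.cover.reach p ⊆ (fun q : {q : E.Path // q.t ∈ S} => q.1) '' (t : Set _) := by
    intro r hr
    obtain ⟨x, hx⟩ := exists_fixedAt hT r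
    obtain ⟨q, hq, hxq⟩ := mem_iUnion₂.1 (ht (a := x) ((hx p).2 hr))
    exact ⟨q, hq, fixedAt_unique hxq hx⟩
  have hfin : (E.cover.reach p).Finite := (t.finite_toSet.image _).subset hsub
  obtain ⟨r, hr, hmin⟩ := Set.exists_min_image (E.cover.reach p)
    (fun r => (E.cover.reach r).ncard) hfin ⟨p, self_mem_reach (T := E.cover) p⟩
  obtain ⟨⟨r', hr'⟩, _, rfl⟩ := hsub hr
  obtain ⟨e, he⟩ := (hS hr').1
  have hstep : E.cover.Step r' (r'.mul (Path.single e)) := cover_step_iff.2 ⟨e, he.1, he.2.symm, rfl⟩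
  have hmem : r'.mul (Path.single e) ∈ E.cover.reach r' := Relation.ReflTransGen.single hstep
  refine absurd (hmin _ (reach_subset hr hmem)) (not_le.2 (Set.ncard_lt_ncard ?_ ?_))
  · refine ⟨reach_subset hmem, fun h => hT.notMem_reach_of_step hstep (h ?_)⟩
    exact self_mem_reach (T := E.cover) r'
  · exact hfin.subset (reach_subset hr)

theorem act_inv_act {a : E.Path} {x : E.cover.Spectrum} (h : a.t = E.base x) :
    act a.inv (act a x) = x := by
  rw [act_act (Path.inv_t a) h, Path.inv_mul, h, act_nil]

end Paths

namespace Inclusion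

variable {E₁ E₂ : DirectedGraph.{u}} (φ : Inclusion E₁ E₂) (S₁ : Set E₁.V) (S₂ : Set E₂.V)

/-! ### An equivariant continuous section of the projection -/

/-- A choice, for each vertex `v ∉ S₁` of `E₁` that belongs to `S₂`, of a boundary path of `E₂` which
starts at `v` and leaves `E₁` at once, so that its projection is the path of length zero at `v`.
For other vertices the value of `point` is irrelevant. -/
structure Exits where
  /-- the boundary path leaving `E₁` at `v` -/
  point : E₁.V → E₂.cover.Spectrum
  mem_transversal : ∀ v, φ.vertex v ∈ S₂ → v ∉ S₁ → point v ∈ transversal S₂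
  mem_nbhd_iff : ∀ v, φ.vertex v ∈ S₂ → v ∉ S₁ → ∀ k : E₁.Path,
    φ.mapPath k ∈ (point v).nbhd ↔ Path.nil v ∈ E₁.cover.reach k

variable {φ S₁ S₂}

theorem noBacktrack_append {l m : List E₂.Edge} (hl : E₂.NoBacktrack l) (hm : E₂.NoBacktrack m)
    (h : ∀ e ∈ l.getLast?, ∀ f ∈ m.head?, (e ∈ Set.range φ.edge ↔ f ∉ Set.range φ.edge)) :
    E₂.NoBacktrack (l ++ m) := by
  refine List.isChain_append.2 ⟨hl, hm, fun e he f hf hef => ?_⟩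
  have := h e he f hf
  rw [hef, φ.rev_mem_range] at this
  tauto

theorem exists_exit (hS₂ : S₂ ⊆ E₂.regular) (hS : S₁ = φ.inducedSet S₂) {v : E₁.V}
    (hv : φ.vertex v ∈ S₂) (hv' : v ∉ S₁) :
    ∃ w ∈ transversal S₂, ∀ k : E₁.Path,
      φ.mapPath k ∈ w.nbhd ↔ Path.nil v ∈ E₁.cover.reach k := by
  have h1 : ¬ E₂.out (φ.vertex v) ⊆ φ.edge '' E₁.pos := fun h => hv' (by rw [hS]; exact ⟨hv, h⟩)
  obtain ⟨f, hf, hf'⟩ := Set.not_subset.1 h1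
  have hfr : f ∉ Set.range φ.edge := by
    rintro ⟨e, rfl⟩
    exact hf' ⟨e, (φ.mem_pos_iff e).1 hf.1, rfl⟩
  obtain ⟨x, hx, hxS⟩ := exists_mem_nbhd_not_fixedAt hS₂ (Path.single f)
  have hsd := Path.isDirected_single hf.1
  have hnil : Path.nil (φ.vertex v) ∈ x.nbhd :=
    mem_nbhd_of_mem_reach hx (Path.mem_reach_nil_iff.2 ⟨hsd, hf.2⟩)
  have hbase : φ.vertex v = E₂.base x := nbhd_o hnil
  refine ⟨x, mem_transversal_iff.2 ⟨hxS, hbase ▸ hnil⟩, fun k => ⟨fun hk => ?_, fun hk => ?_⟩⟩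
  swap
  · exact mem_nbhd_of_mem_reach hnil (φ.mapPath_mem_reach_iff.2 hk)
  have hko : k.o = v := φ.vertex_injective ((nbhd_o hk).trans hbase.symm)
  obtain ⟨m, _, hmk, hmf⟩ := exists_mem_reach_inter E₂.cover_branching hk hx
  obtain ⟨d, hd, hdo, rfl⟩ := mem_cover_reach_iff.1 hmf
  have hedges := hsd.mul_edges hd hdo
  have hmo : φ.vertex k.o = ((Path.single f).mul d).o := by
    rw [Path.mul_o, hko]; exact hf.2.symm
  -- `k⁻¹ f d` is reduced as it stands, and directed, so that `k⁻¹` is directed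
  have h2 : ((φ.mapPath k.inv).mul ((Path.single f).mul d)).IsDirected := by
    rw [← Path.mem_reach_inv_iff (by rw [mapPath_t, Path.inv_t, hmo]), ← mapPath_inv, Path.inv_inv]
    exact hmk
  have h3 : k.inv.IsDirected := by
    rw [← φ.isDirected_mapPath]
    intro e he
    refine h2 e ?_
    rw [Path.mul_edges (by rw [mapPath_t, Path.inv_t, hmo]), foldr_eq_append]
    · exact List.mem_append_left _ he
    · refine noBacktrack_append (φ := φ) (φ.mapPath k.inv).noBacktrack
        ((Path.single f).mul d).noBacktrack fun e he g hg => ?_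
      rw [hedges] at hg
      obtain rfl : f = g := by simpa [Path.single] using hg
      exact iff_of_true (φ.mem_range_of_mem_edges (List.mem_of_mem_getLast? he)) hfr
  rw [mem_cover_reach_iff]
  exact ⟨k.inv, h3, (Path.inv_o k).symm, by rw [Path.mul_inv, hko]⟩

variable (φ S₁ S₂) in
theorem exists_exits (hS₂ : S₂ ⊆ E₂.regular) (hS : S₁ = φ.inducedSet S₂) :
    Nonempty (Exits φ S₁ S₂) := by
  have : ∀ v : E₁.V, ∃ w : E₂.cover.Spectrum, φ.vertex v ∈ S₂ → v ∉ S₁ →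
      w ∈ transversal S₂ ∧ ∀ k : E₁.Path,
        φ.mapPath k ∈ w.nbhd ↔ Path.nil v ∈ E₁.cover.reach k := by
    intro v
    by_cases h : φ.vertex v ∈ S₂ ∧ v ∉ S₁
    · obtain ⟨w, hw⟩ := exists_exit hS₂ hS h.1 h.2
      exact ⟨w, fun _ _ => hw⟩
    · obtain ⟨w, _⟩ := exists_fixedAt E₂.cover_branching (Path.nil (φ.vertex v))
      exact ⟨w, fun h1 h2 => absurd ⟨h1, h2⟩ h⟩
  choose w hw using this
  exact ⟨⟨w, fun v h1 h2 => (hw v h1 h2).1, fun v h1 h2 => (hw v h1 h2).2⟩⟩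

variable (φ) in
theorem isBase_image (y : E₁.cover.Spectrum) :
    IsBase (T := E₂.cover) (φ.mapPath '' y.nbhd) := by
  refine ⟨(y.nbhd_nonempty E₁.cover_branching).image _, ?_⟩
  rintro _ ⟨p, hp, rfl⟩ _ ⟨q, hq, rfl⟩
  obtain ⟨m, hm, h1, h2⟩ := exists_mem_reach_inter E₁.cover_branching hp hq
  exact ⟨_, ⟨m, hm, rfl⟩, φ.mapPath_mem_reach_iff.2 h1, φ.mapPath_mem_reach_iff.2 h2⟩

/-- A path of `E₂` starting in `E₁` is a path of `E₁`, or leaves `E₁` at some edge. -/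
theorem exists_prefix (q : E₂.Path) {v : E₁.V}
    (hv : φ.vertex v = q.o) : ∃ d : E₁.Path, (φ.mapPath d).o = q.o ∧
      (q = φ.mapPath d ∨ ∃ g l, q.edges = (φ.mapPath d).edges ++ g :: l ∧
        g ∉ Set.range φ.edge) := by
  have key : ∀ l : List E₂.Edge, (∀ e ∈ l, e ∈ Set.range φ.edge) ∨
      ∃ l₁ g l₂, l = l₁ ++ g :: l₂ ∧ (∀ e ∈ l₁, e ∈ Set.range φ.edge) ∧ g ∉ Set.range φ.edge := by
    intro l
    induction l with
    | nil => exact Or.inl fun e he => absurd he List.not_mem_nil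
    | cons e l ih =>
      by_cases he : e ∈ Set.range φ.edge
      · rcases ih with ih | ⟨l₁, g, l₂, rfl, h1, h2⟩
        · exact Or.inl (List.forall_mem_cons.2 ⟨he, ih⟩)
        · exact Or.inr ⟨e :: l₁, g, l₂, rfl, List.forall_mem_cons.2 ⟨he, h1⟩, h2⟩
      · exact Or.inr ⟨[], e, l, rfl, fun e he => absurd he List.not_mem_nil, he⟩
  rcases key q.edges with h | ⟨l₁, g, l₂, h, h1, h2⟩
  · obtain ⟨d, rfl, rfl⟩ := φ.exists_mapPath_eq hv h
    exact ⟨d, rfl, Or.inl rfl⟩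
  · have hw := q.isWalk
    have hn := q.noBacktrack
    rw [h, isWalk_append] at hw
    rw [h] at hn
    obtain ⟨d, _, hd⟩ := φ.exists_mapPath_eq
      (q := ⟨q.o, l₁, hw.1, (List.isChain_append.1 hn).1⟩) hv h1
    refine ⟨d, by rw [hd], Or.inr ⟨g, l₂, ?_, h2⟩⟩
    rw [hd]; exact h

namespace Exits

variable (W : Exits φ S₁ S₂)

open Classical in
/-- The section of the projection: a boundary path of `E₁` is regarded as a path of `E₂`, except that
it is continued by the chosen boundary path if it ends at a vertex of `S₂`. -/
noncomputable def sec (y : E₁.cover.Spectrum) : E₂.cover.Spectrum :=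
  if h : ∃ p : E₁.Path, y.FixedAt p ∧ φ.vertex p.t ∈ S₂ then
    act (φ.mapPath h.choose) (W.point h.choose.t)
  else (φ.isBase_image y).point E₂.cover_branching

theorem sec_of_fixedAt {y : E₁.cover.Spectrum} {p : E₁.Path} (hp : y.FixedAt p)
    (hpS : φ.vertex p.t ∈ S₂) : W.sec y = act (φ.mapPath p) (W.point p.t) := by
  have h : ∃ p : E₁.Path, y.FixedAt p ∧ φ.vertex p.t ∈ S₂ := ⟨p, hp, hpS⟩
  rw [sec, dif_pos h, fixedAt_unique h.choose_spec.1 hp]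

theorem mem_nbhd_sec {y : E₁.cover.Spectrum}
    (h : ¬ ∃ p : E₁.Path, y.FixedAt p ∧ φ.vertex p.t ∈ S₂) {q : E₂.Path} :
    q ∈ (W.sec y).nbhd ↔ ∃ d ∈ y.nbhd, φ.mapPath d ∈ E₂.cover.reach q := by
  rw [sec, dif_neg h, IsBase.mem_nbhd_point]
  simp

theorem base_point {v : E₁.V} (hv : φ.vertex v ∈ S₂) (hv' : v ∉ S₁) :
    φ.vertex v = E₂.base (W.point v) :=
  nbhd_o (p := φ.mapPath (Path.nil v))
    ((W.mem_nbhd_iff v hv hv' _).2 (self_mem_reach (T := E₁.cover) _))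

theorem notMem_of_fixedAt {y : E₁.cover.Spectrum} (hy : y ∈ transversal S₁) {p : E₁.Path}
    (hp : y.FixedAt p) : p.t ∉ S₁ := fun h => (mem_transversal_iff.1 hy).1 p h hp

theorem over_sec {y : E₁.cover.Spectrum} (hy : y ∈ transversal S₁) : φ.Over y (W.sec y) := by
  intro k
  by_cases h : ∃ p : E₁.Path, y.FixedAt p ∧ φ.vertex p.t ∈ S₂
  · obtain ⟨p, hp, hpS⟩ := h
    have hp' := notMem_of_fixedAt hy hp
    rw [W.sec_of_fixedAt hp hpS, hp, mem_nbhd_act (by rw [mapPath_t, W.base_point hpS hp']),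
      mapPath_o, mapPath_o, φ.vertex_injective.eq_iff]
    have key : k.o = p.o → ((φ.mapPath p).inv.mul (φ.mapPath k) ∈ (W.point p.t).nbhd ↔
        p ∈ E₁.cover.reach k) := by
      intro ho
      rw [← mapPath_inv, ← φ.mapPath_mul (by rw [Path.inv_t, ho]), W.mem_nbhd_iff _ hpS hp',
        ← Path.mul_mem_reach_iff (a := p) (by rw [Path.mul_o, Path.inv_o]) rfl, Path.mul_nil,
        Path.mul_inv_cancel_left ho.symm]
    exact ⟨fun h => ⟨(cover_reach_o h).symm, (key (cover_reach_o h).symm).2 h⟩,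
      fun h => (key h.1).1 h.2⟩
  · rw [W.mem_nbhd_sec h]
    refine ⟨fun hk => ⟨k, hk, self_mem_reach (T := E₂.cover) _⟩, ?_⟩
    rintro ⟨d, hd, hdk⟩
    exact mem_nbhd_of_mem_reach hd (φ.mapPath_mem_reach_iff.1 hdk)

theorem sec_mem_transversal {y : E₁.cover.Spectrum} (hy : y ∈ transversal S₁) :
    W.sec y ∈ transversal S₂ := by
  have hyn := (mem_transversal_iff.1 hy).2
  by_cases h : ∃ p : E₁.Path, y.FixedAt p ∧ φ.vertex p.t ∈ S₂
  · obtain ⟨p, hp, hpS⟩ := h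
    have hp' := notMem_of_fixedAt hy hp
    rw [W.sec_of_fixedAt hp hpS, act_mem_transversal_iff
      (by rw [mapPath_t, W.base_point hpS hp']) (W.mem_transversal _ hpS hp'), ← mapPath_inv,
      W.mem_nbhd_iff _ hpS hp', Path.mem_reach_inv_iff rfl, Path.mul_nil]
    exact (Path.mem_reach_nil_iff.1 ((hp _).1 hyn)).1
  · have ho := W.over_sec hy
    refine mem_transversal_iff.2 ⟨fun q hq hfix => ?_, ?_⟩
    · obtain ⟨d, hd, hdq⟩ := (W.mem_nbhd_sec h).1 hfix.self_mem
      have hqd : φ.mapPath d = q := E₂.cover_branching.reach_antisymm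
        ((hfix _).1 ((ho d).1 hd)) hdq
      subst hqd
      rw [mapPath_t] at hq
      refine h ⟨d, fun p => ?_, hq⟩
      rw [ho, hfix, φ.mapPath_mem_reach_iff]
    · rw [ho.base_eq, ← mapPath_nil, ← ho]
      exact hyn

theorem sec_act {y : E₁.cover.Spectrum} (hy : y ∈ transversal S₁) {a : E₁.Path}
    (ha : a.t = E₁.base y) : W.sec (act a y) = act (φ.mapPath a) (W.sec y) := by
  have ho := W.over_sec hy
  have ha' := ho.composable_iff.2 ha
  by_cases h : ∃ p : E₁.Path, y.FixedAt p ∧ φ.vertex p.t ∈ S₂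
  · obtain ⟨p, hp, hpS⟩ := h
    have hp' := notMem_of_fixedAt hy hp
    have hap : a.t = p.o := ha.trans (fixedAt_o hp).symm
    have h1 : (a.mul p).t = p.t := Path.mul_t hap
    rw [W.sec_of_fixedAt hp hpS, W.sec_of_fixedAt (fixedAt_act ha hp) (by rw [h1]; exact hpS), h1,
      φ.mapPath_mul hap, act_act (φ.mapPath_composable.2 hap)]
    rw [mapPath_t, W.base_point hpS hp']
  · have h' : ¬ ∃ p : E₁.Path, (act a y).FixedAt p ∧ φ.vertex p.t ∈ S₂ := by
      rintro ⟨p, hp, hpS⟩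
      have hab : a.inv.t = E₁.base (act a y) := by rw [Path.inv_t, base_act ha]
      have h1 := fixedAt_act hab hp
      rw [act_inv_act ha] at h1
      refine h ⟨_, h1, ?_⟩
      rw [Path.mul_t (hab.trans (fixedAt_o hp).symm)]
      exact hpS
    refine ext_nbhd E₂.cover_branching (Set.ext fun q => ?_)
    rw [W.mem_nbhd_sec h', mem_nbhd_act ha', W.mem_nbhd_sec h]
    constructor
    · rintro ⟨d, hd, hdq⟩
      obtain ⟨hdo, hd⟩ := (mem_nbhd_act ha).1 hd
      have hqo : φ.vertex (Path.o d) = Path.o q := cover_reach_o hdq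
      have hqo' : Path.o q = (φ.mapPath a).o := by rw [← hqo, hdo]; rfl
      refine ⟨hqo', _, hd, ?_⟩
      rw [φ.mapPath_mul (by rw [Path.inv_t, hdo]), mapPath_inv, Path.mul_mem_reach_iff]
      · exact hdq
      · rw [Path.inv_t, hqo']
      · rw [Path.inv_t, mapPath_o, mapPath_o, hdo]
    · rintro ⟨hqo, d, hd, hdq⟩
      have hdo : a.t = Path.o d := ha.trans (nbhd_o hd).symm
      refine ⟨a.mul d, (mul_mem_nbhd_act ha hdo).2 hd, ?_⟩
      rw [← Path.mul_mem_reach_iff (a := φ.mapPath a) (by rw [Path.mul_o, Path.inv_o])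
        (φ.mapPath_composable.2 hdo), Path.mul_inv_cancel_left hqo.symm, ← φ.mapPath_mul hdo] at hdq
      exact hdq

/-- If a directed path `d g q` of `E₂`, with `d` in `E₁` and an edge `g` not in `E₁`, is an initial
segment of `sec y`, then `y` is the finite path `d`, continued at an element of `S₂`. -/
theorem fixedAt_of_mem_nbhd_sec {y : E₁.cover.Spectrum} (hy : y ∈ transversal S₁) {q : E₂.Path}
    (hqd : q.IsDirected) {d : E₁.Path} {g : E₂.Edge} {l : List E₂.Edge}
    (hd : q.edges = (φ.mapPath d).edges ++ g :: l) (hdo : (φ.mapPath d).o = q.o)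
    (hg : g ∉ Set.range φ.edge) (hq : q ∈ (W.sec y).nbhd) :
    y.FixedAt d ∧ φ.vertex d.t ∈ S₂ := by
  have ho := W.over_sec hy
  have hyn := (mem_transversal_iff.1 hy).2
  by_cases h : ∃ p : E₁.Path, y.FixedAt p ∧ φ.vertex p.t ∈ S₂
  · obtain ⟨p, hp, hpS⟩ := h
    suffices hpd : p = d by subst hpd; exact ⟨hp, hpS⟩
    have hpdir := (Path.mem_reach_nil_iff.1 ((hp _).1 hyn)).1
    obtain ⟨m, _, hmp, hmq⟩ := exists_mem_reach_inter E₂.cover_branching ((ho p).1 hp.self_mem) hq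
    obtain ⟨a, ha, hao, rfl⟩ := mem_cover_reach_iff.1 hmp
    obtain ⟨b, hb, hbo, hab⟩ := mem_cover_reach_iff.1 hmq
    have h1 := congrArg Path.edges hab
    rw [(φ.isDirected_mapPath.2 hpdir).mul_edges ha hao, hqd.mul_edges hb hbo, hd,
      List.append_assoc] at h1
    have h2 := congrArg Path.o hab
    rw [Path.mul_o, Path.mul_o, ← hdo] at h2
    -- `d` is not longer than `p`, as both are initial segments of `sec y`
    have hdp : p ∈ E₁.cover.reach d := by
      rw [← hp, ho]
      refine mem_nbhd_of_mem_reach hq (mem_cover_reach_iff.2 ?_)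
      have hw := q.isWalk
      rw [hd, isWalk_append] at hw
      have hdir : ∀ e ∈ g :: l, e ∈ E₂.pos := fun e he =>
        hqd e (by rw [hd]; exact List.mem_append_right _ he)
      have hdd : (φ.mapPath d).IsDirected := fun e he =>
        hqd e (by rw [hd]; exact List.mem_append_left _ he)
      refine ⟨⟨(φ.mapPath d).t, g :: l, ?_, Path.noBacktrack_of_pos hdir⟩, hdir, rfl, ?_⟩
      · rw [Path.t, hdo]; exact hw.2
      · ext1
        · rw [Path.mul_o, hdo]
        · exact hd.trans (Path.IsDirected.mul_edges (q := ⟨(φ.mapPath d).t, g :: l, _, _⟩)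
            hdd hdir rfl).symm
    obtain ⟨c, hc, hco, rfl⟩ := mem_cover_reach_iff.1 hdp
    cases hce : c.edges with
    | nil =>
      have : c = Path.nil d.t := by
        ext1
        · exact hco.symm
        · exact hce
      rw [this, Path.mul_nil]
    | cons e c' =>
      refine absurd ⟨e, ?_⟩ hg
      have hdd : d.IsDirected := by
        rw [← φ.isDirected_mapPath]
        exact fun e he => hqd e (by rw [hd]; exact List.mem_append_left _ he)
      rw [mapPath_edges, hdd.mul_edges hc hco, hce, List.map_append, List.append_assoc,
        ← mapPath_edges] at h1
      exact (List.cons.inj (List.append_cancel_left h1)).1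
  · obtain ⟨k, _, hkq⟩ := (W.mem_nbhd_sec h).1 hq
    obtain ⟨b, hb, hbo, hk⟩ := mem_cover_reach_iff.1 hkq
    refine absurd (φ.mem_range_of_mem_edges (p := k) ?_) hg
    rw [hk, hqd.mul_edges hb hbo, hd]
    simp

/-- Continuity could fail only at the paths which `sec` continues. They end at vertices of
`S₂ ⊆ Σ(E₂)`, which have finite exit valence in `E₁`, and so are isolated points. -/
theorem continuous_sec (hS₂ : S₂ ⊆ E₂.regular) {Z : Type*} [TopologicalSpace Z]
    {f : Z → E₁.cover.Spectrum} (hf : Continuous f) (hfS : ∀ z, f z ∈ transversal S₁) :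
    Continuous fun z => W.sec (f z) := by
  refine continuous_of_isClopen_directed
    (fun z => (mem_transversal_iff.1 (W.sec_mem_transversal (hfS z))).2) fun q hqd => ?_
  by_cases hv : ∃ v, φ.vertex v = q.o
  swap
  · have : {z | q ∈ (W.sec (f z)).nbhd} = ∅ := by
      refine Set.eq_empty_of_forall_notMem fun z hz => hv ⟨E₁.base (f z), ?_⟩
      rw [nbhd_o hz, (W.over_sec (hfS z)).base_eq]
    rw [this]; exact isClopen_empty
  obtain ⟨v, hv⟩ := hv
  obtain ⟨d, hdo, rfl | ⟨g, l, hd, hg⟩⟩ := exists_prefix q hv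
  · have : {z | φ.mapPath d ∈ (W.sec (f z)).nbhd} = f ⁻¹' {y | d ∈ y.nbhd} :=
      Set.ext fun z => ((W.over_sec (hfS z)) d).symm
    rw [this]
    exact (isClopen_nbhd E₁.cover_branching d).preimage hf
  by_cases hS : φ.vertex d.t ∈ S₂ ∧ q ∈ (act (φ.mapPath d) (W.point d.t)).nbhd
  · have hfin : (E₁.out d.t).Finite := by
      refine Set.Finite.of_finite_image ((hS₂ hS.1).2.subset ?_) φ.edge_injective.injOn
      rintro _ ⟨e, he, rfl⟩
      exact ⟨φ.map_pos e he.1, by rw [φ.map_o, he.2]⟩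
    have : {z | q ∈ (W.sec (f z)).nbhd} = f ⁻¹' {y | y.FixedAt d} := by
      ext z
      constructor
      · intro hz
        exact (W.fixedAt_of_mem_nbhd_sec (hfS z) hqd hd hdo hg hz).1
      · intro hz
        change q ∈ (W.sec (f z)).nbhd
        rw [W.sec_of_fixedAt hz hS.1]
        exact hS.2
    rw [this]
    exact (isClopen_fixedAt E₁.cover_branching (cover_out_finite_of_finite hfin)).preimage hf
  · have : {z | q ∈ (W.sec (f z)).nbhd} = ∅ := by
      refine Set.eq_empty_of_forall_notMem fun z hz => hS ?_
      obtain ⟨h1, h2⟩ := W.fixedAt_of_mem_nbhd_sec (hfS z) hqd hd hdo hg hz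
      refine ⟨h2, ?_⟩
      rw [← W.sec_of_fixedAt h1 h2]
      exact hz
    rw [this]; exact isClopen_empty

end Exits

end Inclusion

end DirectedGraph

namespace DirectedGraph

open Spectrum

/-! ### Cosets of `G(E₁)` in `G(E₂)` -/

section Lists

variable {E : DirectedGraph.{u}}

/-- Reduction of the product of two reduced paths cancels a terminal segment of the first one against
an initial segment of the second one. -/
theorem exists_cancel (l m : List E.Edge) (hl : E.NoBacktrack l) (hm : E.NoBacktrack m) :
    ∃ l' k m', l = l' ++ k ∧ m'.Sublist m ∧ l.foldr consRed m = l' ++ m' := by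
  induction l using List.reverseRecOn generalizing m with
  | nil => exact ⟨[], [], m, rfl, List.Sublist.refl m, rfl⟩
  | append_singleton l e ih =>
    have hl' : E.NoBacktrack l := (List.isChain_append.1 hl).1
    by_cases h : ∃ m₀, m = E.rev e :: m₀
    · obtain ⟨m₀, rfl⟩ := h
      obtain ⟨l', k, m', rfl, h1, h2⟩ := ih m₀ hl' hm.tail
      refine ⟨l', k ++ [e], m', by simp, h1.cons _, ?_⟩
      rw [List.foldr_append]
      simp only [List.foldr_cons, List.foldr_nil, consRed, if_pos]
      exact h2
    · refine ⟨l ++ [e], [], m, by simp, List.Sublist.refl _,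
        foldr_eq_append ?_⟩
      refine List.isChain_append.2 ⟨hl, hm, fun x hx f hf hfx => h ?_⟩
      obtain rfl : e = x := by simpa using hx
      cases m with
      | nil => simp at hf
      | cons g m =>
        obtain rfl : g = f := by simpa using hf
        exact ⟨m, by rw [hfx]⟩

namespace Path

/-- If the product `c h` is reduced as it stands, and `m` and `c h m` are directed, then `h m` is
directed. -/
theorem isDirected_mul_of_append {c h m : E.Path} (hch : c.t = h.o) (hhm : h.t = m.o)
    (hred : (c.mul h).edges = c.edges ++ h.edges) (hm : m.IsDirected)
    (hd : ((c.mul h).mul m).IsDirected) : (h.mul m).IsDirected := by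
  obtain ⟨l', k, m', h1, h2, h3⟩ := exists_cancel h.edges m.edges h.noBacktrack m.noBacktrack
  have h4 : (h.mul m).edges = l' ++ m' := (mul_edges hhm).trans h3
  have h5 : ((c.mul h).mul m).edges = c.edges.foldr consRed (l' ++ m') := by
    rw [mul_assoc hch hhm, mul_edges (by rw [mul_o, hch]), h4]
  cases l' with
  | nil =>
    intro e he
    rw [h4] at he
    exact hm e (h2.subset he)
  | cons f l' =>
    have h6 : E.NoBacktrack (c.edges ++ (f :: l') ++ m') := by
      have h7 := (c.mul h).noBacktrack
      have h8 := (h.mul m).noBacktrack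
      rw [hred, h1, ← List.append_assoc] at h7
      rw [h4] at h8
      exact List.IsChain.append_overlap (List.isChain_append.1 h7).1 h8 (List.cons_ne_nil _ _)
    rw [List.append_assoc] at h6
    rw [foldr_eq_append h6] at h5
    intro e he
    refine hd e ?_
    rw [h5, ← h4]
    exact List.mem_append_right _ he

end Path

end Lists

namespace Inclusion

variable {E₁ E₂ : DirectedGraph.{u}} (φ : Inclusion E₁ E₂)

/-- The path is empty or its last edge does not belong to `E₁`. Every coset `b G(E₁)`, with `b`
ending in `E₁`, contains exactly one such path, its shortest element. -/
def IsCosetRep (c : E₂.Path) : Prop := ∀ e ∈ c.edges.getLast?, e ∉ Set.range φ.edge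

variable {φ}

namespace IsCosetRep

variable {c c' : E₂.Path} {k k' : E₁.Path}

theorem mul_edges (hc : φ.IsCosetRep c) (hk : c.t = φ.vertex k.o) :
    (c.mul (φ.mapPath k)).edges = c.edges ++ (φ.mapPath k).edges := by
  rw [Path.mul_edges (q := φ.mapPath k) hk, foldr_eq_append]
  refine noBacktrack_append (φ := φ) c.noBacktrack (φ.mapPath k).noBacktrack fun e he f hf => ?_
  exact iff_of_false (hc e he)
    (not_not.2 (φ.mem_range_of_mem_edges (List.mem_of_mem_head? hf)))

theorem unique (hc : φ.IsCosetRep c) (hk : c.t = φ.vertex k.o) (hc' : φ.IsCosetRep c')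
    (hk' : c'.t = φ.vertex k'.o) (h : c.mul (φ.mapPath k) = c'.mul (φ.mapPath k')) :
    c = c' ∧ k = k' := by
  have aux : ∀ {l₁ l₂ l₁' l₂' : List E₂.Edge}, l₁ ++ l₂ = l₁' ++ l₂' →
      (∀ e ∈ l₂, e ∈ Set.range φ.edge) → (∀ e ∈ l₁'.getLast?, e ∉ Set.range φ.edge) →
      l₁'.length ≤ l₁.length := by
    intro l₁ l₂ l₁' l₂' h h1 h2
    rcases List.append_eq_append_iff.1 h with ⟨t, rfl, rfl⟩ | ⟨t, rfl, rfl⟩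
    · rcases List.eq_nil_or_concat t with rfl | ⟨t, e, rfl⟩
      · simp
      · exact absurd (h1 e (by simp)) (h2 e (by simp))
    · simp
  have he := congrArg Path.edges h
  rw [hc.mul_edges hk, hc'.mul_edges hk'] at he
  have hlen := le_antisymm
    (aux he.symm (fun e he => φ.mem_range_of_mem_edges he) hc)
    (aux he (fun e he => φ.mem_range_of_mem_edges he) hc')
  have hcc : c = c' := by
    ext1
    · have := congrArg Path.o h
      rwa [Path.mul_o, Path.mul_o] at this
    · exact (List.append_inj he hlen).1
  subst hcc
  exact ⟨rfl, φ.mapPath_injective (Path.mul_left_cancel (p := c) hk hk' h)⟩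

end IsCosetRep

theorem exists_cosetRep {b : E₂.Path} (hb : b.t ∈ Set.range φ.vertex) :
    ∃ (c : E₂.Path) (k : E₁.Path), φ.IsCosetRep c ∧ c.t = φ.vertex k.o ∧
      b = c.mul (φ.mapPath k) := by
  obtain ⟨w, hw⟩ := hb
  have key : ∀ l : List E₂.Edge, ∃ l₁ l₂, l = l₁ ++ l₂ ∧ (∀ e ∈ l₂, e ∈ Set.range φ.edge) ∧
      ∀ e ∈ l₁.getLast?, e ∉ Set.range φ.edge := by
    intro l
    induction l using List.reverseRecOn with
    | nil => exact ⟨[], [], rfl, fun e he => absurd he List.not_mem_nil, by simp⟩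
    | append_singleton l e ih =>
      by_cases he : e ∈ Set.range φ.edge
      · obtain ⟨l₁, l₂, rfl, h1, h2⟩ := ih
        refine ⟨l₁, l₂ ++ [e], by simp, fun f hf => ?_, h2⟩
        rcases List.mem_append.1 hf with hf | hf
        · exact h1 f hf
        · rw [List.mem_singleton.1 hf]; exact he
      · exact ⟨l ++ [e], [], by simp, fun e he => absurd he List.not_mem_nil, by simpa using he⟩
  obtain ⟨l₁, l₂, hl, h1, h2⟩ := key b.edges
  have hwalk := b.isWalk
  have hnb := b.noBacktrack
  rw [hl, isWalk_append] at hwalk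
  have hnb' := hnb
  rw [hl] at hnb'
  have hnb'' := List.isChain_append.1 hnb'
  let c : E₂.Path := ⟨b.o, l₁, hwalk.1, hnb''.1⟩
  let r : E₂.Path := ⟨c.t, l₂, hwalk.2, hnb''.2.1⟩
  have hcr : b = c.mul r := by
    ext1
    · rw [Path.mul_o]
    · rw [Path.mul_edges (p := c) (q := r) rfl, foldr_eq_append hnb']
      exact hl
  have hrt : r.inv.o = φ.vertex w := by
    rw [Path.inv_o, hw, hcr, Path.mul_t (p := c) (q := r) rfl]
  obtain ⟨k, hk, hkr⟩ := φ.exists_mapPath_eq hrt.symm (q := r.inv) fun e he => by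
    simp only [Path.inv, List.mem_reverse, List.mem_map] at he
    obtain ⟨f, hf, rfl⟩ := he
    exact φ.rev_mem_range.2 (h1 f hf)
  have hkr' : φ.mapPath k.inv = r := by rw [mapPath_inv, hkr, Path.inv_inv]
  refine ⟨c, k.inv, h2, ?_, by rw [hkr']; exact hcr⟩
  rw [← mapPath_o, hkr']

end Inclusion

namespace ToeplitzGroupoid

open Inclusion

variable {E₁ E₂ : DirectedGraph.{u}} {φ : Inclusion E₁ E₂} {S₁ : Set E₁.V} {S₂ : Set E₂.V}

/-! ### Restriction to the subgraph and its positivity -/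

theorem continuous_ev (f : C_c(E₂.ToeplitzGroupoid S₂, ℂ)) {Z : Type*} [TopologicalSpace Z]
    {g : Z → E₂.cover.Spectrum} (hg : Continuous g) (hgS : ∀ z, g z ∈ transversal S₂)
    {b : E₂.Path} (hb : ∀ z, b.t = E₂.base (g z)) : Continuous fun z => ev f b (g z) := by
  have hc : IsClopen {z | b.inv ∈ (g z).nbhd} :=
    (isClopen_nbhd E₂.cover_branching b.inv).preimage hg
  have hadm : ∀ z, Admissible S₂ b (g z) ↔ b.inv ∈ (g z).nbhd := fun z =>
    admissible_iff (hb z) (hgS z)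
  rw [← continuousOn_univ, ← Set.union_compl_self {z | b.inv ∈ (g z).nbhd}]
  refine ContinuousOn.union_of_isOpen ?_ ?_ hc.isOpen hc.compl.isOpen
  · rw [continuousOn_iff_continuous_domRestrict]
    have h1 : Continuous fun z : {z | b.inv ∈ (g z).nbhd} => ((hadm z.1).2 z.2).elt :=
      continuous_of_comp continuous_const (hg.comp continuous_subtype_val)
    exact (f.continuous.comp h1).congr fun z => (ev_of_admissible f ((hadm z.1).2 z.2)).symm
  · refine continuousOn_const (c := (0 : ℂ)) |>.congr fun z hz => ?_
    exact ev_of_not_admissible fun h => hz ((hadm z).1 h)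

theorem ev_invol_mul_inv {E : DirectedGraph.{u}} {S : Set E.V}
    (f : C_c(E.ToeplitzGroupoid S, ℂ)) {a b : E.Path} {x : E.cover.Spectrum}
    (ha : a.t = E.base x) (hb : b.t = E.base x) :
    ev (invol f) (a.mul b.inv) (act b x) = star (ev f (b.mul a.inv) (act a x)) := by
  have h1 : a.t = b.t := ha.trans hb.symm
  rw [ev_invol f (by rw [Path.mul_t h1, Path.inv_t, base_act hb]), Path.inv_mul_rev h1,
    Path.inv_inv, act_act (by rw [Path.mul_t h1, Path.inv_t]) hb, Path.mul_inv_mul_cancel h1]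

variable (W : Exits φ S₁ S₂) (hS₁ : S₁ ⊆ E₁.regular) (hS₂ : S₂ ⊆ E₂.regular)

open Classical in
/-- The function `(h,y) ↦ f(β h, sec y)`, where `β : P → G(E₂)` is an injection preserving sources,
extended by zero where `h ∉ P`. -/
noncomputable def sample {P : Set E₁.Path} {β : E₁.Path → E₂.Path} (hβ : Set.InjOn β P)
    (hβt : ∀ h ∈ P, (β h).t = φ.vertex h.t) (f : C_c(E₂.ToeplitzGroupoid S₂, ℂ)) :
    C_c(E₁.ToeplitzGroupoid S₁, ℂ) :=
  mkOfPath hS₁ (fun γ => if γ.path ∈ P then ev f (β γ.path) (W.sec γ.point) else 0)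
    (by
      refine continuous_of_path fun h => ?_
      by_cases hP : h ∈ P
      · have h1 : ∀ γ : {γ : E₁.ToeplitzGroupoid S₁ | γ.path = h},
            (β h).t = E₂.base (W.sec γ.1.point) := fun γ => by
          rw [hβt h hP, (W.over_sec γ.1.point_mem).base_eq, ← γ.1.composable, γ.2]
        rw [continuousOn_iff_continuous_domRestrict]
        refine (continuous_ev f (W.continuous_sec hS₂
          (continuous_point.comp continuous_subtype_val) fun γ => γ.1.point_mem)
          (fun γ => W.sec_mem_transversal γ.1.point_mem) h1).congr fun γ => ?_
        have h2 : γ.1.path = h := γ.2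
        simp only [Set.domRestrict_apply, h2, if_pos hP, Function.comp]
      · refine continuousOn_const (c := (0 : ℂ)) |>.congr fun γ hγ => ?_
        rw [if_neg]
        rw [show γ.path = h from hγ]
        exact hP)
    (by
      obtain ⟨B, hB⟩ := exists_finset f
      have hfin : (P ∩ β ⁻¹' (B : Set E₂.Path)).Finite :=
        Set.Finite.of_finite_image (B.finite_toSet.subset (by rintro _ ⟨h, hh, rfl⟩; exact hh.2))
          (hβ.mono Set.inter_subset_left)
      refine ⟨hfin.toFinset, fun γ hγ => hfin.mem_toFinset.2 ?_⟩
      by_cases hP : γ.path ∈ P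
      · rw [if_pos hP] at hγ
        exact ⟨hP, mem_of_ev_ne_zero hB hγ⟩
      · rw [if_neg hP] at hγ
        exact absurd rfl hγ)

/-- Restriction of functions along the embedding `(h,y) ↦ (h, sec y)` of `TG(E₁,S₁)` into
`TG(E₂,S₂)`. -/
noncomputable def restrict (f : C_c(E₂.ToeplitzGroupoid S₂, ℂ)) : C_c(E₁.ToeplitzGroupoid S₁, ℂ) :=
  sample W hS₁ hS₂ (P := Set.univ) φ.mapPath_injective.injOn (fun h _ => φ.mapPath_t h) f

theorem ev_restrict (f : C_c(E₂.ToeplitzGroupoid S₂, ℂ)) (h : E₁.Path) {y : E₁.cover.Spectrum}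
    (hy : y ∈ transversal S₁) :
    ev (restrict W hS₁ hS₂ f) h y = ev f (φ.mapPath h) (W.sec y) := by
  have hadm := admissible_mapPath_iff (a := h) (W.over_sec hy) hy (W.sec_mem_transversal hy)
  by_cases ha : Admissible S₁ h y
  · rw [ev_of_admissible _ ha]
    exact if_pos (Set.mem_univ _)
  · rw [ev_of_not_admissible ha, ev_of_not_admissible (hadm.not.2 ha)]

/-- The function `(h,y) ↦ f(c h, sec y)` on `TG(E₁,S₁)`. -/
noncomputable def cosetFun (c : E₂.Path) (f : C_c(E₂.ToeplitzGroupoid S₂, ℂ)) :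
    C_c(E₁.ToeplitzGroupoid S₁, ℂ) :=
  sample W hS₁ hS₂ (P := {h | c.t = φ.vertex h.o}) (β := fun h => c.mul (φ.mapPath h))
    (fun _ hh _ hh' he => φ.mapPath_injective (Path.mul_left_cancel (p := c) hh hh' he))
    (fun h hh => (Path.mul_t (q := φ.mapPath h) hh).trans (φ.mapPath_t h)) f

/-- If `c h` is reduced as it stands and `(c h, sec y)` is in `TG(E₂,S₂)`, then `(h,y)` is in
`TG(E₁,S₁)`. -/
theorem admissible_of_mul {c : E₂.Path} {h : E₁.Path} {y : E₁.cover.Spectrum}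
    (hc : φ.IsCosetRep c) (hy : y ∈ transversal S₁) (ht : h.t = E₁.base y)
    (hch : c.t = φ.vertex h.o) (ha : Admissible S₂ (c.mul (φ.mapPath h)) (W.sec y)) :
    Admissible S₁ h y := by
  have ho := W.over_sec hy
  have hx := W.sec_mem_transversal hy
  have ht' : (φ.mapPath h).t = E₂.base (W.sec y) := ho.composable_iff.2 ht
  rw [← admissible_mapPath_iff ho hy hx, admissible_iff ht' hx]
  rw [admissible_iff ha.composable hx] at ha
  obtain ⟨m, hm, hmd, hmr⟩ := isDirected_of_nil_mem_nbhd (mem_transversal_iff.1 hx).2 ha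
  have hmo : (φ.mapPath h).t = Path.o m := ht'.trans (nbhd_o hm).symm
  have hcm : (c.mul (φ.mapPath h)).t = Path.o m := (Path.mul_t (q := φ.mapPath h) hch).trans hmo
  refine mem_nbhd_of_mem_reach hm ((Path.mem_reach_inv_iff hmo).2 ?_)
  exact Path.isDirected_mul_of_append (c := c) hch hmo (hc.mul_edges hch) hmd
    ((Path.mem_reach_inv_iff hcm).1 hmr)

theorem ev_cosetFun {c : E₂.Path} (hc : φ.IsCosetRep c) (f : C_c(E₂.ToeplitzGroupoid S₂, ℂ))
    {h : E₁.Path} {y : E₁.cover.Spectrum} (hy : y ∈ transversal S₁) (ht : h.t = E₁.base y)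
    (hch : c.t = φ.vertex h.o) :
    ev (cosetFun W hS₁ hS₂ c f) h y = ev f (c.mul (φ.mapPath h)) (W.sec y) := by
  by_cases ha : Admissible S₁ h y
  · rw [ev_of_admissible _ ha]
    exact if_pos hch
  · rw [ev_of_not_admissible ha, ev_of_not_admissible]
    exact fun h' => ha (admissible_of_mul W hc hy ht hch h')

theorem vertex_eq_of_ev_cosetFun_ne_zero {c : E₂.Path} {f : C_c(E₂.ToeplitzGroupoid S₂, ℂ)}
    {h : E₁.Path} {y : E₁.cover.Spectrum} (hne : ev (cosetFun W hS₁ hS₂ c f) h y ≠ 0) :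
    c.t = φ.vertex h.o := by
  have ha := admissible_of_ev_ne_zero hne
  rw [ev_of_admissible _ ha] at hne
  by_contra hn
  exact hne (if_neg hn)

/-- Positivity of the restriction map: the elements of a convolution square that lie over `E₁` can be
collected according to the cosets of `G(E₁)`. -/
theorem restrict_conv_invol (f : C_c(E₂.ToeplitzGroupoid S₂, ℂ)) : ∃ C : Finset E₂.Path,
    restrict W hS₁ hS₂ (conv (invol f) f) =
      ∑ c ∈ C, conv (invol (cosetFun W hS₁ hS₂ c f)) (cosetFun W hS₁ hS₂ c f) := by
  classical
  obtain ⟨B, hB⟩ := exists_finset f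
  choose c k hc hck hb using fun b : {b : E₂.Path // b.t ∈ Set.range φ.vertex} =>
    exists_cosetRep b.2
  set C := (B.subtype (fun b => b.t ∈ Set.range φ.vertex)).image c with hC
  set K := (B.subtype (fun b => b.t ∈ Set.range φ.vertex)).image k with hK
  have hCrep : ∀ d ∈ C, φ.IsCosetRep d := by
    intro d hd
    obtain ⟨b, _, rfl⟩ := Finset.mem_image.1 hd
    exact hc b
  have htr : ∀ {d : E₂.Path} {h : E₁.Path}, d.t = φ.vertex h.o →
      (d.mul (φ.mapPath h)).t = φ.vertex h.t := fun {d h} hdh =>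
    (Path.mul_t (q := φ.mapPath h) hdh).trans (φ.mapPath_t h)
  -- the pair `(d,h)` is the decomposition of `d h`
  have huniq : ∀ {d : E₂.Path} {h : E₁.Path} (hd : φ.IsCosetRep d) (hdh : d.t = φ.vertex h.o),
      c ⟨d.mul (φ.mapPath h), ⟨h.t, (htr hdh).symm⟩⟩ = d ∧
        k ⟨d.mul (φ.mapPath h), ⟨h.t, (htr hdh).symm⟩⟩ = h := fun {d h} hd hdh =>
    (hc _).unique (hck _) hd hdh (hb _).symm
  have hmem : ∀ {d : E₂.Path} (hd : φ.IsCosetRep d) {h : E₁.Path} {y : E₁.cover.Spectrum},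
      ev (cosetFun W hS₁ hS₂ d f) h y ≠ 0 → d.mul (φ.mapPath h) ∈ B := by
    intro d hd h y hne
    have ha := admissible_of_ev_ne_zero hne
    rw [ev_cosetFun W hS₁ hS₂ hd f ha.point_mem ha.composable
      (vertex_eq_of_ev_cosetFun_ne_zero W hS₁ hS₂ hne)] at hne
    exact mem_of_ev_ne_zero hB hne
  have hmemK : ∀ d ∈ C, ∀ γ, cosetFun W hS₁ hS₂ d f γ ≠ 0 → γ.path ∈ K := by
    intro d hd γ hγ
    rw [← ev_path_point] at hγ
    have hdh := vertex_eq_of_ev_cosetFun_ne_zero W hS₁ hS₂ hγ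
    refine Finset.mem_image.2 ⟨⟨_, ⟨γ.path.t, (htr hdh).symm⟩⟩, ?_, (huniq (hCrep d hd) hdh).2⟩
    exact Finset.mem_subtype.2 (hmem (hCrep d hd) hγ)
  refine ⟨C, ext_ev fun h y ha => ?_⟩
  have hy := ha.point_mem
  have ho := W.over_sec hy
  have hht := ha.composable
  have hht' := ho.composable_iff.2 hht
  have hsum : ∀ (s : Finset E₂.Path) (F : E₂.Path → C_c(E₁.ToeplitzGroupoid S₁, ℂ)),
      ev (∑ d ∈ s, F d) h y = ∑ d ∈ s, ev (F d) h y := by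
    intro s F
    induction s using Finset.induction with
    | empty =>
      rw [Finset.sum_empty, Finset.sum_empty, ev_of_admissible _ ha]
      rfl
    | insert d s hd ih => rw [Finset.sum_insert hd, Finset.sum_insert hd, ev_add, ih]
  rw [ev_restrict W hS₁ hS₂ _ h hy, ev_conv _ hB hht', hsum,
    Finset.sum_congr rfl fun d hd => ev_conv _ (hmemK d hd) hht, ← Finset.sum_product']
  -- the summands for `b = d l` and for the pair `(d,l)` agree
  have hterm : ∀ {d : E₂.Path} (hd : φ.IsCosetRep d) {l : E₁.Path} (hdl : d.t = φ.vertex l.o)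
      (hl : l.t = E₁.base y),
      ev (invol f) ((φ.mapPath h).mul (d.mul (φ.mapPath l)).inv)
          (act (d.mul (φ.mapPath l)) (W.sec y)) * ev f (d.mul (φ.mapPath l)) (W.sec y) =
        ev (invol (cosetFun W hS₁ hS₂ d f)) (h.mul l.inv) (act l y) *
          ev (cosetFun W hS₁ hS₂ d f) l y := by
    intro d hd l hdl hl
    have hlh : l.t = h.inv.o := hl.trans hht.symm
    have hdl' : d.t = φ.vertex (l.mul h.inv).o := by rw [Path.mul_o, hdl]
    rw [ev_invol_mul_inv _ hht' (by rw [htr hdl, hl, ho.base_eq]), ev_invol_mul_inv _ hht hl,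
      ev_cosetFun W hS₁ hS₂ hd f hy hl hdl, ev_cosetFun W hS₁ hS₂ hd f ha.act_mem
        (by rw [Path.mul_t hlh, Path.inv_t, base_act hht]) hdl', W.sec_act hy hht,
      φ.mapPath_mul hlh, mapPath_inv,
      Path.mul_assoc (p := d) (q := φ.mapPath l) hdl
        (by rw [← mapPath_inv, φ.mapPath_composable, hlh])]
  have hbase : ∀ {b : E₂.Path} {x : ℂ}, x * ev f b (W.sec y) ≠ 0 → b.t = φ.vertex (E₁.base y) :=
    fun hne => (admissible_of_ev_ne_zero (right_ne_zero_of_mul hne)).composable.trans ho.base_eq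
  refine Finset.sum_bij_ne_zero (fun b _ hne => (c ⟨b, ⟨E₁.base y, (hbase hne).symm⟩⟩,
    k ⟨b, ⟨E₁.base y, (hbase hne).symm⟩⟩)) ?_ ?_ ?_ ?_
  · intro b hbB hne
    exact Finset.mem_product.2 ⟨Finset.mem_image_of_mem c (Finset.mem_subtype.2 hbB),
      Finset.mem_image_of_mem k (Finset.mem_subtype.2 hbB)⟩
  · intro b hbB hne b' hbB' hne' he
    obtain ⟨he1, he2⟩ := Prod.mk.inj he
    have h1 := hb ⟨b, ⟨E₁.base y, (hbase hne).symm⟩⟩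
    have h2 := hb ⟨b', ⟨E₁.base y, (hbase hne').symm⟩⟩
    rw [he1, he2] at h1
    exact h1.trans h2.symm
  · rintro ⟨d, l⟩ hdl hne
    have hd := hCrep d (Finset.mem_product.1 hdl).1
    have hne2 := right_ne_zero_of_mul hne
    have hdlo := vertex_eq_of_ev_cosetFun_ne_zero W hS₁ hS₂ hne2
    have hl := (admissible_of_ev_ne_zero hne2).composable
    refine ⟨d.mul (φ.mapPath l), hmem hd hne2, ?_, ?_⟩
    · rw [hterm hd hdlo hl]; exact hne
    · exact Prod.ext (huniq hd hdlo).1 (huniq hd hdlo).2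
  · intro b hbB hne
    have hbt := hbase hne
    have h1 := hb ⟨b, ⟨E₁.base y, hbt.symm⟩⟩
    have h2 := hck ⟨b, ⟨E₁.base y, hbt.symm⟩⟩
    have h3 : (k ⟨b, ⟨E₁.base y, hbt.symm⟩⟩).t = E₁.base y := by
      refine φ.vertex_injective ?_
      rw [← htr h2, ← h1]
      exact hbt
    rw [← hterm (hc _) h2 h3, ← h1]

theorem restrict_pull (hS : S₁ = φ.inducedSet S₂) (f : C_c(E₁.ToeplitzGroupoid S₁, ℂ)) :
    restrict W hS₁ hS₂ (pull hS₂ hS f) = f := by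
  refine ext_ev fun h y ha => ?_
  rw [ev_restrict W hS₁ hS₂ _ h ha.point_mem,
    ev_pull hS₂ hS f (W.over_sec ha.point_mem) ha.point_mem (W.sec_mem_transversal ha.point_mem)]

theorem restrict_invol (f : C_c(E₂.ToeplitzGroupoid S₂, ℂ)) :
    restrict W hS₁ hS₂ (invol f) = invol (restrict W hS₁ hS₂ f) := by
  refine ext_ev fun h y ha => ?_
  rw [ev_restrict W hS₁ hS₂ _ h ha.point_mem, ev_invol _ ha.composable,
    ev_invol _ ((W.over_sec ha.point_mem).composable_iff.2 ha.composable),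
    ev_restrict W hS₁ hS₂ _ _ ha.act_mem, mapPath_inv, W.sec_act ha.point_mem ha.composable]

/-- The restriction as a linear map. -/
noncomputable def restrictLin :
    C_c(E₂.ToeplitzGroupoid S₂, ℂ) →ₗ[ℂ] C_c(E₁.ToeplitzGroupoid S₁, ℂ) where
  toFun := restrict W hS₁ hS₂
  map_add' f g := ext_ev fun h y ha => by
    simp only [ev_add, ev_restrict W hS₁ hS₂ _ _ ha.point_mem]
  map_smul' r f := ext_ev fun h y ha => by
    simp only [ev_smul, ev_restrict W hS₁ hS₂ _ _ ha.point_mem, RingHom.id_apply]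

end ToeplitzGroupoid

end DirectedGraph

namespace DirectedGraph

open ToeplitzGroupoid

variable {E₁ E₂ E₃ : DirectedGraph.{u}} {φ : Inclusion E₁ E₂} {S₁ : Set E₁.V} {S₂ : Set E₂.V}

/-! ### Dilation of representations -/

namespace Rep

/-- The positive functional `f ↦ ⟪ξ, ρ(f|) ξ⟫` on the convolution algebra of `E₂` given by a vector
`ξ` of a representation `ρ` of the convolution algebra of `E₁`, where `f|` is the restriction of
`f`. -/
noncomputable def vectorFunctional (W : Inclusion.Exits φ S₁ S₂) (hS₁ : S₁ ⊆ E₁.regular)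
    (hS₂ : S₂ ⊆ E₂.regular) (ρ : Rep S₁) (ξ : ρ.H) : PosFunctional S₂ where
  toLin := (innerSL ℂ ξ).toLinearMap ∘ₗ (ContinuousLinearMap.apply ℂ ρ.H ξ).toLinearMap ∘ₗ
    ρ.π ∘ₗ restrictLin W hS₁ hS₂
  map_invol f := by
    change inner ℂ ξ (ρ.π (restrict W hS₁ hS₂ (invol f)) ξ) =
      star (inner ℂ ξ (ρ.π (restrict W hS₁ hS₂ f) ξ))
    rw [restrict_invol, ρ.map_invol, ContinuousLinearMap.star_eq_adjoint,
      ContinuousLinearMap.adjoint_inner_right]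
    exact (inner_conj_symm _ _).symm
  nonneg f := by
    change 0 ≤ (inner ℂ ξ (ρ.π (restrict W hS₁ hS₂ (conv (invol f) f)) ξ)).re
    obtain ⟨C, hC⟩ := restrict_conv_invol W hS₁ hS₂ f
    rw [hC, map_sum, sum_apply, inner_sum, Complex.re_sum]
    refine Finset.sum_nonneg fun c _ => ?_
    rw [ρ.map_conv, ρ.map_invol, ContinuousLinearMap.star_eq_adjoint, mul_apply_eq_comp,
      ContinuousLinearMap.adjoint_inner_right]
    exact inner_self_nonneg (𝕜 := ℂ)

variable (hS₂ : S₂ ⊆ E₂.regular) (hS : S₁ = φ.inducedSet S₂)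

/-- In the representation given by `vectorFunctional`, the vectors of the functions pulled back from
`E₁` carry a copy of the restriction of `ρ` to the subspace generated by `ξ`. -/
theorem norm_vec_pull (W : Inclusion.Exits φ S₁ S₂) (hS₁ : S₁ ⊆ E₁.regular) (ρ : Rep S₁)
    (ξ : ρ.H) (g : C_c(E₁.ToeplitzGroupoid S₁, ℂ)) :
    ‖(ρ.vectorFunctional W hS₁ hS₂ ξ).vec (pull hS₂ hS g)‖ = ‖ρ.π g ξ‖ := by
  have h1 := (ρ.vectorFunctional W hS₁ hS₂ ξ).norm_sq_vec (pull hS₂ hS g)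
  rw [← pull_invol, ← pull_conv] at h1
  change _ = inner ℂ ξ (ρ.π (restrict W hS₁ hS₂ _) ξ) at h1
  rw [restrict_pull, ρ.map_conv, ρ.map_invol, ContinuousLinearMap.star_eq_adjoint,
    mul_apply_eq_comp, ContinuousLinearMap.adjoint_inner_right,
    inner_self_eq_norm_sq_to_K] at h1
  have h2 : ‖(ρ.vectorFunctional W hS₁ hS₂ ξ).vec (pull hS₂ hS g)‖ ^ 2 = ‖ρ.π g ξ‖ ^ 2 := by
    exact Complex.ofReal_injective (h1.trans (by simp))
  exact (sq_eq_sq₀ (norm_nonneg _) (norm_nonneg _)).1 h2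

theorem norm_le_norm_univRep_pull (ρ : Rep S₁) (f : C_c(E₁.ToeplitzGroupoid S₁, ℂ)) :
    ‖ρ.π f‖ ≤ ‖univRep S₂ (pull hS₂ hS f)‖ := by
  have hS₁ : S₁ ⊆ E₁.regular := hS ▸ φ.inducedSet_subset_regular hS₂
  obtain ⟨W⟩ := Inclusion.exists_exits φ S₁ S₂ hS₂ hS
  set N := ‖univRep S₂ (pull hS₂ hS f)‖ with hN
  have h1 : ∀ (g : C_c(E₁.ToeplitzGroupoid S₁, ℂ)) (ξ : ρ.H),
      ‖ρ.π (conv f g) ξ‖ ≤ N * ‖ρ.π g ξ‖ := by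
    intro g ξ
    rw [← norm_vec_pull hS₂ hS W hS₁ ρ ξ, ← norm_vec_pull hS₂ hS W hS₁ ρ ξ, pull_conv,
      ← PosFunctional.gnsRep_vec]
    refine (ContinuousLinearMap.le_opNorm _ _).trans ?_
    gcongr
    exact lp.norm_apply_le_norm ENNReal.top_ne_zero (univRep S₂ (pull hS₂ hS f)) _
  -- with `g = f*` the estimate says `‖ρ(f) ρ(f)*‖ ≤ N ‖ρ(f)*‖`, that is `‖ρ(f)‖² ≤ N ‖ρ(f)‖`
  have h2 : ‖ρ.π f * star (ρ.π f)‖ ≤ N * ‖ρ.π f‖ := by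
    refine ContinuousLinearMap.opNorm_le_bound _ (by positivity) fun ξ => ?_
    rw [← ρ.map_invol, ← ρ.map_conv]
    refine (h1 _ ξ).trans ?_
    rw [mul_assoc, ρ.map_invol, ← norm_star (ρ.π f)]
    gcongr
    exact ContinuousLinearMap.le_opNorm _ _
  rw [CStarRing.norm_self_mul_star] at h2
  rcases (norm_nonneg (ρ.π f)).eq_or_lt with h | h
  · rw [← h]; positivity
  · exact le_of_mul_le_mul_right h2 h

/-- A representation of the convolution algebra of `E₂`, composed with the pullback of functions. -/
noncomputable def compPull (ρ : Rep S₂) : Rep S₁ where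
  H := ρ.H
  π := ρ.π ∘ₗ
    { toFun := pull hS₂ hS
      map_add' := pull_add hS₂ hS
      map_smul' := pull_smul hS₂ hS }
  map_conv f g := (congrArg ρ.π (pull_conv hS₂ hS f g)).trans (ρ.map_conv _ _)
  map_invol f := (congrArg ρ.π (pull_invol hS₂ hS f)).trans (ρ.map_invol _)

end Rep

/-! ### The homomorphisms between the C*-algebras -/

section Hom

variable (hS₂ : S₂ ⊆ E₂.regular) (hS : S₁ = φ.inducedSet S₂)

/-- The map of bounded families of operators induced by composing representations with the pullback
of functions. -/
noncomputable def lpComp : lp (fun ρ : Rep S₁ => ρ.H →L[ℂ] ρ.H) ∞ →⋆ₙₐ[ℂ]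
    lp (fun ρ : Rep S₂ => ρ.H →L[ℂ] ρ.H) ∞ where
  toFun F := ⟨fun ρ => F (ρ.compPull hS₂ hS), memℓp_infty ⟨‖F‖, by
    rintro _ ⟨ρ, rfl⟩
    exact lp.norm_apply_le_norm ENNReal.top_ne_zero F (ρ.compPull hS₂ hS)⟩⟩
  map_smul' _ _ := rfl
  map_zero' := rfl
  map_add' _ _ := rfl
  map_mul' _ _ := rfl
  map_star' _ := rfl

theorem norm_lpComp_le (F : lp (fun ρ : Rep S₁ => ρ.H →L[ℂ] ρ.H) ∞) :
    ‖lpComp hS₂ hS F‖ ≤ ‖F‖ :=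
  lp.norm_le_of_forall_le (norm_nonneg _) fun ρ =>
    lp.norm_apply_le_norm ENNReal.top_ne_zero F (ρ.compPull hS₂ hS)

theorem continuous_lpComp : Continuous (lpComp hS₂ hS) :=
  AddMonoidHomClass.continuous_of_bound (lpComp hS₂ hS) 1 fun F => by
    rw [one_mul]; exact norm_lpComp_le hS₂ hS F

/-- The homomorphism `TO(E₁,S₁) → TO(E₂,S₂)` which extends the pullback of functions. -/
noncomputable def mapTO : E₁.TO S₁ →⋆ₙₐ[ℂ] E₂.TO S₂ where
  toFun z := ⟨lpComp hS₂ hS z.1,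
    map_mem_closure (continuous_lpComp hS₂ hS) z.2 (by
      rintro _ ⟨f, rfl⟩
      exact ⟨pull hS₂ hS f, rfl⟩)⟩
  map_smul' c z := Subtype.ext ((lpComp hS₂ hS).map_smul' c z.1)
  map_zero' := Subtype.ext (map_zero (lpComp hS₂ hS))
  map_add' z w := Subtype.ext (map_add (lpComp hS₂ hS) z.1 w.1)
  map_mul' z w := Subtype.ext (map_mul (lpComp hS₂ hS) z.1 w.1)
  map_star' z := Subtype.ext (map_star (lpComp hS₂ hS) z.1)

theorem continuous_mapTO : Continuous (mapTO hS₂ hS) :=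
  ((continuous_lpComp hS₂ hS).comp continuous_subtype_val).subtype_mk _

theorem denseRange_toTO {E : DirectedGraph.{u}} (S : Set E.V) :
    DenseRange (toTO : C_c(E.ToeplitzGroupoid S, ℂ) → E.TO S) := by
  intro z
  refine closure_subtype.2 ?_
  have h : Subtype.val '' Set.range (toTO : C_c(E.ToeplitzGroupoid S, ℂ) → E.TO S) =
      (toeplitzRange S : Set _) := by
    exact (Set.range_comp Subtype.val (toTO : C_c(E.ToeplitzGroupoid S, ℂ) → E.TO S)).symm
  exact h.symm ▸ z.2

theorem norm_le_norm_mapTO (z : E₁.TO S₁) : ‖z‖ ≤ ‖mapTO hS₂ hS z‖ := by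
  refine (denseRange_toTO S₁).induction_on (p := fun z => ‖z‖ ≤ ‖mapTO hS₂ hS z‖) z
    (isClosed_le continuous_norm (continuous_mapTO hS₂ hS).norm) fun f => ?_
  exact lp.norm_le_of_forall_le (f := univRep S₁ f) (norm_nonneg _) fun ρ =>
    ρ.norm_le_norm_univRep_pull hS₂ hS f

theorem mapTO_injective : Function.Injective (mapTO hS₂ hS) :=
  (injective_iff_map_eq_zero _).2 fun z hz => by
    have h := norm_le_norm_mapTO hS₂ hS z
    rwa [hz, norm_zero, norm_le_zero_iff] at h

theorem mapTO_vertexProj (hS₁ : S₁ ⊆ E₁.regular) (v : E₁.V) :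
    mapTO hS₂ hS (vertexProj hS₁ v) = vertexProj hS₂ (φ.vertex v) :=
  congrArg toTO (pull_charFun hS₂ hS hS₁ (Path.nil v))

theorem mapTO_edgeIsom (hS₁ : S₁ ⊆ E₁.regular) (e : E₁.Edge) :
    mapTO hS₂ hS (edgeIsom hS₁ e) = edgeIsom hS₂ (φ.edge e) :=
  congrArg toTO ((pull_charFun hS₂ hS hS₁ (Path.single e)).trans
    (congrArg (charFun hS₂) (φ.mapPath_single e)))

theorem mapTO_id {E : DirectedGraph.{u}} {S : Set E.V} (hS : S ⊆ E.regular)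
    (h : S = (Inclusion.id E).inducedSet S) :
    mapTO hS h = NonUnitalStarAlgHom.id ℂ (E.TO S) :=
  DFunLike.coe_injective <| (denseRange_toTO S).equalizer (continuous_mapTO hS h) continuous_id <|
    funext fun f => congrArg toTO (pull_id hS h f)

theorem mapTO_comp {ψ : Inclusion E₂ E₃} {S₃ : Set E₃.V} (hS₃ : S₃ ⊆ E₃.regular)
    (hS' : S₂ = ψ.inducedSet S₃) (hS'' : S₁ = (ψ.comp φ).inducedSet S₃) :
    mapTO hS₃ hS'' = (mapTO hS₃ hS').comp (mapTO hS₂ hS) :=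
  DFunLike.coe_injective <| (denseRange_toTO S₁).equalizer (continuous_mapTO hS₃ hS'')
    ((continuous_mapTO hS₃ hS').comp (continuous_mapTO hS₂ hS)) <|
    funext fun f => congrArg toTO (pull_comp hS₂ hS hS₃ hS' hS'' f)

end Hom

end DirectedGraph

open CategoryTheory in
theorem theorem2p34 :
    ∃ Φ : ∀ {P Q : GraphPair.{u}}, (P ⟶ Q) → (P.E.TO P.S →⋆ₙₐ[ℂ] Q.E.TO Q.S),
      (∀ {P Q : GraphPair.{u}} (φ : P ⟶ Q), Function.Injective (Φ φ)) ∧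
      (∀ {P Q : GraphPair.{u}} (φ : P ⟶ Q) (v : P.E.V),
        Φ φ (DirectedGraph.vertexProj P.subset v) =
          DirectedGraph.vertexProj Q.subset (φ.incl.vertex v)) ∧
      (∀ {P Q : GraphPair.{u}} (φ : P ⟶ Q), ∀ e ∈ P.E.pos,
        Φ φ (DirectedGraph.edgeIsom P.subset e) =
          DirectedGraph.edgeIsom Q.subset (φ.incl.edge e)) ∧
      (∀ P : GraphPair.{u}, Φ (𝟙 P) = NonUnitalStarAlgHom.id ℂ (P.E.TO P.S)) ∧
      (∀ {P Q R : GraphPair.{u}} (φ : P ⟶ Q) (ψ : Q ⟶ R),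
        Φ (φ ≫ ψ) = (Φ ψ).comp (Φ φ)) :=
  ⟨fun {_ Q} φ => DirectedGraph.mapTO Q.subset φ.eq_inducedSet,
    fun _ => DirectedGraph.mapTO_injective _ _,
    fun {P _} _ v => DirectedGraph.mapTO_vertexProj _ _ P.subset v,
    fun {P _} _ e _ => DirectedGraph.mapTO_edgeIsom _ _ P.subset e,
    fun P => DirectedGraph.mapTO_id P.subset _,
    fun {_ Q _} φ ψ => DirectedGraph.mapTO_comp Q.subset φ.eq_inducedSet _ ψ.eq_inducedSet _⟩
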